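/- Let $d \ge 5$ be an odd integer, let $\mathbb{B}^d$ be the open unit ball in $\mathbb{R}^d$, and put $$V(r) = -\frac{8(d-3)(d-4)}{(d-4+r^2)^2}, \qquad W(y) = (1-|y|^2)^{\frac{3-d}{2}} \quad (y \in \mathbb{B}^d).$$ **The Sturm–Liouville operator $T$.** For $r \in (0,1)$ let $w(r) = (1-r^2)^{-2}$ and $$q(r) = -\left[\frac{\frac{(d-3)(d-1)}{4} - r^2\,\frac{3d-9}{2}}{r^2(1-r^2)^2} + \frac{V(r)}{1-r^2}\right], \qquad \tau g = -\frac1w\left(g'' + q\,g\right).$$ In the Hilbert space $H_w$ of (classes of) functions $g:(0,1)\to\mathbb{C}$ with $\int_0^1 |g|^2 w\,dr < \infty$, let $T u = \tau u$ with domain $D(T) = \{u \in H_w : u, u' \in AC_{\mathrm{loc}}(0,1),\ \tau u \in H_w\}$. **The operator $L$.** Let $C^\infty_{\mathrm{rad}}(\overline{\mathbb{B}^d})$ be the space of radially symmetric smooth functions $\mathbb{B}^d \to \mathbb{C}$ all of whose partial derivatives are bounded, and $C^\infty_{\mathrm{rad}}(\overline{\mathbb{B}^d};W) = \{f \in C^\infty_{\mathrm{rad}}(\overline{\mathbb{B}^d})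 : Wf \in C^\infty_{\mathrm{rad}}(\overline{\mathbb{B}^d})\}$. For an integer $k \ge 1$ let $\mathcal{H}^k$ be the completion of $C^\infty_{\mathrm{rad}}(\overline{\mathbb{B}^d};W)^2$ with respect to the norm $$\|(f_1,f_2)\|^2 = \|W f_1\|_{H^k(\mathbb{B}^d)}^2 + \|W f_2\|_{H^{k-1}(\mathbb{B}^d)}^2, \qquad \|h\|_{H^k(\mathbb{B}^d)}^2 = \sum_{|\alpha|\le k}\|\partial^\alpha h\|_{L^2(\mathbb{B}^d)}^2.$$ With $\Lambda = y^j\partial_{y^j}$, define $L_0$ on the domain $C^\infty_{\mathrm{rad}}(\overline{\mathbb{B}^d};W)^2 \subset \mathcal{H}^k$ by $L_0 f = W^{-1}\left(L_0^* - (d-2)\right) W f$ (with $W^{\pm 1}$ acting on both components by multiplication), where $$L_0^*(g_1,g_2) = \left(g_2 - \Lambda g_1,\ -\Lambda g_2 - g_2 + \Delta g_1\right).$$ Let $\overline{L_0}$ be its closure in $\mathcal{H}^k$, let $L'$ be the bounded operator on $\mathcal{H}^k$ extending $(f_1,f_2)\mapsto(0,-V(|\cdot|) f_1)$, and let $L =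 \overline{L_0} + L'$ with domain $D(L) = D(\overline{L_0})$. **Statement (mode stability).** 1. $T$ is self-adjoint in $H_w$. 2. $T$ has no eigenvalue $\mu < 0$. 3. For every integer $k \ge 1$, the operator $L$ on $\mathcal{H}^k$ has no eigenvalue $\lambda \in \mathbb{C}$ with $\operatorname{Re}\lambda > -1$. -/

import Mathlib

open MeasureTheory Set Topology Filter
open scoped ContDiff ENNReal

namespace HypWaveMap

noncomputable section

/-! ### Eigenvalues of unbounded operators -/

/-- `z` is an eigenvalue of the unbounded operator `A`: there is a nonzero `u ∈ D(A)` with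
`A u = z u`. -/
def HasEigenvalue {H : Type*} [AddCommGroup H] [Module ℂ H] (A : H →ₗ.[ℂ] H) (z : ℂ) : Prop :=
  ∃ u : A.domain, (u : H) ≠ 0 ∧ A u = z • (u : H)

/-- The radial profile of the potential, `V(r) = -8(d-3)(d-4) / (d-4+r²)²`. -/
def potential (d : ℕ) (r : ℝ) : ℝ :=
  -(8 * ((d : ℝ) - 3) * ((d : ℝ) - 4)) / ((d : ℝ) - 4 + r ^ 2) ^ 2

/-! ### The singular Sturm–Liouville operator `T` -/

/-- The weight `w(r) = 1 / (1 - r²)²`. -/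
def slWeight (r : ℝ) : ℝ := 1 / (1 - r ^ 2) ^ 2

/-- The coefficient
`q(r) = -[ ((d-3)(d-1)/4 - r² (3d-9)/2) / (r² (1-r²)²) + V(r) / (1-r²) ]`. -/
def slCoeff (d : ℕ) (r : ℝ) : ℝ :=
  -((((d : ℝ) - 3) * ((d : ℝ) - 1) / 4 - r ^ 2 * ((3 * (d : ℝ) - 9) / 2)) /
      (r ^ 2 * (1 - r ^ 2) ^ 2) + potential d r / (1 - r ^ 2))

/-- The formal differential expression `τ g = -(1/w) (g'' + q g)`. -/
def slTau (d : ℕ) (g : ℝ → ℂ) (r : ℝ) : ℂ :=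
  -((1 / slWeight r : ℝ) : ℂ) * (deriv (deriv g) r + (slCoeff d r : ℂ) * g r)

/-- The measure `w(r) dr` on the interval `(0,1)`. -/
def slMeasure : Measure ℝ :=
  (volume.restrict (Ioo (0 : ℝ) 1)).withDensity fun r => ENNReal.ofReal (slWeight r)

/-- The Hilbert space of (classes of) functions `g : (0,1) → ℂ` with `√w g ∈ L²(0,1)`, that is,
with `∫₀¹ |g|² w dr < ∞`. -/
abbrev SLSpace : Type := Lp ℂ 2 slMeasure

/-- `g ∈ AC_loc(0,1)`: absolutely continuous on every compact subinterval of `(0,1)`. -/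
def ACLoc (g : ℝ → ℂ) : Prop :=
  ∀ a b : ℝ, 0 < a → a ≤ b → b < 1 → AbsolutelyContinuousOnInterval g a b

/-- `g ∈ AC_loc(0,1)` and `g' ∈ AC_loc(0,1)`; in particular `g` is differentiable in `(0,1)`. -/
structure SLRegular (g : ℝ → ℂ) : Prop where
  ac : ACLoc g
  diff : DifferentiableOn ℝ g (Ioo 0 1)
  ac_deriv : ACLoc (deriv g)

lemma ACLoc.continuousOn {g : ℝ → ℂ} (h : ACLoc g) : ContinuousOn g (Ioo 0 1) := by
  intro x hx
  have h1 : ContinuousOn g (uIcc (x / 2) ((x + 1) / 2)) :=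
    (h (x / 2) ((x + 1) / 2) (by linarith [hx.1]) (by linarith [hx.1, hx.2])
      (by linarith [hx.2])).continuousOn
  rw [uIcc_of_le (by linarith [hx.1, hx.2])] at h1
  exact (h1.continuousAt (Icc_mem_nhds (by linarith [hx.1]) (by linarith [hx.2]))).continuousWithinAt

lemma ACLoc.ae_differentiableAt {g : ℝ → ℂ} (h : ACLoc g) :
    ∀ᵐ r ∂(volume.restrict (Ioo (0 : ℝ) 1)), DifferentiableAt ℝ g r := by
  have key : ∀ n : ℕ, ∀ᵐ r : ℝ, r ∈ uIcc (1 / ((n : ℝ) + 2)) (1 - 1 / ((n : ℝ) + 2)) →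
      DifferentiableAt ℝ g r := by
    intro n
    have hn : (0 : ℝ) < 1 / ((n : ℝ) + 2) := by positivity
    have hn2 : 1 / ((n : ℝ) + 2) ≤ 1 / 2 :=
      one_div_le_one_div_of_le (by norm_num) (by linarith [Nat.cast_nonneg (α := ℝ) n])
    exact (h _ _ hn (by linarith) (by linarith)).boundedVariationOn.ae_differentiableAt_of_mem_uIcc
  rw [ae_restrict_iff' measurableSet_Ioo]
  filter_upwards [ae_all_iff.2 key] with r hr hr01
  obtain ⟨n, hn⟩ := exists_nat_one_div_lt (lt_min hr01.1 (sub_pos.2 hr01.2))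
  have hlt : 1 / ((n : ℝ) + 2) ≤ 1 / ((n : ℝ) + 1) :=
    one_div_le_one_div_of_le (by positivity) (by linarith)
  have h1 := lt_min_iff.1 hn
  apply hr n
  rw [mem_uIcc]
  left
  constructor <;> linarith [h1.1, h1.2]

lemma slWeight_pos {r : ℝ} (hr : r ∈ Ioo (0 : ℝ) 1) : 0 < slWeight r := by
  have : 0 < 1 - r ^ 2 := by nlinarith [hr.1, hr.2]
  unfold slWeight
  positivity

lemma slMeasure_ac : slMeasure ≪ volume.restrict (Ioo (0 : ℝ) 1) :=
  withDensity_absolutelyContinuous _ _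

lemma ac_slMeasure : volume.restrict (Ioo (0 : ℝ) 1) ≪ slMeasure := by
  apply withDensity_absolutelyContinuous'
  · apply Measurable.aemeasurable
    unfold slWeight
    fun_prop
  · rw [ae_restrict_iff' measurableSet_Ioo]
    filter_upwards with r hr
    simpa using slWeight_pos hr

lemma ACLoc.congr {g h : ℝ → ℂ} (hg : ACLoc g) (e : EqOn g h (Ioo 0 1)) : ACLoc h := by
  intro a b h0 hab h1
  have key := hg a b h0 hab h1
  have hsub : uIcc a b ⊆ Ioo 0 1 := by
    rw [uIcc_of_le hab]
    exact fun x hx => ⟨h0.trans_le hx.1, hx.2.trans_lt h1⟩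
  rw [absolutelyContinuousOnInterval_iff] at key ⊢
  intro ε hε
  obtain ⟨δ, hδ, H⟩ := key ε hε
  refine ⟨δ, hδ, fun E hE hlt => ?_⟩
  have := H E hE hlt
  rwa [Finset.sum_congr rfl fun i hi => ?_] at this
  rw [e (hsub (hE.1 i hi).1), e (hsub (hE.1 i hi).2)]

lemma SLRegular.deriv_add {g h : ℝ → ℂ} (hg : SLRegular g) (hh : SLRegular h) :
    EqOn (deriv (g + h)) (deriv g + deriv h) (Ioo 0 1) := fun _ hr =>
  _root_.deriv_add (hg.diff.differentiableAt (isOpen_Ioo.mem_nhds hr))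
    (hh.diff.differentiableAt (isOpen_Ioo.mem_nhds hr))

lemma deriv_smul_eq (c : ℂ) (g : ℝ → ℂ) : deriv (c • g) = c • deriv g := by
  funext r
  exact deriv_const_mul_field c

lemma SLRegular.add {g h : ℝ → ℂ} (hg : SLRegular g) (hh : SLRegular h) :
    SLRegular (g + h) where
  ac a b h0 hab h1 := (hg.ac a b h0 hab h1).add (hh.ac a b h0 hab h1)
  diff := hg.diff.add hh.diff
  ac_deriv := ACLoc.congr
    (fun a b h0 hab h1 => (hg.ac_deriv a b h0 hab h1).add (hh.ac_deriv a b h0 hab h1))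
    (hg.deriv_add hh).symm

lemma SLRegular.smul {g : ℝ → ℂ} (c : ℂ) (hg : SLRegular g) : SLRegular (c • g) where
  ac a b h0 hab h1 := (hg.ac a b h0 hab h1).const_smul c
  diff := hg.diff.const_smul c
  ac_deriv := by
    rw [deriv_smul_eq]
    exact fun a b h0 hab h1 => (hg.ac_deriv a b h0 hab h1).const_smul c

lemma slTau_add (d : ℕ) {g h : ℝ → ℂ} (hg : SLRegular g) (hh : SLRegular h) :
    slTau d (g + h) =ᵐ[slMeasure] slTau d g + slTau d h := by
  apply slMeasure_ac.ae_eq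
  filter_upwards [hg.ac_deriv.ae_differentiableAt, hh.ac_deriv.ae_differentiableAt,
    ae_restrict_mem measurableSet_Ioo] with r h1 h2 hr
  have e : deriv (deriv (g + h)) r = deriv (deriv g) r + deriv (deriv h) r := by
    rw [← _root_.deriv_add h1 h2]
    exact ((hg.deriv_add hh).eventuallyEq_of_mem (isOpen_Ioo.mem_nhds hr)).deriv_eq
  simp only [slTau, e, Pi.add_apply]
  ring

lemma slTau_smul (d : ℕ) (c : ℂ) (g : ℝ → ℂ) : slTau d (c • g) = c • slTau d g := by
  funext r
  simp only [slTau, deriv_smul_eq, Pi.smul_apply, smul_eq_mul]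
  ring

lemma slTau_congr (d : ℕ) {g h : ℝ → ℂ} (e : EqOn g h (Ioo 0 1)) :
    EqOn (slTau d g) (slTau d h) (Ioo 0 1) := by
  intro r hr
  have h1 : g =ᶠ[𝓝 r] h := e.eventuallyEq_of_mem (isOpen_Ioo.mem_nhds hr)
  simp only [slTau, e hr, h1.deriv.deriv_eq]

/-- The graph of `T`: the pairs `(u, v)` of elements of `L²((0,1);√w)` such that `u` has a
representative `g` with `g, g' ∈ AC_loc(0,1)` and `v = τ g`. -/
def slGraph (d : ℕ) : Submodule ℂ (SLSpace × SLSpace) where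
  carrier := {p | ∃ g : ℝ → ℂ, SLRegular g ∧ p.1 =ᵐ[slMeasure] g ∧ p.2 =ᵐ[slMeasure] slTau d g}
  zero_mem' := by
    refine ⟨(0 : ℂ) • (fun _ => 0), SLRegular.smul 0 ⟨?_, differentiableOn_const 0, ?_⟩, ?_, ?_⟩
    · intro a b _ _ _
      simp [absolutelyContinuousOnInterval_iff]
      exact fun ε hε => ⟨1, one_pos, fun _ _ _ _ => hε⟩
    · intro a b _ _ _
      simp [absolutelyContinuousOnInterval_iff]
      exact fun ε hε => ⟨1, one_pos, fun _ _ _ _ => hε⟩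
    · rw [zero_smul]
      exact Lp.coeFn_zero _ _ _
    · rw [slTau_smul, zero_smul]
      exact Lp.coeFn_zero _ _ _
  add_mem' := by
    rintro p p' ⟨g, hg, h1, h2⟩ ⟨g', hg', h1', h2'⟩
    refine ⟨g + g', hg.add hg', ?_, ?_⟩
    · exact (Lp.coeFn_add p.1 p'.1).trans (h1.add h1')
    · exact (Lp.coeFn_add p.2 p'.2).trans ((h2.add h2').trans (slTau_add d hg hg').symm)
  smul_mem' := by
    rintro c p ⟨g, hg, h1, h2⟩
    refine ⟨c • g, hg.smul c, ?_, ?_⟩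
    · exact (Lp.coeFn_smul c p.1).trans (h1.const_smul c)
    · rw [slTau_smul]
      exact (Lp.coeFn_smul c p.2).trans (h2.const_smul c)

lemma slGraph_singleValued (d : ℕ) (p : SLSpace × SLSpace) (hp : p ∈ slGraph d)
    (h0 : p.1 = 0) : p.2 = 0 := by
  obtain ⟨g, hg, h1, h2⟩ := hp
  rw [h0] at h1
  have e : EqOn g 0 (Ioo 0 1) :=
    Measure.eqOn_open_of_ae_eq (ac_slMeasure.ae_eq (h1.symm.trans (Lp.coeFn_zero _ _ _)))
      isOpen_Ioo hg.ac.continuousOn continuousOn_const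
  have e2 : slTau d g =ᵐ[slMeasure] 0 := by
    apply slMeasure_ac.ae_eq
    filter_upwards [ae_restrict_mem measurableSet_Ioo] with r hr
    rw [slTau_congr d e hr]
    have : slTau d (0 : ℝ → ℂ) = 0 := by simpa using slTau_smul d 0 0
    rw [this]
  exact Lp.ext (h2.trans (e2.trans (Lp.coeFn_zero _ _ _).symm))

/-- The operator `T u = τ u` in `L²((0,1);√w)` with maximal domain
`D(T) = {u ∈ L²((0,1);√w) | u, u' ∈ AC_loc(0,1), τ u ∈ L²((0,1);√w)}`. -/
def slOperator (d : ℕ) : SLSpace →ₗ.[ℂ] SLSpace := (slGraph d).toLinearPMap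

lemma mem_slOperator_graph (d : ℕ) (p : SLSpace × SLSpace) :
    p ∈ (slOperator d).graph ↔ p ∈ slGraph d := by
  rw [slOperator, Submodule.toLinearPMap_graph_eq _ (slGraph_singleValued d)]

/-! ### Smooth functions on the closed unit ball -/

/-- Euclidean space `ℝ^d`. -/
abbrev Euc (d : ℕ) : Type := EuclideanSpace ℝ (Fin d)

/-- The open unit ball `𝔹^d`. -/
abbrev unitBall (d : ℕ) : Set (Euc d) := Metric.ball 0 1

/-- `f` is smooth on `𝔹^d` and all its derivatives (of all orders) are bounded on `𝔹^d`. -/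
def BddSmooth {d : ℕ} {F : Type*} [NormedAddCommGroup F] [NormedSpace ℝ F] (f : Euc d → F) :
    Prop :=
  ContDiffOn ℝ ∞ f (unitBall d) ∧
    ∀ n : ℕ, ∃ C : ℝ, ∀ x ∈ unitBall d, ‖iteratedFDeriv ℝ n f x‖ ≤ C

lemma eventuallyEq_of_eqOn_ball {d : ℕ} {F : Type*} {f g : Euc d → F} (h : EqOn f g (unitBall d)) {x : Euc d}
    (hx : x ∈ unitBall d) : f =ᶠ[𝓝 x] g :=
  h.eventuallyEq_of_mem (Metric.isOpen_ball.mem_nhds hx)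

section BddSmooth

variable {d : ℕ} {F : Type*} [NormedAddCommGroup F] [NormedSpace ℝ F]
  {G : Type*} [NormedAddCommGroup G] [NormedSpace ℝ G]

lemma BddSmooth.contDiffAt {f : Euc d → F} (hf : BddSmooth f) {x : Euc d} (hx : x ∈ unitBall d)
    {n : ℕ∞} : ContDiffAt ℝ n f x :=
  (hf.1.contDiffAt (Metric.isOpen_ball.mem_nhds hx)).of_le (by exact_mod_cast le_top)

lemma BddSmooth.differentiableAt {f : Euc d → F} (hf : BddSmooth f) {x : Euc d}
    (hx : x ∈ unitBall d) : DifferentiableAt ℝ f x :=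
  (hf.contDiffAt (n := 1) hx).differentiableAt (by simp)

lemma BddSmooth.congr {f g : Euc d → F} (hf : BddSmooth f) (h : EqOn g f (unitBall d)) :
    BddSmooth g := by
  refine ⟨hf.1.congr h, fun n => ?_⟩
  obtain ⟨C, hC⟩ := hf.2 n
  refine ⟨C, fun x hx => ?_⟩
  rw [((eventuallyEq_of_eqOn_ball h hx).iteratedFDeriv ℝ n).eq_of_nhds]
  exact hC x hx

lemma BddSmooth.indicator {f : Euc d → F} (hf : BddSmooth f) :
    BddSmooth ((unitBall d).indicator f) :=
  hf.congr fun _ hx => indicator_of_mem hx f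

lemma BddSmooth.of_contDiff {f : Euc d → F} (hf : ContDiff ℝ ∞ f) : BddSmooth f := by
  refine ⟨hf.contDiffOn, fun n => ?_⟩
  obtain ⟨C, hC⟩ := (isCompact_closedBall (0 : Euc d) 1).exists_bound_of_continuousOn
    (hf.continuous_iteratedFDeriv (m := n) (by exact_mod_cast le_top)).continuousOn
  exact ⟨C, fun x hx => hC x (Metric.ball_subset_closedBall hx)⟩

lemma BddSmooth.add {f g : Euc d → F} (hf : BddSmooth f) (hg : BddSmooth g) :
    BddSmooth (f + g) := by
  refine ⟨hf.1.add hg.1, fun n => ?_⟩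
  obtain ⟨C, hC⟩ := hf.2 n
  obtain ⟨C', hC'⟩ := hg.2 n
  refine ⟨C + C', fun x hx => ?_⟩
  rw [iteratedFDeriv_add_apply (hf.contDiffAt (n := n) hx) (hg.contDiffAt (n := n) hx)]
  exact (norm_add_le _ _).trans (add_le_add (hC x hx) (hC' x hx))

lemma BddSmooth.clm_comp {f : Euc d → F} (hf : BddSmooth f) (A : F →L[ℝ] G) :
    BddSmooth (A ∘ f) := by
  refine ⟨A.contDiff.comp_contDiffOn hf.1, fun n => ?_⟩
  obtain ⟨C, hC⟩ := hf.2 n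
  refine ⟨‖A‖ * C, fun x hx => ?_⟩
  refine (A.norm_iteratedFDeriv_comp_left (hf.contDiffAt (n := n) hx) le_rfl).trans ?_
  gcongr
  exact hC x hx

lemma BddSmooth.mul {f g : Euc d → ℂ} (hf : BddSmooth f) (hg : BddSmooth g) :
    BddSmooth (fun x => f x * g x) := by
  refine ⟨hf.1.mul hg.1, fun n => ?_⟩
  choose C hC using hf.2
  choose C' hC' using hg.2
  refine ⟨∑ i ∈ Finset.range (n + 1), (n.choose i : ℝ) * C i * C' (n - i), fun x hx => ?_⟩
  have hs : UniqueDiffOn ℝ (unitBall d) := Metric.isOpen_ball.uniqueDiffOn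
  have key := norm_iteratedFDerivWithin_mul_le hf.1 hg.1 hs hx (n := n)
    (by exact_mod_cast le_top)
  have ho := fun (j : ℕ) (h : Euc d → ℂ) =>
    iteratedFDerivWithin_of_isOpen (𝕜 := ℝ) (f := h) j (Metric.isOpen_ball) hx
  simp only [ho] at key
  refine key.trans (Finset.sum_le_sum fun i _ => ?_)
  have h1 := hC i x hx
  have h2 := hC' (n - i) x hx
  have h0 : 0 ≤ C i := (norm_nonneg _).trans h1
  gcongr

lemma BddSmooth.fderiv {f : Euc d → F} (hf : BddSmooth f) : BddSmooth (fderiv ℝ f) := by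
  refine ⟨hf.1.fderiv_of_isOpen Metric.isOpen_ball (by simp), fun n => ?_⟩
  obtain ⟨C, hC⟩ := hf.2 (n + 1)
  exact ⟨C, fun x hx => by rw [norm_iteratedFDeriv_fderiv]; exact hC x hx⟩

lemma BddSmooth.fderiv_apply {f : Euc d → F} (hf : BddSmooth f) (v : Euc d) :
    BddSmooth (fun x => _root_.fderiv ℝ f x v) :=
  hf.fderiv.clm_comp (ContinuousLinearMap.apply ℝ F v)

lemma BddSmooth.sum {ι : Type*} (s : Finset ι) {f : ι → Euc d → F}
    (hf : ∀ i ∈ s, BddSmooth (f i)) : BddSmooth (fun x => ∑ i ∈ s, f i x) := by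
  classical
  induction s using Finset.induction_on with
  | empty => simpa using BddSmooth.of_contDiff (d := d) (contDiff_const (c := (0 : F)))
  | insert a s ha ih =>
    simp only [Finset.sum_insert ha]
    exact (hf a (Finset.mem_insert_self a s)).add
      (ih fun i hi => hf i (Finset.mem_insert_of_mem hi))

end BddSmooth

/-- The space `C^∞(closure 𝔹^d)` of smooth complex-valued functions on `𝔹^d` all of whose
derivatives are bounded on `𝔹^d`. A function on `𝔹^d` is represented by its extension by zero
to `ℝ^d`; only values and derivatives at points of the open ball are ever used. -/
def CInfty (d : ℕ) : Submodule ℂ (Euc d → ℂ) where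
  carrier := {f | BddSmooth f ∧ ∀ x, x ∉ unitBall d → f x = 0}
  zero_mem' := ⟨BddSmooth.of_contDiff contDiff_const, fun _ _ => rfl⟩
  add_mem' := fun {f g} hf hg => ⟨hf.1.add hg.1, fun x hx => by simp [hf.2 x hx, hg.2 x hx]⟩
  smul_mem' := fun c f hf =>
    ⟨(BddSmooth.of_contDiff (contDiff_const (c := c))).mul hf.1, fun x hx => by simp [hf.2 x hx]⟩

/-- The subspace `C^∞_rad(closure 𝔹^d)` of radially symmetric functions. -/
def CInftyRad (d : ℕ) : Submodule ℂ (Euc d → ℂ) where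
  carrier := {f | f ∈ CInfty d ∧ ∀ x y : Euc d, ‖x‖ = ‖y‖ → f x = f y}
  zero_mem' := ⟨zero_mem _, fun _ _ _ => rfl⟩
  add_mem' := fun {f g} hf hg =>
    ⟨add_mem hf.1 hg.1, fun x y h => by simp [hf.2 x y h, hg.2 x y h]⟩
  smul_mem' := fun c f hf =>
    ⟨Submodule.smul_mem _ c hf.1, fun x y h => by simp [hf.2 x y h]⟩

/-- The weight `W(y) = (1 - |y|²)^((3-d)/2)`. -/
def weightW (d : ℕ) (y : Euc d) : ℝ := (1 - ‖y‖ ^ 2) ^ ((3 - (d : ℝ)) / 2)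

/-- The space `C^∞_rad(closure 𝔹^d; W)` of those `f ∈ C^∞_rad(closure 𝔹^d)` with
`W f ∈ C^∞_rad(closure 𝔹^d)`. -/
def CInftyRadW (d : ℕ) : Submodule ℂ (Euc d → ℂ) where
  carrier := {f | f ∈ CInftyRad d ∧ (fun y => (weightW d y : ℂ) * f y) ∈ CInftyRad d}
  zero_mem' := ⟨zero_mem _, by
    simp only [Pi.zero_apply, mul_zero]
    exact zero_mem (CInftyRad d)⟩
  add_mem' := fun {f g} hf hg => ⟨add_mem hf.1 hg.1, by
    simpa [mul_add] using! add_mem hf.2 hg.2⟩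
  smul_mem' := fun c f hf => ⟨Submodule.smul_mem _ c hf.1, by
    simpa [mul_left_comm] using! Submodule.smul_mem _ c hf.2⟩

lemma indicator_mem_CInfty {d : ℕ} {f : Euc d → ℂ} (hf : BddSmooth f) :
    (unitBall d).indicator f ∈ CInfty d :=
  ⟨hf.indicator, fun _ hx => indicator_of_notMem hx f⟩

/-- The inclusion `C^∞_rad(closure 𝔹^d) → C^∞(closure 𝔹^d)`. -/
def radIncl (d : ℕ) : CInftyRad d →ₗ[ℂ] CInfty d :=
  Submodule.inclusion fun _ hf => hf.1

/-! ### Differential operators on smooth functions -/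

/-- The partial derivative `∂_i` on `C^∞(closure 𝔹^d)`. -/
def pderiv {d : ℕ} (i : Fin d) : CInfty d →ₗ[ℂ] CInfty d where
  toFun f := ⟨(unitBall d).indicator fun x => fderiv ℝ (f : Euc d → ℂ) x
      (EuclideanSpace.single i 1), indicator_mem_CInfty (f.2.1.fderiv_apply _)⟩
  map_add' f g := by
    ext x
    by_cases hx : x ∈ unitBall d
    · simp [hx, fderiv_add (f.2.1.differentiableAt hx) (g.2.1.differentiableAt hx),
        -Metric.mem_ball]
    · simp [hx, -Metric.mem_ball]
  map_smul' c f := by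
    ext x
    by_cases hx : x ∈ unitBall d
    · simp [hx, fderiv_const_smul (f.2.1.differentiableAt hx),
        -Metric.mem_ball]
    · simp [hx, -Metric.mem_ball]

/-- The partial derivative `∂^α = ∂_1^{α_1} ⋯ ∂_d^{α_d}` of multi-index `α`. -/
def mderiv {d : ℕ} (α : Fin d → ℕ) : CInfty d →ₗ[ℂ] CInfty d :=
  ((List.finRange d).map fun i => (pderiv i : Module.End ℂ (CInfty d)) ^ α i).prod

/-- Multiplication by a smooth function with bounded derivatives on `C^∞(closure 𝔹^d)`. -/
def smoothMul {d : ℕ} (m : Euc d → ℂ) (hm : BddSmooth m) : CInfty d →ₗ[ℂ] CInfty d where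
  toFun f := ⟨fun x => m x * (f : Euc d → ℂ) x, hm.mul f.2.1,
    fun x hx => by simp [f.2.2 x hx]⟩
  map_add' f g := by ext x; simp [mul_add]
  map_smul' c f := by ext x; simp [mul_left_comm]

lemma exists_isometry_of_norm_eq {d : ℕ} {x y : Euc d} (h : ‖x‖ = ‖y‖) :
    ∃ R : Euc d ≃ₗᵢ[ℝ] Euc d, R x = y :=
  ⟨_, Submodule.reflection_sub h⟩

lemma rad_comp_isometry {d : ℕ} (f : CInftyRad d) (R : Euc d ≃ₗᵢ[ℝ] Euc d) :
    (f : Euc d → ℂ) ∘ R = f := by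
  funext x
  exact f.2.2 _ _ (R.norm_map x)

lemma indicator_radial {d : ℕ} {f : Euc d → ℂ}
    (hf : ∀ (R : Euc d ≃ₗᵢ[ℝ] Euc d) (x : Euc d), f (R x) = f x) (x y : Euc d) (h : ‖x‖ = ‖y‖) :
    (unitBall d).indicator f x = (unitBall d).indicator f y := by
  obtain ⟨R, rfl⟩ := exists_isometry_of_norm_eq h
  by_cases hx : x ∈ unitBall d
  · have hy : R x ∈ unitBall d := by simpa using hx
    rw [indicator_of_mem hx, indicator_of_mem hy, hf]
  · have hy : R x ∉ unitBall d := by simpa using hx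
    rw [indicator_of_notMem hx, indicator_of_notMem hy]

/-- The operator `Λ f(y) = y^k ∂_k f(y)` on `C^∞_rad(closure 𝔹^d)`. -/
def radLambda (d : ℕ) : CInftyRad d →ₗ[ℂ] CInftyRad d where
  toFun f := ⟨(unitBall d).indicator fun x => fderiv ℝ (f : Euc d → ℂ) x x, by
    refine ⟨indicator_mem_CInfty ?_, indicator_radial fun R x => ?_⟩
    · have : BddSmooth fun x : Euc d => ∑ i, ((x i : ℝ) : ℂ) *
          fderiv ℝ (f : Euc d → ℂ) x (EuclideanSpace.single i 1) := by
        refine BddSmooth.sum _ fun i _ => BddSmooth.mul ?_ (f.2.1.1.fderiv_apply _)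
        exact BddSmooth.of_contDiff (Complex.ofRealCLM.contDiff.comp
          (EuclideanSpace.proj (𝕜 := ℝ) i).contDiff)
      refine this.congr fun x _ => ?_
      have hx : x = ∑ i, x i • EuclideanSpace.single i (1 : ℝ) := by
        have := (EuclideanSpace.basisFun (Fin d) ℝ).sum_repr x
        simpa using this.symm
      have h3 := congrArg (fderiv ℝ (f : Euc d → ℂ) x) hx
      rw [map_sum] at h3
      simpa using h3
    · have h := R.toContinuousLinearEquiv.comp_right_fderiv (f := (f : Euc d → ℂ)) (x := x)
      have h2 : (f : Euc d → ℂ) ∘ R.toContinuousLinearEquiv = f := rad_comp_isometry f R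
      rw [h2] at h
      rw [h]
      simp⟩
  map_add' f g := by
    ext x
    by_cases hx : x ∈ unitBall d
    · simp [hx, fderiv_add (f.2.1.1.differentiableAt hx) (g.2.1.1.differentiableAt hx),
        -Metric.mem_ball]
    · simp [hx, -Metric.mem_ball]
  map_smul' c f := by
    ext x
    by_cases hx : x ∈ unitBall d
    · simp [hx, fderiv_const_smul (f.2.1.1.differentiableAt hx),
        -Metric.mem_ball]
    · simp [hx, -Metric.mem_ball]

/-- The Laplace operator `Δ` on `C^∞_rad(closure 𝔹^d)`. -/
def radLaplacian (d : ℕ) : CInftyRad d →ₗ[ℂ] CInftyRad d where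
  toFun f := ⟨(unitBall d).indicator (Laplacian.laplacian (f : Euc d → ℂ)), by
    refine ⟨indicator_mem_CInfty ?_, indicator_radial fun R x => ?_⟩
    · rw [InnerProductSpace.laplacian_eq_iteratedFDeriv_orthonormalBasis _
        (EuclideanSpace.basisFun (Fin d) ℝ)]
      simp only [iteratedFDeriv_two_apply]
      refine BddSmooth.sum _ fun i _ => ?_
      exact (f.2.1.1.fderiv.fderiv_apply _).clm_comp (ContinuousLinearMap.apply ℝ ℂ _)
    · have h2 : (f : Euc d → ℂ) ∘ R.toContinuousLinearEquiv = f := rad_comp_isometry f R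
      have key : ∀ v : Euc d, iteratedFDeriv ℝ 2 (f : Euc d → ℂ) x ![v, v] =
          iteratedFDeriv ℝ 2 (f : Euc d → ℂ) (R x) ![R v, R v] := by
        intro v
        have h := R.toContinuousLinearEquiv.iteratedFDerivWithin_comp_right (f : Euc d → ℂ)
          uniqueDiffOn_univ (x := x) (mem_univ _) 2
        rw [preimage_univ, iteratedFDerivWithin_univ, iteratedFDerivWithin_univ, h2] at h
        rw [h, ContinuousMultilinearMap.compContinuousLinearMap_apply]
        congr 1
        ext j : 1
        fin_cases j <;> rfl
      refine (congrFun (InnerProductSpace.laplacian_eq_iteratedFDeriv_orthonormalBasis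
        (f : Euc d → ℂ) ((EuclideanSpace.basisFun (Fin d) ℝ).map R)) (R x)).trans ?_
      refine Eq.trans ?_ (congrFun (InnerProductSpace.laplacian_eq_iteratedFDeriv_orthonormalBasis
        (f : Euc d → ℂ) (EuclideanSpace.basisFun (Fin d) ℝ)) x).symm
      simp only [key, OrthonormalBasis.map_apply]⟩
  map_add' f g := by
    ext x
    by_cases hx : x ∈ unitBall d
    · simp [hx, (f.2.1.1.contDiffAt (n := 2) hx).laplacian_add
        (g.2.1.1.contDiffAt (n := 2) hx), -Metric.mem_ball]
    · simp [hx, -Metric.mem_ball]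
  map_smul' c f := by
    ext x
    by_cases hx : x ∈ unitBall d
    · simp [hx, InnerProductSpace.laplacian_smul c (f.2.1.1.contDiffAt (n := 2) hx),
        -Metric.mem_ball]
    · simp [hx, -Metric.mem_ball]

/-! ### Weights and potential as operators -/

/-- The potential `V(y) = -8(d-3)(d-4) / (d-4+|y|²)²` as a function on `𝔹^d`. -/
def potentialV (d : ℕ) (y : Euc d) : ℂ := (potential d ‖y‖ : ℂ)

lemma potentialV_bddSmooth {d : ℕ} (hd : 5 ≤ d) : BddSmooth (potentialV d) := by
  apply BddSmooth.of_contDiff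
  refine Complex.ofRealCLM.contDiff.comp
    (?_ : ContDiff ℝ ∞ fun y : Euc d =>
      -(8 * ((d : ℝ) - 3) * ((d : ℝ) - 4)) / ((d : ℝ) - 4 + ‖y‖ ^ 2) ^ 2)
  have hd' : (5 : ℝ) ≤ d := by exact_mod_cast hd
  refine contDiff_const.div ((contDiff_const.add (contDiff_norm_sq ℝ)).pow 2) fun x => ?_
  have : 0 < (d : ℝ) - 4 + ‖x‖ ^ 2 := by nlinarith [sq_nonneg ‖x‖]
  positivity

lemma one_sub_normSq_pos {d : ℕ} {y : Euc d} (hy : y ∈ unitBall d) : 0 < 1 - ‖y‖ ^ 2 := by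
  have : ‖y‖ < 1 := by simpa using hy
  nlinarith [norm_nonneg y]

/-- For odd `d ≥ 3` the reciprocal `1/W` is a polynomial in `|y|²` on the ball. -/
lemma inv_weightW_bddSmooth {d : ℕ} (hd : 3 ≤ d) (ho : Odd d) :
    BddSmooth fun y : Euc d => ((weightW d y : ℂ))⁻¹ := by
  obtain ⟨m, rfl⟩ : ∃ m, d = 2 * m + 3 := by
    obtain ⟨n, hn⟩ := ho
    exact ⟨n - 1, by omega⟩
  have h1 : BddSmooth fun y : Euc (2 * m + 3) => (((1 - ‖y‖ ^ 2) ^ m : ℝ) : ℂ) := by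
    apply BddSmooth.of_contDiff
    exact Complex.ofRealCLM.contDiff.comp ((contDiff_const.sub (contDiff_norm_sq ℝ)).pow m)
  refine h1.congr fun y hy => ?_
  have hp := one_sub_normSq_pos hy
  have e : (3 - ((2 * m + 3 : ℕ) : ℝ)) / 2 = -(m : ℝ) := by push_cast; ring
  simp only [weightW, e, Real.rpow_neg hp.le, Real.rpow_natCast]
  push_cast
  rw [inv_inv]

lemma weightW_radial {d : ℕ} {x y : Euc d} (h : ‖x‖ = ‖y‖) : weightW d x = weightW d y := by
  simp [weightW, h]

lemma weightW_ne_zero {d : ℕ} {y : Euc d} (hy : y ∈ unitBall d) : (weightW d y : ℂ) ≠ 0 := by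
  exact_mod_cast (Real.rpow_pos_of_pos (one_sub_normSq_pos hy) _).ne'

/-- Multiplication by `W`, as a map `C^∞_rad(closure 𝔹^d; W) → C^∞_rad(closure 𝔹^d)`. -/
def mulW (d : ℕ) : CInftyRadW d →ₗ[ℂ] CInftyRad d where
  toFun f := ⟨fun y => (weightW d y : ℂ) * (f : Euc d → ℂ) y, f.2.2⟩
  map_add' f g := by ext x; simp [mul_add]
  map_smul' c f := by ext x; simp [mul_left_comm]

/-- Multiplication by `W⁻¹`, as a map `C^∞_rad(closure 𝔹^d) → C^∞_rad(closure 𝔹^d; W)`. -/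
def mulWInv {d : ℕ} (hd : 3 ≤ d) (ho : Odd d) : CInftyRad d →ₗ[ℂ] CInftyRadW d where
  toFun h := ⟨fun y => ((weightW d y : ℂ))⁻¹ * (h : Euc d → ℂ) y, by
    refine ⟨⟨⟨(inv_weightW_bddSmooth hd ho).mul h.2.1.1, fun x hx => by simp [h.2.1.2 x hx]⟩,
      fun x y e => by simp only [weightW_radial e, h.2.2 x y e]⟩, ?_⟩
    convert h.2 using 1
    funext y
    by_cases hy : y ∈ unitBall d
    · rw [mul_inv_cancel_left₀ (weightW_ne_zero hy)]
    · simp [h.2.1.2 y hy]⟩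
  map_add' f g := by ext x; simp [mul_add]
  map_smul' c f := by ext x; simp [mul_left_comm]

/-- Multiplication by the potential `V` on `C^∞_rad(closure 𝔹^d; W)`. -/
def mulV {d : ℕ} (hd : 5 ≤ d) : CInftyRadW d →ₗ[ℂ] CInftyRadW d where
  toFun f := ⟨fun y => potentialV d y * (f : Euc d → ℂ) y, by
    have key : ∀ h : CInftyRad d, (fun y => potentialV d y * (h : Euc d → ℂ) y) ∈ CInftyRad d :=
      fun h => ⟨⟨(potentialV_bddSmooth hd).mul h.2.1.1, fun x hx => by simp [h.2.1.2 x hx]⟩,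
        fun x y e => by simp only [potentialV]; rw [e, h.2.2 x y e]⟩
    refine ⟨key ⟨_, f.2.1⟩, ?_⟩
    convert key (mulW d f) using 1
    funext y
    simp only [mulW, LinearMap.coe_mk, AddHom.coe_mk]
    ring⟩
  map_add' f g := by ext x; simp [mul_add]
  map_smul' c f := by ext x; simp [mul_left_comm]

/-! ### Sobolev norms -/

/-- Lebesgue measure on the ball `𝔹^d`. -/
def ballMeasure (d : ℕ) : Measure (Euc d) := volume.restrict (unitBall d)

lemma CInfty_memLp {d : ℕ} (f : CInfty d) : MemLp (f : Euc d → ℂ) 2 (ballMeasure d) := by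
  obtain ⟨C, hC⟩ := f.2.1.2 0
  have : IsFiniteMeasure (ballMeasure d) :=
    ⟨by rw [ballMeasure, Measure.restrict_apply_univ]; exact measure_ball_lt_top⟩
  refine MemLp.of_bound (f.2.1.1.continuousOn.aestronglyMeasurable measurableSet_ball) C ?_
  rw [ballMeasure, ae_restrict_iff' measurableSet_ball]
  filter_upwards with x hx
  simpa using hC x hx

/-- The inclusion `C^∞(closure 𝔹^d) → L²(𝔹^d)`. -/
def toL2 (d : ℕ) : CInfty d →ₗ[ℂ] Lp ℂ 2 (ballMeasure d) where
  toFun f := (CInfty_memLp f).toLp f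
  map_add' _ _ := rfl
  map_smul' _ _ := rfl

lemma toL2_injective (d : ℕ) : Function.Injective (toL2 d) := by
  rw [← LinearMap.ker_eq_bot, LinearMap.ker_eq_bot']
  intro f hf
  have h1 : (f : Euc d → ℂ) =ᵐ[ballMeasure d] 0 := by
    have h2 : (toL2 d f : Euc d → ℂ) =ᵐ[ballMeasure d] f := (CInfty_memLp f).coeFn_toLp
    rw [hf] at h2
    exact h2.symm.trans (Lp.coeFn_zero _ _ _)
  have h3 := Measure.eqOn_open_of_ae_eq h1 Metric.isOpen_ball f.2.1.1.continuousOn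
    continuousOn_const
  ext x
  by_cases hx : x ∈ unitBall d
  · exact h3 hx
  · exact f.2.2 x hx

/-- Multi-indices `α ∈ ℕ₀^d` with `|α| ≤ k`. -/
abbrev MIdx (d k : ℕ) : Type := {α : Fin d → Fin (k + 1) // ∑ i, (α i : ℕ) ≤ k}

/-- The Hilbert space `⊕_{|α| ≤ k} L²(𝔹^d)`. -/
abbrev JetSpace (d k : ℕ) : Type := PiLp 2 fun _ : MIdx d k => Lp ℂ 2 (ballMeasure d)

/-- The map `f ↦ (∂^α f)_{|α| ≤ k}`, so that
`‖jet d k f‖² = ∑_{|α| ≤ k} ‖∂^α f‖²_{L²(𝔹^d)} = ‖f‖²_{H^k(𝔹^d)}`. -/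
def jet (d k : ℕ) : CInfty d →ₗ[ℂ] JetSpace d k where
  toFun f := WithLp.toLp 2 fun α => toL2 d (mderiv (fun i => (α.1 i : ℕ)) f)
  map_add' f g := by ext1 α; simp
  map_smul' c f := by ext1 α; simp

lemma norm_jet_sq (d k : ℕ) (f : CInfty d) :
    ‖jet d k f‖ ^ 2 = ∑ α : MIdx d k, ‖toL2 d (mderiv (fun i => (α.1 i : ℕ)) f)‖ ^ 2 :=
  PiLp.norm_sq_eq_of_L2 _ _

lemma norm_toL2_mderiv_le {d k : ℕ} (β : Fin d → ℕ) (hβ : ∑ i, β i ≤ k) (f : CInfty d) :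
    ‖toL2 d (mderiv β f)‖ ≤ ‖jet d k f‖ := by
  have hb : ∀ i, β i < k + 1 := fun i =>
    Nat.lt_succ_of_le ((Finset.single_le_sum (fun _ _ => Nat.zero_le _)
      (Finset.mem_univ i)).trans hβ)
  exact PiLp.norm_apply_le (jet d k f) (⟨fun i => ⟨β i, hb i⟩, hβ⟩ : MIdx d k)

lemma jet_injective (d k : ℕ) : Function.Injective (jet d k) := by
  rw [← LinearMap.ker_eq_bot, LinearMap.ker_eq_bot']
  intro f hf
  have h := norm_toL2_mderiv_le (k := k) (fun _ : Fin d => 0) (by simp) f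
  rw [hf, norm_zero, norm_le_zero_iff] at h
  have e : mderiv (fun _ : Fin d => 0) f = f := by simp [mderiv]
  rw [e] at h
  exact toL2_injective d (h.trans (map_zero _).symm)

lemma norm_jet_mono {d k l : ℕ} (h : k ≤ l) (f : CInfty d) : ‖jet d k f‖ ≤ ‖jet d l f‖ := by
  rw [← sq_le_sq₀ (norm_nonneg _) (norm_nonneg _), norm_jet_sq, norm_jet_sq]
  let e : MIdx d k → MIdx d l := fun α =>
    ⟨fun i => ⟨α.1 i, (α.1 i).2.trans_le (Nat.succ_le_succ h)⟩, α.2.trans h⟩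
  have he : Function.Injective e := by
    intro α β hab
    ext i
    have := congrArg (fun γ : MIdx d l => (γ.1 i : ℕ)) hab
    simpa [e] using this
  rw [← Finset.sum_image (s := Finset.univ) (g := e)
    (f := fun α : MIdx d l => ‖toL2 d (mderiv (fun i => (α.1 i : ℕ)) f)‖ ^ 2) he.injOn]
  exact Finset.sum_le_sum_of_subset_of_nonneg (Finset.subset_univ _) fun _ _ _ => sq_nonneg _

/-! ### Multiplication by smooth functions is bounded in the Sobolev norms -/

/-- The operators `∑ m_j ∂^{β_j}` with `β_j ≤ α`, where only the indices in the list `L` are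
differentiated. -/
def leibnizSpan {d : ℕ} (L : List (Fin d)) (α : Fin d → ℕ) :
    AddSubmonoid (Module.End ℂ (CInfty d)) :=
  AddSubmonoid.closure {A | ∃ (m : Euc d → ℂ) (hm : BddSmooth m) (β : Fin d → ℕ), β ≤ α ∧
    A = (smoothMul m hm : Module.End ℂ (CInfty d)) *
      (L.map fun i => (pderiv i : Module.End ℂ (CInfty d)) ^ β i).prod}

lemma pderiv_smoothMul {d : ℕ} (i : Fin d) (m : Euc d → ℂ) (hm : BddSmooth m) :
    (pderiv i : Module.End ℂ (CInfty d)) * smoothMul m hm =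
      smoothMul _ (hm.fderiv_apply (EuclideanSpace.single i 1)) + smoothMul m hm * pderiv i := by
  ext f x
  by_cases hx : x ∈ unitBall d
  · have h := fderiv_mul (hm.differentiableAt hx) (f.2.1.differentiableAt hx)
    simp only [Pi.mul_def] at h
    simp [pderiv, smoothMul, hx, -Metric.mem_ball, h]
    ring
  · simp [pderiv, smoothMul, hx, -Metric.mem_ball, f.2.2 x hx]

lemma pderiv_pow_smoothMul {d : ℕ} (i : Fin d) (n : ℕ) (m : Euc d → ℂ) (hm : BddSmooth m) :
    (pderiv i : Module.End ℂ (CInfty d)) ^ n * smoothMul m hm ∈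
      AddSubmonoid.closure {A : Module.End ℂ (CInfty d) | ∃ (m : Euc d → ℂ) (hm : BddSmooth m)
        (q : ℕ), q ≤ n ∧ A = (smoothMul m hm : Module.End ℂ (CInfty d)) * pderiv i ^ q} := by
  induction n generalizing m with
  | zero => exact AddSubmonoid.subset_closure ⟨m, hm, 0, le_rfl, by simp⟩
  | succ n ih =>
    rw [pow_succ, mul_assoc, pderiv_smoothMul, mul_add]
    refine add_mem (AddSubmonoid.closure_mono ?_ (ih _ _)) ?_
    · rintro A ⟨m', hm', q, hq, rfl⟩
      exact ⟨m', hm', q, hq.trans (Nat.le_succ n), rfl⟩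
    · rw [← mul_assoc]
      refine AddSubmonoid.closure_induction (motive := fun A _ => A * pderiv i ∈ _)
        ?_ ?_ ?_ (ih m hm)
      · rintro A ⟨m', hm', q, hq, rfl⟩
        exact AddSubmonoid.subset_closure ⟨m', hm', q + 1, Nat.succ_le_succ hq, by
          rw [pow_succ, mul_assoc]⟩
      · rw [zero_mul]; exact zero_mem _
      · intro A B _ _ hA hB
        rw [add_mul]; exact add_mem hA hB

lemma list_prod_smoothMul {d : ℕ} (L : List (Fin d)) (hL : L.Nodup) (α : Fin d → ℕ)
    (m : Euc d → ℂ) (hm : BddSmooth m) :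
    (L.map fun i => (pderiv i : Module.End ℂ (CInfty d)) ^ α i).prod * smoothMul m hm ∈
      leibnizSpan L α := by
  induction L with
  | nil => exact AddSubmonoid.subset_closure ⟨m, hm, α, le_rfl, by simp⟩
  | cons i L ih =>
    obtain ⟨hi, hL'⟩ := List.nodup_cons.1 hL
    rw [List.map_cons, List.prod_cons, mul_assoc]
    refine AddSubmonoid.closure_induction
      (motive := fun A _ => (pderiv i : Module.End ℂ (CInfty d)) ^ α i * A ∈ leibnizSpan (i :: L) α)
      ?_ ?_ ?_ (ih hL')
    · rintro A ⟨m', hm', β, hβ, rfl⟩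
      rw [← mul_assoc]
      refine AddSubmonoid.closure_induction
        (motive := fun A _ => A * (L.map fun i => (pderiv i : Module.End ℂ (CInfty d)) ^ β i).prod ∈
          leibnizSpan (i :: L) α) ?_ ?_ ?_ (pderiv_pow_smoothMul i (α i) m' hm')
      · rintro A ⟨m'', hm'', q, hq, rfl⟩
        refine AddSubmonoid.subset_closure ⟨m'', hm'', Function.update β i q, ?_, ?_⟩
        · intro j
          by_cases hj : j = i
          · subst hj; simpa using hq
          · simpa [hj] using hβ j
        · rw [List.map_cons, List.prod_cons, Function.update_self, mul_assoc]
          congr 3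
          refine List.map_congr_left fun j hj => ?_
          have : j ≠ i := fun e => hi (e ▸ hj)
          rw [Function.update_of_ne this]
      · rw [zero_mul]; exact zero_mem _
      · intro A B _ _ hA hB
        rw [add_mul]; exact add_mem hA hB
    · rw [mul_zero]; exact zero_mem _
    · intro A B _ _ hA hB
      rw [mul_add]; exact add_mem hA hB

lemma norm_toL2_smoothMul_le {d : ℕ} (m : Euc d → ℂ) (hm : BddSmooth m) :
    ∃ C : ℝ, ∀ f : CInfty d, ‖toL2 d (smoothMul m hm f)‖ ≤ C * ‖toL2 d f‖ := by
  obtain ⟨C, hC⟩ := hm.2 0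
  refine ⟨C, fun f => ?_⟩
  refine Lp.norm_le_mul_norm_of_ae_le_mul ?_
  have h1 : (toL2 d f : Euc d → ℂ) =ᵐ[ballMeasure d] f := (CInfty_memLp f).coeFn_toLp
  have h2 : (toL2 d (smoothMul m hm f) : Euc d → ℂ) =ᵐ[ballMeasure d] smoothMul m hm f :=
    (CInfty_memLp _).coeFn_toLp
  have h3 : ∀ᵐ x ∂(ballMeasure d), x ∈ unitBall d := ae_restrict_mem measurableSet_ball
  filter_upwards [h1, h2, h3] with x e1 e2 hx
  rw [e1, e2]
  have := hC x hx
  rw [norm_iteratedFDeriv_zero] at this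
  simp only [smoothMul, LinearMap.coe_mk, AddHom.coe_mk, norm_mul]
  gcongr

lemma norm_jet_smoothMul_le {d : ℕ} (k : ℕ) (m : Euc d → ℂ) (hm : BddSmooth m) :
    ∃ C : ℝ, 0 ≤ C ∧ ∀ f : CInfty d, ‖jet d k (smoothMul m hm f)‖ ≤ C * ‖jet d k f‖ := by
  have span : ∀ (α : Fin d → ℕ), ∑ i, α i ≤ k → ∀ A ∈ leibnizSpan (List.finRange d) α,
      ∃ C : ℝ, ∀ f : CInfty d, ‖toL2 d (A f)‖ ≤ C * ‖jet d k f‖ := by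
    intro α hα A hA
    induction hA using AddSubmonoid.closure_induction with
    | mem A hA =>
      obtain ⟨m', hm', β, hβ, rfl⟩ := hA
      obtain ⟨C, hC⟩ := norm_toL2_smoothMul_le m' hm'
      refine ⟨max C 0, fun f => ?_⟩
      have h1 : ‖toL2 d (mderiv β f)‖ ≤ ‖jet d k f‖ :=
        norm_toL2_mderiv_le β ((Finset.sum_le_sum fun i _ => hβ i).trans hα) f
      have h2 := hC (mderiv β f)
      have h3 := h2.trans (mul_le_mul (le_max_left C 0) h1 (norm_nonneg _) (le_max_right C 0))
      exact h3
    | zero => exact ⟨0, fun f => by simp⟩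
    | add A B _ _ hA hB =>
      obtain ⟨C, hC⟩ := hA
      obtain ⟨C', hC'⟩ := hB
      refine ⟨C + C', fun f => ?_⟩
      rw [LinearMap.add_apply, map_add, add_mul]
      exact (norm_add_le _ _).trans (add_le_add (hC f) (hC' f))
  have key : ∀ α : MIdx d k, ∃ C : ℝ, ∀ f : CInfty d,
      ‖toL2 d (mderiv (fun i => (α.1 i : ℕ)) (smoothMul m hm f))‖ ≤ C * ‖jet d k f‖ := by
    intro α
    obtain ⟨C, hC⟩ := span (fun i => (α.1 i : ℕ)) α.2 _
      (list_prod_smoothMul (List.finRange d) (List.nodup_finRange d) (fun i => (α.1 i : ℕ)) m hm)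
    refine ⟨C, fun f => ?_⟩
    have h := hC f
    rw [Module.End.mul_apply] at h
    exact h
  choose C hC using key
  refine ⟨Real.sqrt (∑ α, C α ^ 2), Real.sqrt_nonneg _, fun f => ?_⟩
  rw [← sq_le_sq₀ (norm_nonneg _) (by positivity), mul_pow, Real.sq_sqrt (by positivity),
    norm_jet_sq, Finset.sum_mul]
  refine Finset.sum_le_sum fun α _ => ?_
  rw [← mul_pow]
  exact pow_le_pow_left₀ (norm_nonneg _) (hC α f) 2

/-! ### The space `ℋ^k_rad(𝔹^d; W)` -/

/-- The space `C^∞_rad(closure 𝔹^d; W)²`, to be endowed with the norm of `ℋ^k(𝔹^d; W)`. -/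
def SmoothPair (d _k : ℕ) : Type := CInftyRadW d × CInftyRadW d

instance (d k : ℕ) : AddCommGroup (SmoothPair d k) :=
  inferInstanceAs (AddCommGroup (CInftyRadW d × CInftyRadW d))

instance (d k : ℕ) : Module ℂ (SmoothPair d k) :=
  inferInstanceAs (Module ℂ (CInftyRadW d × CInftyRadW d))

/-- The first component of a pair. -/
def SmoothPair.fst (d k : ℕ) : SmoothPair d k →ₗ[ℂ] CInftyRadW d :=
  LinearMap.fst ℂ (CInftyRadW d) (CInftyRadW d)

/-- The second component of a pair. -/
def SmoothPair.snd (d k : ℕ) : SmoothPair d k →ₗ[ℂ] CInftyRadW d :=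
  LinearMap.snd ℂ (CInftyRadW d) (CInftyRadW d)

/-- The map `(f₁, f₂) ↦ ((∂^α (W f₁))_{|α| ≤ k}, (∂^α (W f₂))_{|α| ≤ k-1})`. -/
def pairJet (d k : ℕ) : SmoothPair d k →ₗ[ℂ] WithLp 2 (JetSpace d k × JetSpace d (k - 1)) :=
  (WithLp.linearEquiv 2 ℂ (JetSpace d k × JetSpace d (k - 1))).symm.toLinearMap ∘ₗ
    ((jet d k ∘ₗ radIncl d ∘ₗ mulW d ∘ₗ SmoothPair.fst d k).prod
      (jet d (k - 1) ∘ₗ radIncl d ∘ₗ mulW d ∘ₗ SmoothPair.snd d k))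

lemma mulW_injective (d : ℕ) : Function.Injective (mulW d) := by
  intro f g h
  ext x
  by_cases hx : x ∈ unitBall d
  · have := congrArg (fun u : CInftyRad d => (u : Euc d → ℂ) x) h
    exact mul_left_cancel₀ (weightW_ne_zero hx) this
  · rw [f.2.1.1.2 x hx, g.2.1.1.2 x hx]

lemma pairJet_injective (d k : ℕ) : Function.Injective (pairJet d k) := by
  intro f g h
  have h' := (WithLp.linearEquiv 2 ℂ (JetSpace d k × JetSpace d (k - 1))).symm.injective h
  have hr : Function.Injective (radIncl d) := Submodule.inclusion_injective _
  exact Prod.ext (mulW_injective d (hr (jet_injective d k (congrArg Prod.fst h'))))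
    (mulW_injective d (hr (jet_injective d (k - 1) (congrArg Prod.snd h'))))

/-- The norm `‖(f₁, f₂)‖² = ‖W f₁‖²_{H^k(𝔹^d)} + ‖W f₂‖²_{H^{k-1}(𝔹^d)}`. -/
instance (d k : ℕ) : NormedAddCommGroup (SmoothPair d k) :=
  NormedAddCommGroup.induced _ _ (pairJet d k) (pairJet_injective d k)

instance (d k : ℕ) : NormedSpace ℂ (SmoothPair d k) :=
  NormedSpace.induced ℂ _ _ (pairJet d k)

lemma SmoothPair.norm_sq (d k : ℕ) (f : SmoothPair d k) :
    ‖f‖ ^ 2 = ‖jet d k (radIncl d (mulW d (SmoothPair.fst d k f)))‖ ^ 2 +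
      ‖jet d (k - 1) (radIncl d (mulW d (SmoothPair.snd d k f)))‖ ^ 2 :=
  WithLp.prod_norm_sq_eq_of_L2 (pairJet d k f)

/-- The space `ℋ^k_rad(𝔹^d; W)`: the completion of `C^∞_rad(closure 𝔹^d; W)²`. -/
abbrev HSpace (d k : ℕ) : Type := UniformSpace.Completion (SmoothPair d k)

/-! ### The generator of the linearised evolution -/

/-- The operator
`L₀*(g₁, g₂) = (g₂ - Λ g₁, -Λ g₂ - g₂ + Δ g₁)` on `C^∞_rad(closure 𝔹^d)²`. -/
def freeStar (d : ℕ) : CInftyRad d × CInftyRad d →ₗ[ℂ] CInftyRad d × CInftyRad d where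
  toFun g := (g.2 - radLambda d g.1, -radLambda d g.2 - g.2 + radLaplacian d g.1)
  map_add' f g := by ext1 <;> simp <;> abel
  map_smul' c f := by ext1 <;> simp [smul_sub]

/-- The free operator `L₀ f = W⁻¹ (L₀* - (d-2)) W f` on `C^∞_rad(closure 𝔹^d; W)²`. -/
def freeOp {d : ℕ} (k : ℕ) (hd : 5 ≤ d) (ho : Odd d) : SmoothPair d k →ₗ[ℂ] SmoothPair d k :=
  ((mulWInv (by omega) ho).prodMap (mulWInv (by omega) ho)) ∘ₗ
    (freeStar d - ((d : ℂ) - 2) • LinearMap.id) ∘ₗ ((mulW d).prodMap (mulW d))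

/-- `L₀` as a densely defined operator in `ℋ^k_rad(𝔹^d; W)` with domain
`C^∞_rad(closure 𝔹^d; W)²`. -/
def freePMap {d : ℕ} (k : ℕ) (hd : 5 ≤ d) (ho : Odd d) : HSpace d k →ₗ.[ℂ] HSpace d k where
  domain := LinearMap.range
    (UniformSpace.Completion.toComplₗᵢ (𝕜 := ℂ) (E := SmoothPair d k)).toLinearMap
  toFun := (UniformSpace.Completion.toComplₗᵢ (𝕜 := ℂ) (E := SmoothPair d k)).toLinearMap ∘ₗ
    freeOp k hd ho ∘ₗ (LinearEquiv.ofInjective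
      (UniformSpace.Completion.toComplₗᵢ (𝕜 := ℂ) (E := SmoothPair d k)).toLinearMap
      (UniformSpace.Completion.toComplₗᵢ (𝕜 := ℂ) (E := SmoothPair d k)).injective).symm.toLinearMap

lemma freePMap_apply_coe {d : ℕ} (k : ℕ) (hd : 5 ≤ d) (ho : Odd d) (f : SmoothPair d k) :
    freePMap k hd ho ⟨(f : HSpace d k), ⟨f, rfl⟩⟩ = (freeOp k hd ho f : HSpace d k) := by
  have e := (LinearEquiv.ofInjective
      (UniformSpace.Completion.toComplₗᵢ (𝕜 := ℂ) (E := SmoothPair d k)).toLinearMap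
      (UniformSpace.Completion.toComplₗᵢ (𝕜 := ℂ)
        (E := SmoothPair d k)).injective).symm_apply_apply f
  exact congrArg (fun g : SmoothPair d k => (freeOp k hd ho g : HSpace d k)) e

/-- The operator `L'(f₁, f₂) = (0, -V f₁)` on `C^∞_rad(closure 𝔹^d; W)²`. -/
def potentialOp {d : ℕ} (k : ℕ) (hd : 5 ≤ d) : SmoothPair d k →ₗ[ℂ] SmoothPair d k :=
  LinearMap.inr ℂ (CInftyRadW d) (CInftyRadW d) ∘ₗ (-mulV hd) ∘ₗ SmoothPair.fst d k

lemma potentialOp_bound {d : ℕ} (k : ℕ) (hd : 5 ≤ d) :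
    ∃ C : ℝ, ∀ f : SmoothPair d k, ‖potentialOp k hd f‖ ≤ C * ‖f‖ := by
  obtain ⟨C, hC0, hC⟩ := norm_jet_smoothMul_le (k - 1) (potentialV d) (potentialV_bddSmooth hd)
  refine ⟨C, fun f => ?_⟩
  have e1 : SmoothPair.fst d k (potentialOp k hd f) = 0 := rfl
  have e2 : radIncl d (mulW d (SmoothPair.snd d k (potentialOp k hd f))) =
      -smoothMul (potentialV d) (potentialV_bddSmooth hd)
        (radIncl d (mulW d (SmoothPair.fst d k f))) := by
    ext x
    change (weightW d x : ℂ) * -(potentialV d x * (SmoothPair.fst d k f : Euc d → ℂ) x) =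
      -(potentialV d x * ((weightW d x : ℂ) * (SmoothPair.fst d k f : Euc d → ℂ) x))
    ring
  have h1 : ‖potentialOp k hd f‖ =
      ‖jet d (k - 1) (smoothMul (potentialV d) (potentialV_bddSmooth hd)
        (radIncl d (mulW d (SmoothPair.fst d k f))))‖ := by
    rw [← sq_eq_sq₀ (norm_nonneg _) (norm_nonneg _), SmoothPair.norm_sq, e1, e2]
    simp
  rw [h1]
  refine (hC _).trans ?_
  gcongr
  refine (norm_jet_mono (Nat.sub_le k 1) _).trans ?_
  rw [← sq_le_sq₀ (norm_nonneg _) (norm_nonneg _), SmoothPair.norm_sq d k f]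
  exact le_add_of_nonneg_right (sq_nonneg _)

/-- The bounded extension of `L'` to `ℋ^k_rad(𝔹^d; W)`. -/
def potentialCLM {d : ℕ} (k : ℕ) (hd : 5 ≤ d) : HSpace d k →L[ℂ] HSpace d k :=
  ((potentialOp k hd).mkContinuousOfExistsBound (potentialOp_bound k hd)).completion

/-- The generator `L = closure(L₀) + L'` of the linearised evolution, an unbounded operator in
`ℋ^k_rad(𝔹^d; W)` with domain `D(L) = D(closure(L₀))`. -/
def generatorL {d : ℕ} (k : ℕ) (hd : 5 ≤ d) (ho : Odd d) : HSpace d k →ₗ.[ℂ] HSpace d k :=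
  (potentialCLM k hd : HSpace d k →ₗ[ℂ] HSpace d k) +ᵥ (freePMap k hd ho).closure

end

end HypWaveMap

open MeasureTheory Set Topology Filter
open scoped ContDiff ENNReal

namespace HypWaveMap

noncomputable section

/-! ### Absolutely continuous complex-valued functions -/

open ComplexConjugate
-- Self-adjointness. For `d ≥ 5` one has `-q ≥ 2/r² - C w`, and `1/(1-r)² ≤ 4w`. Hence for `g` in
-- the domain, `Re(g'' conj g)` is at least `2|g|²/r² + 2|g|²/(1-r)²` up to an integrable error.
-- This repulsion forces `g'`, and `g` divided by the distance to the endpoint, to be square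
-- integrable at both ends (`endpoint_integrable`). A boundary term such as the Wronskian is then at
-- most the distance `x` times an integrable function of `x`, so it is small along a sequence
-- tending to the endpoint. Green's formula therefore has no boundary terms and `T` is symmetric
-- (`slGraph_symm`). Conversely, a du Bois-Reymond argument with compactly supported elements of the
-- domain shows that every pair in the adjoint relation lies in the graph of `T`
-- (`mem_slGraph_of_forall_inner`). Density of the domain follows from the same lemma.
--
-- No negative eigenvalues. The function `r^((d-1)/2) (1-r²)^((7-d)/4) / (d-4+r²)` is a positive
-- solution at energy zero. With `a` its logarithmic derivative, `E = Re(g' conj g) - a|g|²` has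
-- derivative `|g' - a g|² - μ w|g|²`. For `μ < 0` this makes `E` monotone, while `E` is small along
-- sequences tending to both endpoints. So `E = 0`, and then `g = 0` (`eigenfunction_eq_zero`).
--
-- The generator. Put `u = W f₁` and `p = W f₂`. The eigenvalue equation gives `p = Λu + (d-2+z)u`
-- and a second-order radial equation for `u`. A Liouville transformation turns it into `τ g = μ g`
-- with `μ = (d-5)²/4 - (z + (d-3)/2)²`. For `Re z > -1` and `u'` square integrable near `1`, the
-- function `g` lies in `H_w`. Symmetry of `T` then makes `μ` real, which forces `z` to be real and
-- `μ < 0`, so `g = 0` (`spectral_solution_eq_zero`).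
--
-- An eigenvector of the closure is only a limit of smooth pairs with small residual. Integrating
-- the equations once, with the second one in divergence form, lets them pass to the limit using
-- only `L²` convergence of `u`, `Λu` and `p`. The limit is then seen to be a classical solution
-- (`weak_solution_ae_eq_zero`). Once the `L²` limits vanish, closability of `∂^α` in `L²` shows
-- that the vector of the abstract completion vanishes (`eq_zero_of_tendsto_toL2`).
lemma ac_comp_lipschitz {X Y : Type*} [PseudoMetricSpace X] [PseudoMetricSpace Y] {f : ℝ → X}
    {φ : X → Y} (hφ : LipschitzWith 1 φ) {a b : ℝ} (hf : AbsolutelyContinuousOnInterval f a b) :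
    AbsolutelyContinuousOnInterval (fun x => φ (f x)) a b := by
  rw [absolutelyContinuousOnInterval_iff] at hf ⊢
  intro ε hε
  obtain ⟨δ, hδ, H⟩ := hf ε hε
  refine ⟨δ, hδ, fun E hE hlt => (Finset.sum_le_sum fun i _ => ?_).trans_lt (H E hE hlt)⟩
  simpa using hφ.dist_le_mul (f (E.2 i).1) (f (E.2 i).2)

lemma lipschitzWith_re : LipschitzWith 1 Complex.re :=
  LipschitzWith.of_dist_le_mul fun x y => by
    simpa [Real.dist_eq, dist_eq_norm] using Complex.abs_re_le_norm (x - y)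

lemma lipschitzWith_im : LipschitzWith 1 Complex.im :=
  LipschitzWith.of_dist_le_mul fun x y => by
    simpa [Real.dist_eq, dist_eq_norm] using Complex.abs_im_le_norm (x - y)

lemma lipschitzWith_ofReal : LipschitzWith 1 Complex.ofReal :=
  Complex.isometry_ofReal.lipschitz

lemma lipschitzWith_conj : LipschitzWith 1 (conj : ℂ → ℂ) :=
  Complex.isometry_conj.lipschitz

/-- Real and imaginary parts are treated separately. Their derivatives are the parts of `deriv f`
wherever `f` is differentiable, which is almost everywhere since `f` has bounded variation. -/
lemma ac_intervalIntegrable_deriv {f : ℝ → ℂ} {a b : ℝ}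
    (hf : AbsolutelyContinuousOnInterval f a b) : IntervalIntegrable (deriv f) volume a b := by
  have h1 := (ac_comp_lipschitz lipschitzWith_re hf).intervalIntegrable_deriv
  have h2 := (ac_comp_lipschitz lipschitzWith_im hf).intervalIntegrable_deriv
  have h3 : IntervalIntegrable (fun x => ((deriv (fun x => (f x).re) x : ℝ) : ℂ) +
      Complex.I * ((deriv (fun x => (f x).im) x : ℝ) : ℂ)) volume a b :=
    IntervalIntegrable.add ⟨h1.1.ofReal, h1.2.ofReal⟩
      (IntervalIntegrable.const_mul ⟨h2.1.ofReal, h2.2.ofReal⟩ _)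
  refine h3.congr_ae ?_
  rw [Filter.EventuallyEq, ae_restrict_iff' measurableSet_uIoc]
  filter_upwards [hf.boundedVariationOn.ae_differentiableAt_of_mem_uIcc] with x hx hxm
  have hd := (hx (uIoc_subset_uIcc hxm)).hasDerivAt
  have hr : HasDerivAt (fun x => (f x).re) (deriv f x).re x :=
    Complex.reCLM.hasFDerivAt.comp_hasDerivAt x hd
  have hi : HasDerivAt (fun x => (f x).im) (deriv f x).im x :=
    Complex.imCLM.hasFDerivAt.comp_hasDerivAt x hd
  rw [hr.deriv, hi.deriv, mul_comm, Complex.re_add_im]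

lemma ac_intervalIntegral {f : ℝ → ℂ} {a b c : ℝ} (h : IntervalIntegrable f volume a b)
    (hc : c ∈ uIcc a b) : AbsolutelyContinuousOnInterval (fun x => ∫ v in c..x, f v) a b := by
  have hre : IntervalIntegrable (fun x => (f x).re) volume a b := ⟨h.1.re, h.2.re⟩
  have him : IntervalIntegrable (fun x => (f x).im) volume a b := ⟨h.1.im, h.2.im⟩
  have h1 := ac_comp_lipschitz lipschitzWith_ofReal
    (hre.absolutelyContinuousOnInterval_intervalIntegral hc)
  have h2 := ac_comp_lipschitz lipschitzWith_ofReal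
    (him.absolutelyContinuousOnInterval_intervalIntegral hc)
  have h3 := h1.fun_add (h2.const_smul Complex.I)
  rw [absolutelyContinuousOnInterval_iff] at h3 ⊢
  have key : ∀ x ∈ uIcc a b, ∫ v in c..x, f v = ((∫ v in c..x, (f v).re : ℝ) : ℂ) +
      Complex.I • ((∫ v in c..x, (f v).im : ℝ) : ℂ) := by
    intro x hx
    have hs : uIcc c x ⊆ uIcc a b := uIcc_subset_uIcc hc hx
    have e1 := hre.mono_set hs
    have e2 := him.mono_set hs
    have e3 : IntervalIntegrable (fun x => ((f x).re : ℂ)) volume c x :=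
      ⟨e1.1.ofReal, e1.2.ofReal⟩
    have e4 : IntervalIntegrable (fun x => ((f x).im : ℂ)) volume c x :=
      ⟨e2.1.ofReal, e2.2.ofReal⟩
    rw [← intervalIntegral.integral_ofReal, ← intervalIntegral.integral_ofReal,
      ← intervalIntegral.integral_smul, ← intervalIntegral.integral_add e3
        (show IntervalIntegrable (fun x => Complex.I • ((f x).im : ℂ)) volume c x from
          e4.smul Complex.I)]
    refine intervalIntegral.integral_congr fun v _ => ?_
    simp only [smul_eq_mul]
    rw [mul_comm, Complex.re_add_im]
  intro ε hε
  obtain ⟨δ, hδ, H⟩ := h3 ε hε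
  refine ⟨δ, hδ, fun E hE hlt => ?_⟩
  have := H E hE hlt
  rwa [Finset.sum_congr rfl fun i hi => ?_] at this
  rw [key _ (hE.1 i hi).1, key _ (hE.1 i hi).2]

/-- Fundamental theorem of calculus for absolutely continuous functions. -/
lemma ac_integral_eq_sub {f f' : ℝ → ℂ} {a b : ℝ} (hf : AbsolutelyContinuousOnInterval f a b)
    (hf' : ∀ᵐ x, x ∈ uIcc a b → HasDerivAt f (f' x) x) :
    IntervalIntegrable f' volume a b ∧ ∫ x in a..b, f' x = f b - f a := by
  have hi : IntervalIntegrable f' volume a b := by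
    refine (ac_intervalIntegrable_deriv hf).congr_ae ?_
    rw [Filter.EventuallyEq, ae_restrict_iff' measurableSet_uIoc]
    filter_upwards [hf'] with x hx hxm
    exact (hx (uIoc_subset_uIcc hxm)).deriv
  refine ⟨hi, ?_⟩
  -- `f` minus the primitive of `f'` is absolutely continuous with zero derivative almost
  -- everywhere, hence constant.
  have g_ac := hf.fun_sub (ac_intervalIntegral hi (left_mem_uIcc))
  obtain ⟨C, hC⟩ := g_ac.const_of_ae_hasDerivAt_zero (by
    filter_upwards [hf', hi.ae_hasDerivAt_integral] with x h1 h2 h3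
    simpa using! (h1 h3).sub (h2 h3 a left_mem_uIcc))
  have e1 := hC a left_mem_uIcc
  have e2 := hC b right_mem_uIcc
  rw [intervalIntegral.integral_same, sub_zero] at e1
  rw [← e1] at e2
  rw [← e2]; ring

lemma ac_congr {f g : ℝ → ℂ} {a b : ℝ} (hf : AbsolutelyContinuousOnInterval f a b)
    (e : EqOn f g (uIcc a b)) : AbsolutelyContinuousOnInterval g a b := by
  rw [absolutelyContinuousOnInterval_iff] at hf ⊢
  intro ε hε
  obtain ⟨δ, hδ, H⟩ := hf ε hε
  refine ⟨δ, hδ, fun E hE hlt => ?_⟩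
  have := H E hE hlt
  rwa [Finset.sum_congr rfl fun i hi => ?_] at this
  rw [e (hE.1 i hi).1, e (hE.1 i hi).2]

/-! ### Integrability at an endpoint -/

/-- A function that is integrable at `0` is frequently smaller than `ε / x`. -/
lemma frequently_mul_lt_of_integrableOn {f : ℝ → ℝ} {b : ℝ} (hb : 0 < b)
    (hf : IntegrableOn f (Ioo 0 b)) {ε : ℝ} (hε : 0 < ε) :
    ∃ᶠ x in 𝓝[>] (0 : ℝ), x * f x < ε := by
  intro hcon
  obtain ⟨c, hc, hcs⟩ := mem_nhdsGT_iff_exists_Ioo_subset.1 hcon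
  set e := min b c with he
  have hc0 : (0 : ℝ) < c := hc
  have he0 : 0 < e := lt_min hb hc0
  -- If `ε ≤ x f(x)` near `0`, then `1/x ≤ f/ε` would be integrable at `0`.
  have h1 : IntegrableOn (fun x : ℝ => x⁻¹) (Ioo 0 e) := by
    refine Integrable.mono' ((hf.mono_set (Ioo_subset_Ioo_right (min_le_left b c))).const_mul ε⁻¹)
      measurable_inv.aestronglyMeasurable ?_
    rw [ae_restrict_iff' measurableSet_Ioo]
    filter_upwards with x hx
    have h2 : ε ≤ x * f x := not_lt.1 (hcs ⟨hx.1, hx.2.trans_le (min_le_right b c)⟩)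
    rw [Real.norm_of_nonneg (inv_nonneg.2 hx.1.le), inv_mul_eq_div, le_div_iff₀ hε,
      inv_mul_le_iff₀ hx.1]
    exact h2
  have h2 : IntervalIntegrable (fun x : ℝ => x⁻¹) volume 0 e := by
    rw [intervalIntegrable_iff_integrableOn_Ioo_of_le he0.le]; exact h1
  rw [intervalIntegrable_inv_iff] at h2
  rcases h2 with h2 | h2
  · exact he0.ne h2
  · exact h2 left_mem_uIcc

/-- The value of an improper integral when the boundary term is frequently small. -/
lemma integral_eq_of_frequently_small {Φ W : ℝ → ℂ} {b : ℝ} (hb : 0 < b)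
    (hΦ : IntegrableOn Φ (Ioo 0 b))
    (hW : ∀ x ∈ Ioo 0 b, ∫ t in x..b, Φ t = W b - W x)
    (hs : ∀ ε > 0, ∃ᶠ x in 𝓝[>] (0 : ℝ), ‖W x‖ < ε) : ∫ t in (0 : ℝ)..b, Φ t = W b := by
  have hI : IntervalIntegrable Φ volume 0 b := by
    rw [intervalIntegrable_iff_integrableOn_Ioo_of_le hb.le]; exact hΦ
  have hcont : Tendsto (fun x => ∫ t in x..b, Φ t) (𝓝[>] 0) (𝓝 (∫ t in (0 : ℝ)..b, Φ t)) := by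
    have h1 := intervalIntegral.continuousOn_primitive_interval_left
      (f := Φ) (μ := volume) (a := 0) (b := b) (by
        rw [uIcc_of_le hb.le, integrableOn_Icc_iff_integrableOn_Ioo]; exact hΦ)
    have h2 := h1 0 left_mem_uIcc
    refine h2.mono_left (nhdsWithin_le_iff.2 ?_)
    rw [uIcc_of_le hb.le]
    exact mem_of_superset (Ioo_mem_nhdsGT hb) Ioo_subset_Icc_self
  have key : ∀ ε > 0, ‖(∫ t in (0 : ℝ)..b, Φ t) - W b‖ ≤ 2 * ε := by
    intro ε hε
    have h1 := (Metric.tendsto_nhds.1 hcont) ε hε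
    obtain ⟨x, hx, h2, h3⟩ := ((hs ε hε).and_eventually
      (h1.and (Ioo_mem_nhdsGT hb))).exists
    rw [hW x h3, dist_eq_norm] at h2
    have : (∫ t in (0 : ℝ)..b, Φ t) - W b =
        -(W b - W x - ∫ t in (0 : ℝ)..b, Φ t) - W x := by ring
    rw [this]
    refine (norm_sub_le _ _).trans ?_
    rw [norm_neg]
    linarith
  rw [← sub_eq_zero, ← norm_le_zero_iff]
  refine le_of_forall_pos_le_add fun ε hε => ?_
  have := key (ε / 2) (by positivity)
  linarith

/-- Near a singular endpoint with inverse-square repulsion, square integrable functions have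
square integrable derivative. -/
lemma endpoint_integrable {v v1 v2 : ℝ → ℂ} {χ : ℝ → ℝ} {b : ℝ} (hb : 0 < b)
    (hac : ∀ a ∈ Ioo 0 b, AbsolutelyContinuousOnInterval v a b)
    (hv : ∀ x ∈ Ioo 0 b, HasDerivAt v (v1 x) x)
    (hac1 : ∀ a ∈ Ioo 0 b, AbsolutelyContinuousOnInterval v1 a b)
    (hv1 : ∀ᵐ x, x ∈ Ioo 0 b → HasDerivAt v1 (v2 x) x)
    (h2 : IntegrableOn (fun x => ‖v x‖ ^ 2) (Ioo 0 b)) (hχ : IntegrableOn χ (Ioo 0 b))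
    (hge : ∀ᵐ x, x ∈ Ioo 0 b → 2 * ‖v x‖ ^ 2 / x ^ 2 - χ x ≤ (v2 x * conj (v x)).re) :
    IntegrableOn (fun x => ‖v1 x‖ ^ 2 / 2 + ‖v x‖ ^ 2 / x ^ 2) (Ioo 0 b) := by
  -- The correction `|v|²/(2x)` makes `2xE` the derivative of `x|v|²`, which excludes `E` from
  -- staying below `-1` near `0`. It costs little: `E' ≥ |v1|²/2 + |v|²/x² - χ` still holds, thanks
  -- to the constant `2` in `hge`.
  set E : ℝ → ℝ := fun x => (v1 x * conj (v x)).re + ‖v x‖ ^ 2 * (1 / (2 * x)) with hE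
  have nsq : ∀ z : ℂ, ‖z‖ ^ 2 = (z * conj z).re := fun z => by
    rw [Complex.mul_conj, Complex.ofReal_re, Complex.normSq_eq_norm_sq]
  have hvc : ContinuousOn v (Ioc 0 b) := by
    intro x hx
    have h0 : x / 2 ∈ Ioo 0 b := ⟨by linarith [hx.1], by linarith [hx.1, hx.2]⟩
    have := (hac _ h0).continuousOn
    rw [uIcc_of_le h0.2.le] at this
    refine (this x ⟨by linarith [hx.1], hx.2⟩).mono_of_mem_nhdsWithin ?_
    rw [mem_nhdsWithin_iff_exists_mem_nhds_inter]
    exact ⟨Ioi (x / 2), Ioi_mem_nhds (by linarith [hx.1]), fun y hy => ⟨hy.1.le, hy.2.2⟩⟩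
  have hv1c : ContinuousOn v1 (Ioc 0 b) := by
    intro x hx
    have h0 : x / 2 ∈ Ioo 0 b := ⟨by linarith [hx.1], by linarith [hx.1, hx.2]⟩
    have := (hac1 _ h0).continuousOn
    rw [uIcc_of_le h0.2.le] at this
    refine (this x ⟨by linarith [hx.1], hx.2⟩).mono_of_mem_nhdsWithin ?_
    rw [mem_nhdsWithin_iff_exists_mem_nhds_inter]
    exact ⟨Ioi (x / 2), Ioi_mem_nhds (by linarith [hx.1]), fun y hy => ⟨hy.1.le, hy.2.2⟩⟩
  set ψ : ℝ → ℝ := fun x => ‖v1 x‖ ^ 2 / 2 + ‖v x‖ ^ 2 / x ^ 2 with hψ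
  have hψc : ContinuousOn ψ (Ioc 0 b) := by
    refine ((hv1c.norm.pow 2).div_const 2).add ((hvc.norm.pow 2).div (continuousOn_pow 2) ?_)
    intro x hx; exact (pow_pos hx.1 2).ne'
  have hψ0 : ∀ x, 0 ≤ ψ x := fun x => by positivity
  -- the energy inequality
  have energy : ∀ a ∈ Ioo 0 b, ∫ x in a..b, ψ x ≤ E b - E a + ∫ x in Ioo 0 b, |χ x| := by
    intro a ha
    have hsub : Icc a b ⊆ Ioc 0 b := fun x hx => ⟨ha.1.trans_le hx.1, hx.2⟩
    have hEac : AbsolutelyContinuousOnInterval E a b := by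
      have c1 := ac_comp_lipschitz lipschitzWith_re ((hac1 a ha).fun_smul
        (ac_comp_lipschitz lipschitzWith_conj (hac a ha)))
      have c2 := ac_comp_lipschitz lipschitzWith_re ((hac a ha).fun_smul
        (ac_comp_lipschitz lipschitzWith_conj (hac a ha)))
      have c3 : AbsolutelyContinuousOnInterval (fun x : ℝ => 1 / (2 * x)) a b := by
        apply ContDiffOn.absolutelyContinuousOnInterval
        rw [uIcc_of_le ha.2.le]
        refine contDiffOn_const.div (contDiffOn_const.mul contDiffOn_id) fun x hx => ?_
        have := (hsub hx).1
        simp; linarith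
      have c4 := c1.fun_add (c2.fun_mul c3)
      simpa only [hE, nsq, smul_eq_mul] using c4
    have hEd := hEac.integral_deriv_eq_sub
    have hEi := hEac.intervalIntegrable_deriv
    have hψi : IntervalIntegrable ψ volume a b := by
      apply ContinuousOn.intervalIntegrable
      rw [uIcc_of_le ha.2.le]
      exact hψc.mono hsub
    have hχi : IntervalIntegrable χ volume a b := by
      rw [intervalIntegrable_iff_integrableOn_Ioo_of_le ha.2.le]
      exact hχ.mono_set (Ioo_subset_Ioo_left ha.1.le)
    have hm : ∫ x in a..b, (ψ x - χ x) ≤ ∫ x in a..b, deriv E x := by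
      rw [intervalIntegral.integral_of_le ha.2.le, intervalIntegral.integral_of_le ha.2.le,
        integral_Ioc_eq_integral_Ioo, integral_Ioc_eq_integral_Ioo]
      have i1 := hψi.sub hχi
      rw [intervalIntegrable_iff_integrableOn_Ioo_of_le ha.2.le] at i1 hEi
      refine integral_mono_ae i1 hEi ?_
      rw [Filter.EventuallyLE, ae_restrict_iff' measurableSet_Ioo]
      filter_upwards [hv1, hge] with x k1 k2 hx
      have hx0 : x ∈ Ioo 0 b := ⟨ha.1.trans hx.1, hx.2⟩
      have d0 := hv x hx0
      have d1 := k1 hx0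
      have d0c : HasDerivAt (fun x => conj (v x)) (conj (v1 x)) x :=
        Complex.conjCLE.toContinuousLinearMap.hasFDerivAt.comp_hasDerivAt x d0
      have e1 : HasDerivAt (fun x => (v1 x * conj (v x)).re)
          (v2 x * conj (v x) + v1 x * conj (v1 x)).re x :=
        Complex.reCLM.hasFDerivAt.comp_hasDerivAt x (d1.mul d0c)
      have e2 : HasDerivAt (fun x => (v x * conj (v x)).re)
          (v1 x * conj (v x) + v x * conj (v1 x)).re x :=
        Complex.reCLM.hasFDerivAt.comp_hasDerivAt x (d0.mul d0c)
      have e3 : HasDerivAt (fun x : ℝ => 1 / (2 * x)) (-(1 / (2 * x ^ 2))) x := by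
        have hx' := hx0.1.ne'
        have := ((hasDerivAt_id x).const_mul (2 : ℝ)).inv (by simpa using hx')
        simp only [one_div]
        convert! this using 1
        simp only [id]
        field_simp
      have e4 := e1.add (e2.mul e3)
      have e5 : HasDerivAt E ((v2 x * conj (v x) + v1 x * conj (v1 x)).re +
          ((v1 x * conj (v x) + v x * conj (v1 x)).re * (1 / (2 * x)) +
          (v x * conj (v x)).re * (-(1 / (2 * x ^ 2))))) x := by
        simpa only [hE, nsq] using! e4
      rw [e5.deriv]
      have k3 := k2 hx0
      have e6 : (v x * conj (v1 x)).re = (v1 x * conj (v x)).re := by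
        simp [Complex.mul_re]; ring
      rw [Complex.add_re, Complex.add_re, e6, ← nsq, ← nsq]
      have e7 : |(v1 x * conj (v x)).re| ≤ ‖v1 x‖ * ‖v x‖ := by
        have := Complex.abs_re_le_norm (v1 x * conj (v x))
        rwa [norm_mul, Complex.norm_conj] at this
      have e8 := neg_le_of_abs_le e7
      have hxp := hx0.1
      -- The cross term of `E'` is absorbed by half of `|v1|²` and part of the repulsion `2|v|²/x²`.
      have e9 : -(‖v1 x‖ ^ 2 / 2 + ‖v x‖ ^ 2 / (2 * x ^ 2)) ≤ (v1 x * conj (v x)).re / x := by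
        have s1 : -(‖v1 x‖ * ‖v x‖) / x ≤ (v1 x * conj (v x)).re / x := by gcongr
        have s2 : 0 ≤ (‖v1 x‖ - ‖v x‖ / x) ^ 2 := sq_nonneg _
        have s3 : (‖v1 x‖ - ‖v x‖ / x) ^ 2 = 2 * ((‖v1 x‖ ^ 2 / 2 + ‖v x‖ ^ 2 / (2 * x ^ 2)) +
          -(‖v1 x‖ * ‖v x‖) / x) := by field_simp; ring
        linarith
      have e10 : ((v1 x * conj (v x)).re + (v1 x * conj (v x)).re) * (1 / (2 * x)) =
          (v1 x * conj (v x)).re / x := by field_simp; ring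
      have e11 : 2 * ‖v x‖ ^ 2 / x ^ 2 = 4 * (‖v x‖ ^ 2 / (2 * x ^ 2)) := by field_simp; ring
      have e12 : ‖v x‖ ^ 2 / x ^ 2 = 2 * (‖v x‖ ^ 2 / (2 * x ^ 2)) := by field_simp
      have e13 : ‖v x‖ ^ 2 * -(1 / (2 * x ^ 2)) = -(‖v x‖ ^ 2 / (2 * x ^ 2)) := by field_simp
      simp only [hψ]
      rw [e10, e13, e12]
      rw [e11] at k3
      linarith
    rw [intervalIntegral.integral_sub hψi hχi, hEd] at hm
    have hχle : ∫ x in a..b, χ x ≤ ∫ x in Ioo 0 b, |χ x| := by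
      rw [intervalIntegral.integral_of_le ha.2.le, integral_Ioc_eq_integral_Ioo]
      have hχa := hχ.mono_set (Ioo_subset_Ioo_left (b := b) ha.1.le)
      calc ∫ x in Ioo a b, χ x ≤ ∫ x in Ioo a b, |χ x| :=
            integral_mono hχa hχa.abs fun x => le_abs_self _
        _ ≤ _ := setIntegral_mono_set hχ.abs (ae_of_all _ fun x => abs_nonneg _)
            (Ioo_subset_Ioo_left ha.1.le).eventuallyLE
    linarith
  -- If `E ≥ -1` along a sequence tending to `0`, the energy inequality bounds the integrals of `ψ`
  -- uniformly. The opposite case is contradictory.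
  by_cases hfr : ∃ᶠ a in 𝓝[>] (0 : ℝ), -1 ≤ E a
  · obtain ⟨s, hs, hsf⟩ := exists_seq_forall_of_frequently
      (hfr.and_eventually (Ioo_mem_nhdsGT hb))
    have hs0 : Tendsto s atTop (𝓝 0) := hs.mono_right nhdsWithin_le_nhds
    rw [← integrableOn_Ioc_iff_integrableOn_Ioo]
    refine integrableOn_Ioc_of_intervalIntegral_norm_bounded_left (l := atTop) (a := s)
      (I := E b + 1 + ∫ x in Ioo 0 b, |χ x|) (fun i => ?_) hs0 (Eventually.of_forall fun i => ?_)
    · exact (hψc.mono fun x hx => ⟨(hsf i).2.1.trans_le hx.1, hx.2⟩ :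
        ContinuousOn ψ (Icc (s i) b)).integrableOn_Icc.mono_set Ioc_subset_Icc_self
    · have h := energy (s i) (hsf i).2
      have h' := (hsf i).1
      rw [← intervalIntegral.integral_of_le (hsf i).2.2.le]
      simp only [Real.norm_of_nonneg (hψ0 _)]
      linarith
  · exfalso
    rw [not_frequently] at hfr
    obtain ⟨c, hc, hcs⟩ := mem_nhdsGT_iff_exists_Ioo_subset.1 (hfr.and (Ioo_mem_nhdsGT hb))
    have hc0 : (0 : ℝ) < c := hc
    -- Here `N' = 2xE < 0` near `0`, so `N` decreases. Integrability of `|v|²` makes `N` frequently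
    -- small at `0`, hence `N = 0` at `c/2`. Then `v(c/2) = 0` and `E(c/2) = 0`, against `E < -1`.
    set N : ℝ → ℝ := fun x => x * ‖v x‖ ^ 2 with hN
    have hNd : ∀ x ∈ Ioo 0 c, HasDerivAt N (2 * x * E x) x := by
      intro x hx
      have hx0 := (hcs hx).2
      have d0 := hv x hx0
      have d0c : HasDerivAt (fun x => conj (v x)) (conj (v1 x)) x :=
        Complex.conjCLE.toContinuousLinearMap.hasFDerivAt.comp_hasDerivAt x d0
      have e2 : HasDerivAt (fun x => (v x * conj (v x)).re)
          (v1 x * conj (v x) + v x * conj (v1 x)).re x :=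
        Complex.reCLM.hasFDerivAt.comp_hasDerivAt x (d0.mul d0c)
      have e3 := (hasDerivAt_id x).mul e2
      have e6 : (v x * conj (v1 x)).re = (v1 x * conj (v x)).re := by
        simp [Complex.mul_re]; ring
      have e5 : HasDerivAt N (1 * (v x * conj (v x)).re +
          x * (v1 x * conj (v x) + v x * conj (v1 x)).re) x := by
        simpa only [hN, nsq, id] using! e3
      convert e5 using 1
      rw [Complex.add_re, e6, hE, ← nsq]
      have := hx.1.ne'
      field_simp
      ring
    have hanti : AntitoneOn N (Ioo 0 c) := by
      refine antitoneOn_of_deriv_nonpos (convex_Ioo 0 c)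
        (fun x hx => (hNd x hx).continuousAt.continuousWithinAt) ?_ ?_
      · rw [interior_Ioo]
        exact fun x hx => (hNd x hx).differentiableAt.differentiableWithinAt
      · rw [interior_Ioo]
        intro x hx
        rw [(hNd x hx).deriv]
        have := not_le.1 (hcs hx).1
        have := hx.1
        nlinarith
    have hx2 : c / 2 ∈ Ioo 0 c := ⟨by linarith, by linarith⟩
    have hle : N (c / 2) ≤ 0 := by
      refine le_of_forall_pos_le_add fun ε hε => ?_
      obtain ⟨a, ha1, ha2⟩ := ((frequently_mul_lt_of_integrableOn hb h2 hε).and_eventually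
        (Ioo_mem_nhdsGT hx2.1)).exists
      have := hanti ⟨ha2.1, ha2.2.trans hx2.2⟩ hx2 ha2.2.le
      rw [zero_add]
      exact this.trans ha1.le
    have hz : ‖v (c / 2)‖ ^ 2 = 0 := by
      refine le_antisymm ?_ (by positivity)
      by_contra hcon
      exact absurd hle (not_le.2 (mul_pos hx2.1 (not_le.1 hcon)))
    have hz' : v (c / 2) = 0 := by simpa using hz
    have := (hcs hx2).1
    apply this
    simp [hE, hz']

/-! ### Symmetry of the Sturm–Liouville operator -/

lemma measurable_slWeight : Measurable slWeight := by
  unfold slWeight; fun_prop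

lemma slWeight_nonneg (r : ℝ) : 0 ≤ slWeight r := by unfold slWeight; positivity

lemma integrable_slMeasure_iff {E : Type*} [NormedAddCommGroup E] [NormedSpace ℝ E] {f : ℝ → E} :
    Integrable f slMeasure ↔ IntegrableOn (fun r => slWeight r • f r) (Ioo 0 1) := by
  rw [slMeasure, integrable_withDensity_iff_integrable_smul'
    measurable_slWeight.ennreal_ofReal (ae_of_all _ fun _ => ENNReal.ofReal_lt_top)]
  simp only [ENNReal.toReal_ofReal (slWeight_nonneg _)]
  rfl

lemma integral_slMeasure {E : Type*} [NormedAddCommGroup E] [NormedSpace ℝ E] (f : ℝ → E) :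
    ∫ r, f r ∂slMeasure = ∫ r in Ioo 0 1, slWeight r • f r := by
  rw [slMeasure, integral_withDensity_eq_integral_toReal_smul
    measurable_slWeight.ennreal_ofReal (ae_of_all _ fun _ => ENNReal.ofReal_lt_top)]
  simp only [ENNReal.toReal_ofReal (slWeight_nonneg _)]

lemma integrableOn_normSq_of_memLp {g : ℝ → ℂ} (hg : MemLp g 2 slMeasure) :
    IntegrableOn (fun r => slWeight r * ‖g r‖ ^ 2) (Ioo 0 1) :=
  integrable_slMeasure_iff.1 ((memLp_two_iff_integrable_sq_norm hg.1).1 hg)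

lemma integrableOn_norm_mul_of_memLp {g h : ℝ → ℂ} (hg : MemLp g 2 slMeasure)
    (hh : MemLp h 2 slMeasure) :
    IntegrableOn (fun r => slWeight r * (‖g r‖ * ‖h r‖)) (Ioo 0 1) :=
  integrable_slMeasure_iff.1 (hg.norm.integrable_mul hh.norm)

lemma one_sub_sq_pos {r : ℝ} (hr : r ∈ Ioo (0 : ℝ) 1) : 0 < 1 - r ^ 2 := by
  nlinarith [hr.1, hr.2]

lemma one_le_slWeight {r : ℝ} (hr : r ∈ Ioo (0 : ℝ) 1) : 1 ≤ slWeight r := by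
  have := one_sub_sq_pos hr
  rw [slWeight, le_div_iff₀ (by positivity), one_mul]
  have h2 : 1 - r ^ 2 ≤ 1 := by nlinarith [hr.1]
  nlinarith

lemma inv_one_sub_sq_le_slWeight {r : ℝ} (hr : r ∈ Ioo (0 : ℝ) 1) :
    1 / (1 - r ^ 2) ≤ slWeight r := by
  have := one_sub_sq_pos hr
  rw [slWeight]
  apply one_div_le_one_div_of_le (by positivity)
  have h2 : 1 - r ^ 2 ≤ 1 := by nlinarith [hr.1]
  nlinarith

lemma inv_one_sub_pow_le_slWeight {r : ℝ} (hr : r ∈ Ioo (0 : ℝ) 1) :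
    1 / (1 - r) ^ 2 ≤ 4 * slWeight r := by
  have h1 := one_sub_sq_pos hr
  have h0 : 0 < 1 - r := by linarith [hr.2]
  rw [slWeight, mul_one_div, div_le_div_iff₀ (by positivity) (by positivity)]
  have : (1 - r ^ 2) ^ 2 = (1 + r) ^ 2 * (1 - r) ^ 2 := by ring
  rw [this, one_mul]
  have : (1 + r) ^ 2 ≤ 4 := by nlinarith [hr.1, hr.2]
  gcongr

/-- The constant bounding the part of the coefficient that is controlled by the weight. -/
def slBound (d : ℕ) : ℝ := (3 * (d : ℝ) - 9) / 2 + 8 * ((d : ℝ) - 3) / ((d : ℝ) - 4) + 8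

/-- For `d ≥ 5` the constant `(d-3)(d-1)/4` is at least `2`, and dividing by `(1-r²)² ≤ 1` only
increases it. The other two terms are controlled by `w`, using `1/(1-r²) ≤ w` for the potential. The
`8` subtracted from `slBound` is kept in reserve for the endpoint `1`. -/
lemma slCoeff_le {d : ℕ} (hd : 5 ≤ d) {r : ℝ} (hr : r ∈ Ioo (0 : ℝ) 1) :
    slCoeff d r ≤ -(2 / r ^ 2) + (slBound d - 8) * slWeight r := by
  have hd' : (5 : ℝ) ≤ d := by exact_mod_cast hd
  have h1 := one_sub_sq_pos hr
  have h0 : 0 < r ^ 2 := pow_pos hr.1 2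
  have hw := inv_one_sub_sq_le_slWeight hr
  have hV : -potential d r ≤ 8 * ((d : ℝ) - 3) / ((d : ℝ) - 4) := by
    have h4 : 0 < (d : ℝ) - 4 := by linarith
    rw [potential, neg_div, neg_neg, div_le_div_iff₀ (by positivity) h4]
    have : ((d : ℝ) - 4) ^ 2 ≤ ((d : ℝ) - 4 + r ^ 2) ^ 2 := by gcongr; linarith
    have h5 : 0 ≤ 8 * ((d : ℝ) - 3) := by linarith
    nlinarith
  have hV2 : -(potential d r / (1 - r ^ 2)) ≤ 8 * ((d : ℝ) - 3) / ((d : ℝ) - 4) * slWeight r := by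
    have e : -(potential d r / (1 - r ^ 2)) = -potential d r * (1 / (1 - r ^ 2)) := by ring
    rw [e]
    have : 0 ≤ 8 * ((d : ℝ) - 3) / ((d : ℝ) - 4) := div_nonneg (by linarith) (by linarith)
    gcongr
  have hA : 2 / r ^ 2 ≤ (((d : ℝ) - 3) * ((d : ℝ) - 1) / 4) / (r ^ 2 * (1 - r ^ 2) ^ 2) := by
    have hA2 : 2 ≤ ((d : ℝ) - 3) * ((d : ℝ) - 1) / 4 := by nlinarith
    apply div_le_div₀ (by linarith) hA2 (by positivity)
    have h2 : 1 - r ^ 2 ≤ 1 := by linarith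
    have : (1 - r ^ 2) ^ 2 ≤ 1 := by nlinarith
    nlinarith
  have hs : slCoeff d r = -((((d : ℝ) - 3) * ((d : ℝ) - 1) / 4) / (r ^ 2 * (1 - r ^ 2) ^ 2)) +
      (3 * (d : ℝ) - 9) / 2 * slWeight r + -(potential d r / (1 - r ^ 2)) := by
    rw [slCoeff, slWeight]
    have := hr.1.ne'
    have := h1.ne'
    field_simp
    ring
  rw [hs, slBound]
  linarith

lemma SLRegular.hasDerivAt {g : ℝ → ℂ} (hg : SLRegular g) {x : ℝ} (hx : x ∈ Ioo (0 : ℝ) 1) :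
    HasDerivAt g (deriv g x) x :=
  (hg.diff.differentiableAt (isOpen_Ioo.mem_nhds hx)).hasDerivAt

lemma SLRegular.ae_hasDerivAt_deriv {g : ℝ → ℂ} (hg : SLRegular g) :
    ∀ᵐ x, x ∈ Ioo (0 : ℝ) 1 → HasDerivAt (deriv g) (deriv (deriv g) x) x := by
  have := hg.ac_deriv.ae_differentiableAt
  rw [ae_restrict_iff' measurableSet_Ioo] at this
  filter_upwards [this] with x hx h
  exact (hx h).hasDerivAt

lemma deriv_deriv_eq (d : ℕ) (g : ℝ → ℂ) {r : ℝ} (hr : r ∈ Ioo (0 : ℝ) 1) :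
    deriv (deriv g) r = -((slWeight r : ℂ) * slTau d g r + (slCoeff d r : ℂ) * g r) := by
  have : (slWeight r : ℂ) ≠ 0 := by exact_mod_cast (slWeight_pos hr).ne'
  rw [slTau]
  push_cast
  field_simp
  ring

/-- One inequality provides the hypothesis of `endpoint_integrable` at both ends. The coefficient
itself need not be repulsive at `1`; the term `2|g|²/(1-r)²` is created by spending `8w|g|²`, which
is integrable for `g` in `H_w`, as is the rest of the bracket when `τ g` is in `H_w`. -/
lemma re_deriv_deriv_mul_conj_ge {d : ℕ} (hd : 5 ≤ d) (g : ℝ → ℂ) {r : ℝ}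
    (hr : r ∈ Ioo (0 : ℝ) 1) :
    2 * ‖g r‖ ^ 2 / r ^ 2 + 2 * ‖g r‖ ^ 2 / (1 - r) ^ 2 - (slBound d * (slWeight r * ‖g r‖ ^ 2) +
      slWeight r * (‖slTau d g r‖ * ‖g r‖)) ≤ (deriv (deriv g) r * conj (g r)).re := by
  have e1 : (deriv (deriv g) r * conj (g r)).re =
      -(slWeight r * (slTau d g r * conj (g r)).re) - slCoeff d r * ‖g r‖ ^ 2 := by
    rw [deriv_deriv_eq d g hr]
    have : ‖g r‖ ^ 2 = (g r * conj (g r)).re := by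
      rw [Complex.mul_conj, Complex.ofReal_re, Complex.normSq_eq_norm_sq]
    rw [this, ← Complex.re_ofReal_mul, ← Complex.re_ofReal_mul, ← Complex.neg_re,
      ← Complex.sub_re]
    congr 1
    ring
  have e2 : (slTau d g r * conj (g r)).re ≤ ‖slTau d g r‖ * ‖g r‖ := by
    have := Complex.re_le_norm (slTau d g r * conj (g r))
    rwa [norm_mul, Complex.norm_conj] at this
  have h1 := slCoeff_le hd hr
  have h2 := inv_one_sub_pow_le_slWeight hr
  have hw := slWeight_nonneg r
  rw [e1]
  have h3 : slCoeff d r * ‖g r‖ ^ 2 ≤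
      (-(2 / r ^ 2) + (slBound d - 8) * slWeight r) * ‖g r‖ ^ 2 := by gcongr
  have h4 : 1 / (1 - r) ^ 2 * ‖g r‖ ^ 2 ≤ 4 * slWeight r * ‖g r‖ ^ 2 := by gcongr
  have h5 : slWeight r * (slTau d g r * conj (g r)).re ≤
      slWeight r * (‖slTau d g r‖ * ‖g r‖) := by gcongr
  have e3 : 2 * ‖g r‖ ^ 2 / r ^ 2 = 2 / r ^ 2 * ‖g r‖ ^ 2 := by ring
  have e4 : 2 * ‖g r‖ ^ 2 / (1 - r) ^ 2 = 2 * (1 / (1 - r) ^ 2 * ‖g r‖ ^ 2) := by ring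
  rw [e3, e4]
  linarith

/-! ### Reflection of the interval and square integrability at the two endpoints. -/

lemma integrableOn_comp_one_sub {E : Type*} [NormedAddCommGroup E] {f : ℝ → E}
    (hf : IntegrableOn f (Ioo (0 : ℝ) 1)) : IntegrableOn (fun x => f (1 - x)) (Ioo (0 : ℝ) 1) := by
  have h := (Measure.measurePreserving_sub_left (volume : Measure ℝ) 1).integrableOn_comp_preimage
    (Homeomorph.subLeft (1 : ℝ)).measurableEmbedding (f := f) (s := Ioo 0 1)
  rw [Set.preimage_const_sub_Ioo] at h
  simpa using! h.2 hf

lemma ae_comp_one_sub {p : ℝ → Prop} (h : ∀ᵐ x : ℝ, p x) : ∀ᵐ x : ℝ, p (1 - x) :=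
  (Measure.measurePreserving_sub_left (volume : Measure ℝ) 1).quasiMeasurePreserving.ae h

/-- The reflected function is a constant plus the primitive of `-f'(1 - t)`, and primitives of
integrable functions are absolutely continuous. -/
lemma ac_comp_one_sub {f f' : ℝ → ℂ} {a b : ℝ} (hab : a ≤ b)
    (hf : AbsolutelyContinuousOnInterval f (1 - b) (1 - a))
    (hf' : ∀ᵐ x, x ∈ Icc (1 - b) (1 - a) → HasDerivAt f (f' x) x) :
    AbsolutelyContinuousOnInterval (fun x => f (1 - x)) a b := by
  have h1 : ∀ x ∈ Icc a b, f (1 - x) = f (1 - a) + ∫ t in a..x, -f' (1 - t) := by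
    intro x hx
    have h2 : AbsolutelyContinuousOnInterval f (1 - x) (1 - a) := by
      refine hf.mono ?_
      rw [uIcc_of_le (by linarith [hx.1]), uIcc_of_le (by linarith)]
      exact Icc_subset_Icc_left (by linarith [hx.2])
    have h3 := (ac_integral_eq_sub h2 (f' := f') (by
      filter_upwards [hf'] with t ht ht2
      rw [uIcc_of_le (by linarith [hx.1])] at ht2
      exact ht ⟨by linarith [hx.2, ht2.1], ht2.2⟩)).2
    rw [intervalIntegral.integral_neg, intervalIntegral.integral_comp_sub_left (fun t => f' t), h3]
    ring
  have h4 : IntervalIntegrable f' volume (1 - b) (1 - a) := (ac_integral_eq_sub hf (by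
      filter_upwards [hf'] with t ht ht2
      rw [uIcc_of_le (by linarith)] at ht2
      exact ht ht2)).1
  have h5 : IntervalIntegrable (fun t => -f' (1 - t)) volume a b := by
    have := (h4.comp_sub_left 1).neg
    simpa using! this.symm
  have h6 := ac_intervalIntegral h5 left_mem_uIcc
  have h7 : AbsolutelyContinuousOnInterval (fun _ : ℝ => f (1 - a)) a b :=
    (LipschitzWith.const (f (1 - a))).lipschitzOnWith.absolutelyContinuousOnInterval
  refine ac_congr (h7.fun_add h6) fun x hx => ?_
  rw [uIcc_of_le hab] at hx
  exact (h1 x hx).symm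

lemma integrableOn_slRemainder {d : ℕ} {g : ℝ → ℂ} (h2 : MemLp g 2 slMeasure)
    (hτ : MemLp (slTau d g) 2 slMeasure) :
    IntegrableOn (fun r => slBound d * (slWeight r * ‖g r‖ ^ 2) +
      slWeight r * (‖slTau d g r‖ * ‖g r‖)) (Ioo 0 1) :=
  ((integrableOn_normSq_of_memLp h2).const_mul _).add (integrableOn_norm_mul_of_memLp hτ h2)

lemma integrableOn_normSq {g : ℝ → ℂ} (hg : SLRegular g) (h2 : MemLp g 2 slMeasure) :
    IntegrableOn (fun r => ‖g r‖ ^ 2) (Ioo 0 1) := by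
  refine Integrable.mono' (integrableOn_normSq_of_memLp h2) ?_ ?_
  · exact ((hg.ac.continuousOn.norm.pow 2).aestronglyMeasurable measurableSet_Ioo)
  · rw [ae_restrict_iff' measurableSet_Ioo]
    filter_upwards with r hr
    rw [Real.norm_of_nonneg (by positivity)]
    exact le_mul_of_one_le_left (by positivity) (one_le_slWeight hr)

lemma integrable_endpoint_zero {d : ℕ} (hd : 5 ≤ d) {g : ℝ → ℂ} (hg : SLRegular g)
    (h2 : MemLp g 2 slMeasure) (hτ : MemLp (slTau d g) 2 slMeasure) :
    IntegrableOn (fun r => ‖deriv g r‖ ^ 2 / 2 + ‖g r‖ ^ 2 / r ^ 2) (Ioo 0 (1 / 2)) := by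
  have hs : Ioo (0 : ℝ) (1 / 2) ⊆ Ioo 0 1 := Ioo_subset_Ioo_right (by norm_num)
  refine endpoint_integrable (v2 := deriv (deriv g)) (by norm_num)
    (fun a ha => hg.ac a _ ha.1 ha.2.le (by norm_num)) (fun x hx => hg.hasDerivAt (hs hx))
    (fun a ha => hg.ac_deriv a _ ha.1 ha.2.le (by norm_num)) ?_
    ((integrableOn_normSq hg h2).mono_set hs)
    ((integrableOn_slRemainder h2 hτ).mono_set hs) ?_
  · filter_upwards [hg.ae_hasDerivAt_deriv] with x hx h
    exact hx (hs h)
  · filter_upwards with r hr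
    have := re_deriv_deriv_mul_conj_ge hd g (hs hr)
    have h0 : 0 ≤ 2 * ‖g r‖ ^ 2 / (1 - r) ^ 2 := by positivity
    linarith

lemma integrable_endpoint_one {d : ℕ} (hd : 5 ≤ d) {g : ℝ → ℂ} (hg : SLRegular g)
    (h2 : MemLp g 2 slMeasure) (hτ : MemLp (slTau d g) 2 slMeasure) :
    IntegrableOn (fun x => ‖-deriv g (1 - x)‖ ^ 2 / 2 + ‖g (1 - x)‖ ^ 2 / x ^ 2)
      (Ioo 0 (1 / 2)) := by
  have hs : Ioo (0 : ℝ) (1 / 2) ⊆ Ioo 0 1 := Ioo_subset_Ioo_right (by norm_num)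
  have hr : ∀ {x : ℝ}, x ∈ Ioo (0 : ℝ) (1 / 2) → 1 - x ∈ Ioo (0 : ℝ) 1 := fun {x} hx =>
    ⟨by linarith [hx.2], by linarith [hx.1]⟩
  refine endpoint_integrable (v := fun x => g (1 - x)) (v1 := fun x => -deriv g (1 - x))
    (v2 := fun x => deriv (deriv g) (1 - x)) (by norm_num) (fun a ha => ?_) (fun x hx => ?_)
    (fun a ha => ?_) ?_
    ((integrableOn_comp_one_sub (integrableOn_normSq hg h2)).mono_set hs)
    ((integrableOn_comp_one_sub (integrableOn_slRemainder h2 hτ)).mono_set hs) ?_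
  · refine ac_comp_one_sub (f' := deriv g) ha.2.le
      (hg.ac _ _ (by norm_num) (by linarith [ha.2]) (by linarith [ha.1])) ?_
    filter_upwards with x hx
    exact hg.hasDerivAt ⟨by linarith [hx.1], by linarith [hx.2, ha.1]⟩
  · simpa using! (hg.hasDerivAt (hr hx)).comp_const_sub 1 x
  · refine (ac_comp_one_sub (f' := deriv (deriv g)) ha.2.le
      (hg.ac_deriv _ _ (by norm_num) (by linarith [ha.2]) (by linarith [ha.1])) ?_).fun_neg
    filter_upwards [hg.ae_hasDerivAt_deriv] with x h hx
    exact h ⟨by linarith [hx.1], by linarith [hx.2, ha.1]⟩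
  · filter_upwards [ae_comp_one_sub hg.ae_hasDerivAt_deriv] with x h hx
    simpa using! ((h (hr hx)).comp_const_sub 1 x).neg
  · filter_upwards with x hx
    have := re_deriv_deriv_mul_conj_ge hd g (hr hx)
    have h0 : 0 ≤ 2 * ‖g (1 - x)‖ ^ 2 / (1 - x) ^ 2 := by positivity
    rw [sub_sub_cancel] at this
    linarith

/-- The Wronskian `conj(g)' h - conj(g) h'`. -/
def wronskian (g h : ℝ → ℂ) (x : ℝ) : ℂ := conj (deriv g x) * h x - conj (g x) * deriv h x

/-- The derivative of the Wronskian. -/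
def wronskianDeriv (g h : ℝ → ℂ) (x : ℝ) : ℂ :=
  conj (deriv (deriv g) x) * h x - conj (g x) * deriv (deriv h) x

lemma integral_wronskianDeriv {g h : ℝ → ℂ} (hg : SLRegular g) (hh : SLRegular h) {a b : ℝ}
    (ha : 0 < a) (hab : a ≤ b) (hb : b < 1) :
    ∫ x in a..b, wronskianDeriv g h x = wronskian g h b - wronskian g h a := by
  have a1 := ac_comp_lipschitz lipschitzWith_conj (hg.ac a b ha hab hb)
  have a2 := ac_comp_lipschitz lipschitzWith_conj (hg.ac_deriv a b ha hab hb)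
  have h1 := (a2.fun_smul (hh.ac a b ha hab hb)).fun_sub
    (a1.fun_smul (hh.ac_deriv a b ha hab hb))
  refine (ac_integral_eq_sub h1 ?_).2
  filter_upwards [hg.ae_hasDerivAt_deriv, hh.ae_hasDerivAt_deriv] with x h1 h2 hx
  rw [uIcc_of_le hab] at hx
  have hx' : x ∈ Ioo (0 : ℝ) 1 := ⟨ha.trans_le hx.1, hx.2.trans_lt hb⟩
  have c : ∀ {f : ℝ → ℂ} {f' : ℂ}, HasDerivAt f f' x →
      HasDerivAt (fun x => conj (f x)) (conj f') x := fun hf =>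
    Complex.conjCLE.toContinuousLinearMap.hasFDerivAt.comp_hasDerivAt x hf
  have := ((c (h1 hx')).mul (hh.hasDerivAt hx')).sub ((c (hg.hasDerivAt hx')).mul (h2 hx'))
  convert! this using 1
  rw [wronskianDeriv]
  ring

lemma wronskianDeriv_eq (d : ℕ) (g h : ℝ → ℂ) {x : ℝ} (hx : x ∈ Ioo (0 : ℝ) 1) :
    wronskianDeriv g h x =
      -(slWeight x • (conj (slTau d g x) * h x - conj (g x) * slTau d h x)) := by
  rw [wronskianDeriv, deriv_deriv_eq d g hx, deriv_deriv_eq d h hx]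
  simp only [map_neg, map_add, map_mul, Complex.conj_ofReal, Complex.real_smul]
  ring

/-- The difference of the two sides is a sum of squares. With `a`, `e` for derivatives and `b`, `c`
for values, this bounds a Wronskian at distance `x` from an endpoint by `x` times an integrable
function, the form needed for `frequently_mul_lt_of_integrableOn`. -/
lemma norm_mul_le_of_pos {x a b c e : ℝ} (hx : 0 < x) :
    a * b + c * e ≤ x * ((a ^ 2 / 2 + c ^ 2 / x ^ 2) + (e ^ 2 / 2 + b ^ 2 / x ^ 2)) := by
  have h : x * ((a ^ 2 / 2 + c ^ 2 / x ^ 2) + (e ^ 2 / 2 + b ^ 2 / x ^ 2)) - (a * b + c * e) =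
      x / 2 * ((a - b / x) ^ 2 + (e - c / x) ^ 2 + (b / x) ^ 2 + (c / x) ^ 2) := by
    field_simp
    ring
  have : 0 ≤ x / 2 * ((a - b / x) ^ 2 + (e - c / x) ^ 2 + (b / x) ^ 2 + (c / x) ^ 2) := by
    positivity
  linarith

lemma norm_wronskian_le (g h : ℝ → ℂ) (r : ℝ) :
    ‖wronskian g h r‖ ≤ ‖deriv g r‖ * ‖h r‖ + ‖g r‖ * ‖deriv h r‖ := by
  refine (norm_sub_le _ _).trans ?_
  simp

/-- Green's formula without boundary terms. -/
lemma integral_slTau_symm {d : ℕ} (hd : 5 ≤ d) {g h : ℝ → ℂ} (hg : SLRegular g)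
    (hh : SLRegular h) (g2 : MemLp g 2 slMeasure) (h2 : MemLp h 2 slMeasure)
    (gτ : MemLp (slTau d g) 2 slMeasure) (hτ : MemLp (slTau d h) 2 slMeasure) :
    ∫ r, conj (slTau d g r) * h r ∂slMeasure = ∫ r, conj (g r) * slTau d h r ∂slMeasure := by
  have cint : ∀ {u v : ℝ → ℂ}, MemLp u 2 slMeasure → MemLp v 2 slMeasure →
      Integrable (fun r => conj (u r) * v r) slMeasure := fun {u v} hu hv =>
    MemLp.integrable_mul (p := 2) (q := 2) hu.star hv
  have i1 := cint gτ h2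
  have i2 := cint g2 hτ
  rw [← sub_eq_zero, ← integral_sub i1 i2, integral_slMeasure]
  have hΦ : IntegrableOn (wronskianDeriv g h) (Ioo 0 1) := by
    have := (integrable_slMeasure_iff.1 (i1.sub i2)).neg
    refine Integrable.congr this ?_
    rw [Filter.EventuallyEq, ae_restrict_iff' measurableSet_Ioo]
    filter_upwards with x hx
    rw [wronskianDeriv_eq d g h hx]
    rfl
  have e : ∫ r in Ioo (0 : ℝ) 1, slWeight r • (conj (slTau d g r) * h r -
      conj (g r) * slTau d h r) = -∫ r in Ioo (0 : ℝ) 1, wronskianDeriv g h r := by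
    rw [← integral_neg]
    refine setIntegral_congr_fun measurableSet_Ioo fun x hx => ?_
    simp only [wronskianDeriv_eq d g h hx, neg_neg]
  have hs : Ioo (0 : ℝ) (1 / 2) ⊆ Ioo 0 1 := Ioo_subset_Ioo_right (by norm_num)
  have left : ∫ t in (0 : ℝ)..(1 / 2), wronskianDeriv g h t = wronskian g h (1 / 2) := by
    refine integral_eq_of_frequently_small (by norm_num) (hΦ.mono_set hs)
      (fun x hx => integral_wronskianDeriv hg hh hx.1 hx.2.le (by norm_num)) fun ε hε => ?_
    have hI := (integrable_endpoint_zero hd hg g2 gτ).add (integrable_endpoint_zero hd hh h2 hτ)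
    refine ((frequently_mul_lt_of_integrableOn (by norm_num) hI hε).and_eventually
      self_mem_nhdsWithin).mono fun x hx => lt_of_le_of_lt ?_ hx.1
    exact (norm_wronskian_le g h x).trans (norm_mul_le_of_pos hx.2)
  -- The endpoint `1` is reflected to `0`. The contributions of the two halves cancel at the
  -- midpoint `1/2`.
  have right : ∫ t in (0 : ℝ)..(1 / 2), -wronskianDeriv g h (1 - t) =
      wronskian g h (1 - 1 / 2) := by
    refine integral_eq_of_frequently_small (W := fun x => wronskian g h (1 - x)) (by norm_num)
      ((integrableOn_comp_one_sub hΦ).mono_set hs).neg (fun x hx => ?_) fun ε hε => ?_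
    · rw [intervalIntegral.integral_neg,
        intervalIntegral.integral_comp_sub_left (fun t => wronskianDeriv g h t),
        integral_wronskianDeriv hg hh (by norm_num) (by linarith [hx.2]) (by linarith [hx.1])]
      ring
    · have hI := (integrable_endpoint_one hd hg g2 gτ).add (integrable_endpoint_one hd hh h2 hτ)
      refine ((frequently_mul_lt_of_integrableOn (by norm_num) hI hε).and_eventually
        self_mem_nhdsWithin).mono fun x hx => lt_of_le_of_lt ?_ hx.1
      have := (norm_wronskian_le g h (1 - x)).trans (norm_mul_le_of_pos hx.2)
      simpa only [norm_neg] using! this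
  rw [intervalIntegral.integral_neg,
    intervalIntegral.integral_comp_sub_left (fun t => wronskianDeriv g h t)] at right
  have hI : ∀ {a b : ℝ}, 0 ≤ a → a ≤ b → b ≤ 1 →
      IntervalIntegrable (wronskianDeriv g h) volume a b := fun {a b} h0 hab h1 => by
    rw [intervalIntegrable_iff_integrableOn_Ioo_of_le hab]
    exact hΦ.mono_set (Ioo_subset_Ioo h0 h1)
  have tot := intervalIntegral.integral_add_adjacent_intervals
    (hI (a := 0) (b := 1 / 2) le_rfl (by norm_num) (by norm_num))
    (hI (a := 1 / 2) (b := 1) (by norm_num) (by norm_num) le_rfl)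
  rw [e, ← integral_Ioc_eq_integral_Ioo, ← intervalIntegral.integral_of_le zero_le_one, ← tot,
    left]
  norm_num at right ⊢
  rw [← right]
  ring

/-- Stated for pairs in the graph because it is used twice: for the inclusion of `T` in its adjoint,
and to show that the spectral parameter attached to `z` is real. -/
lemma slGraph_symm {d : ℕ} (hd : 5 ≤ d) {p p' : SLSpace × SLSpace} (hp : p ∈ slGraph d)
    (hp' : p' ∈ slGraph d) : inner ℂ p.2 p'.1 = inner ℂ p.1 p'.2 := by
  obtain ⟨g, hg, h1, h2⟩ := hp
  obtain ⟨h, hh, h1', h2'⟩ := hp'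
  have key := integral_slTau_symm hd hg hh ((Lp.memLp p.1).ae_eq h1) ((Lp.memLp p'.1).ae_eq h1')
    ((Lp.memLp p.2).ae_eq h2) ((Lp.memLp p'.2).ae_eq h2')
  rw [L2.inner_def, L2.inner_def]
  simp only [RCLike.inner_apply']
  calc _ = ∫ r, conj (slTau d g r) * h r ∂slMeasure :=
        integral_congr_ae (by filter_upwards [h2, h1'] with r e1 e2; rw [e1, e2])
    _ = ∫ r, conj (g r) * slTau d h r ∂slMeasure := key
    _ = _ := integral_congr_ae (by filter_upwards [h1, h2'] with r e1 e2; rw [e1, e2])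

/-! ### Self-adjointness of the Sturm–Liouville operator -/

/-- The interval is exhausted by countably many compact ones. The shift by `2` in the denominator
keeps the left end at most `1/2`, so that each of them is nonempty. -/
lemma ae_Ioo_of_forall_Icc {p : ℝ → Prop}
    (h : ∀ a b : ℝ, 0 < a → a ≤ b → b < 1 → ∀ᵐ x, x ∈ Icc a b → p x) :
    ∀ᵐ x, x ∈ Ioo (0 : ℝ) 1 → p x := by
  have key : ∀ n : ℕ, ∀ᵐ x : ℝ, x ∈ Icc (1 / ((n : ℝ) + 2)) (1 - 1 / ((n : ℝ) + 2)) → p x := by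
    intro n
    have hn : (0 : ℝ) < 1 / ((n : ℝ) + 2) := by positivity
    have hn2 : 1 / ((n : ℝ) + 2) ≤ 1 / 2 :=
      one_div_le_one_div_of_le (by norm_num) (by linarith [Nat.cast_nonneg (α := ℝ) n])
    exact h _ _ hn (by linarith) (by linarith)
  filter_upwards [ae_all_iff.2 key] with r hr hr01
  obtain ⟨n, hn⟩ := exists_nat_one_div_lt (lt_min hr01.1 (sub_pos.2 hr01.2))
  have hlt : 1 / ((n : ℝ) + 2) ≤ 1 / ((n : ℝ) + 1) :=
    one_div_le_one_div_of_le (by positivity) (by linarith)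
  have h1 := lt_min_iff.1 hn
  exact hr n ⟨by linarith [h1.1], by linarith [h1.2]⟩

lemma acLoc_integral {F : ℝ → ℂ} {c : ℝ} (hc : c ∈ Ioo (0 : ℝ) 1)
    (hF : ∀ a b : ℝ, 0 < a → a ≤ b → b < 1 → IntervalIntegrable F volume a b) :
    ACLoc (fun x => ∫ t in c..x, F t) := by
  intro a b ha hab hb
  have h1 : min a c ≤ max b c := (min_le_left a c).trans (hab.trans (le_max_left b c))
  refine (ac_intervalIntegral (hF (min a c) (max b c) (lt_min ha hc.1) h1
    (max_lt hb hc.2)) ?_).mono ?_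
  · rw [uIcc_of_le h1]; exact ⟨min_le_right _ _, le_max_right _ _⟩
  · rw [uIcc_of_le h1, uIcc_of_le hab]
    exact Icc_subset_Icc (min_le_left _ _) (le_max_left _ _)

lemma ae_hasDerivAt_integral_Ioo {F : ℝ → ℂ} {c : ℝ} (hc : c ∈ Ioo (0 : ℝ) 1)
    (hF : ∀ a b : ℝ, 0 < a → a ≤ b → b < 1 → IntervalIntegrable F volume a b) :
    ∀ᵐ x, x ∈ Ioo (0 : ℝ) 1 → HasDerivAt (fun x => ∫ t in c..x, F t) (F x) x := by
  refine ae_Ioo_of_forall_Icc fun a b ha hab hb => ?_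
  have h1 : min a c ≤ max b c := (min_le_left a c).trans (hab.trans (le_max_left b c))
  filter_upwards [(hF (min a c) (max b c) (lt_min ha hc.1) h1
    (max_lt hb hc.2)).ae_hasDerivAt_integral] with x hx h
  rw [uIcc_of_le h1] at hx
  exact hx ⟨(min_le_left _ _).trans h.1, h.2.trans (le_max_left _ _)⟩ c
    ⟨min_le_right _ _, le_max_right _ _⟩

lemma hasDerivAt_integral_Ioo {F : ℝ → ℂ} {c : ℝ} (hc : c ∈ Ioo (0 : ℝ) 1)
    (hF : ContinuousOn F (Ioo (0 : ℝ) 1)) {x : ℝ} (hx : x ∈ Ioo (0 : ℝ) 1) :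
    HasDerivAt (fun x => ∫ t in c..x, F t) (F x) x := by
  refine intervalIntegral.integral_hasDerivAt_right ?_ ?_
    (hF.continuousAt (isOpen_Ioo.mem_nhds hx))
  · refine (hF.mono ?_).intervalIntegrable
    exact (ordConnected_Ioo.uIcc_subset hc hx)
  · exact hF.stronglyMeasurableAtFilter isOpen_Ioo x hx

lemma intervalIntegrable_of_continuousOn_Ioo {F : ℝ → ℂ} (hF : ContinuousOn F (Ioo (0 : ℝ) 1))
    {a b : ℝ} (ha : 0 < a) (hab : a ≤ b) (hb : b < 1) : IntervalIntegrable F volume a b := by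
  refine (hF.mono ?_).intervalIntegrable
  rw [uIcc_of_le hab]
  exact fun x hx => ⟨ha.trans_le hx.1, hx.2.trans_lt hb⟩

/-- A twofold primitive of a locally integrable function on `(0,1)`. -/
def primitiveTwo (c : ℝ) (F : ℝ → ℂ) (x : ℝ) : ℂ := ∫ s in c..x, ∫ t in c..s, F t

section primitive

variable {F : ℝ → ℂ} {c : ℝ}

lemma hasDerivAt_primitiveTwo (hc : c ∈ Ioo (0 : ℝ) 1)
    (hF : ∀ a b : ℝ, 0 < a → a ≤ b → b < 1 → IntervalIntegrable F volume a b) {x : ℝ}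
    (hx : x ∈ Ioo (0 : ℝ) 1) : HasDerivAt (primitiveTwo c F) (∫ t in c..x, F t) x :=
  hasDerivAt_integral_Ioo hc (acLoc_integral hc hF).continuousOn hx

lemma slRegular_primitiveTwo (hc : c ∈ Ioo (0 : ℝ) 1)
    (hF : ∀ a b : ℝ, 0 < a → a ≤ b → b < 1 → IntervalIntegrable F volume a b) :
    SLRegular (primitiveTwo c F) where
  ac := acLoc_integral hc fun _ _ ha hab hb =>
    intervalIntegrable_of_continuousOn_Ioo (acLoc_integral hc hF).continuousOn ha hab hb
  diff _ hx := (hasDerivAt_primitiveTwo hc hF hx).differentiableAt.differentiableWithinAt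
  ac_deriv := (acLoc_integral hc hF).congr fun _ hx => (hasDerivAt_primitiveTwo hc hF hx).deriv.symm

lemma deriv_deriv_primitiveTwo (hc : c ∈ Ioo (0 : ℝ) 1)
    (hF : ∀ a b : ℝ, 0 < a → a ≤ b → b < 1 → IntervalIntegrable F volume a b) :
    ∀ᵐ x, x ∈ Ioo (0 : ℝ) 1 → deriv (deriv (primitiveTwo c F)) x = F x := by
  filter_upwards [ae_hasDerivAt_integral_Ioo hc hF] with x hx h
  rw [← (hx h).deriv]
  apply Filter.EventuallyEq.deriv_eq
  filter_upwards [isOpen_Ioo.mem_nhds h] with y hy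
  exact (hasDerivAt_primitiveTwo hc hF hy).deriv

end primitive

lemma integral_eq_zero_of_forall_Ioo {F : ℝ → ℂ} {a b : ℝ}
    (h : ∀ x ∈ Ioo (min a b) (max a b), F x = 0) : ∫ t in a..b, F t = 0 := by
  rw [intervalIntegral.integral_congr_ae (g := fun _ => 0), intervalIntegral.integral_zero]
  have h1 : ∀ᵐ x : ℝ, x ≠ max a b := by simp [ae_iff, measure_singleton]
  filter_upwards [h1] with x hx hm
  rw [uIoc, mem_Ioc] at hm
  exact h x ⟨hm.1, lt_of_le_of_ne hm.2 hx⟩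

/-- Two vanishing moments give the twofold primitive compact support. The first one kills the simple
primitive beyond `b`. Integration by parts turns the value of the double primitive at `b` into minus
the first moment; where that moment is centred is immaterial once the integral of `ψ` is zero. -/
lemma primitiveTwo_eq_zero {ψ : ℝ → ℂ} {a b : ℝ} (ha : 0 < a) (hab : a < b) (hb : b < 1)
    (hψ : Integrable ψ) (h0 : ∀ x, x ∉ Ioo a b → ψ x = 0) (h1 : ∫ t in a..b, ψ t = 0)
    (h2 : ∫ t in a..b, ((t - 1 / 2 : ℝ) : ℂ) * ψ t = 0) {x : ℝ} (hx : x ∉ Ioo a b) :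
    ∫ t in a..x, ψ t = 0 ∧ primitiveTwo a ψ x = 0 := by
  have zl : ∀ y ≤ a, ∫ t in a..y, ψ t = 0 := fun y hy => by
    refine integral_eq_zero_of_forall_Ioo fun t ht => h0 t fun h => ?_
    rw [max_eq_left hy] at ht
    exact lt_asymm ht.2 h.1
  have zr : ∀ y, b ≤ y → ∫ t in a..y, ψ t = 0 := fun y hy => by
    rw [← intervalIntegral.integral_add_adjacent_intervals (b := b) hψ.intervalIntegrable
      hψ.intervalIntegrable, h1, zero_add]
    refine integral_eq_zero_of_forall_Ioo fun t ht => h0 t fun h => ?_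
    rw [min_eq_left hy] at ht
    exact lt_asymm ht.1 h.2
  have hψ1 : Continuous fun s => ∫ t in a..s, ψ t :=
    intervalIntegral.continuous_primitive (fun _ _ => hψ.intervalIntegrable) a
  rcases le_or_gt x a with hxa | hxa
  · refine ⟨zl x hxa, integral_eq_zero_of_forall_Ioo fun t ht => zl t ?_⟩
    rw [max_eq_left hxa] at ht
    exact ht.2.le
  · have hxb : b ≤ x := not_lt.1 fun h => hx ⟨hxa, h⟩
    refine ⟨zr x hxb, ?_⟩
    rw [primitiveTwo, ← intervalIntegral.integral_add_adjacent_intervals (b := b)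
      (hψ1.intervalIntegrable _ _) (hψ1.intervalIntegrable _ _)]
    have e2 : ∫ s in b..x, ∫ t in a..s, ψ t = 0 := by
      refine integral_eq_zero_of_forall_Ioo fun t ht => zr t ?_
      rw [min_eq_left hxb] at ht
      exact ht.1.le
    have hI : ∀ a b : ℝ, 0 < a → a ≤ b → b < 1 → IntervalIntegrable ψ volume a b :=
      fun _ _ _ _ _ => hψ.intervalIntegrable
    have haI : a ∈ Ioo (0 : ℝ) 1 := ⟨ha, hab.trans hb⟩
    have ac1 := acLoc_integral haI hI a b ha hab.le hb
    have ac0 : AbsolutelyContinuousOnInterval (fun t : ℝ => ((t - 1 / 2 : ℝ) : ℂ)) a b := by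
      apply ContDiffOn.absolutelyContinuousOnInterval
      exact (Complex.ofRealCLM.contDiff.comp (contDiff_id.sub contDiff_const)).contDiffOn
    -- Integration by parts of `t - 1/2` against the primitive of `ψ`, which vanishes at both `a`
    -- and `b`.
    have key := ac_integral_eq_sub (ac0.fun_smul ac1)
      (f' := fun t => ((t - 1 / 2 : ℝ) : ℂ) * ψ t + ∫ s in a..t, ψ s) (by
        filter_upwards [ae_hasDerivAt_integral_Ioo haI hI] with t ht h
        rw [uIcc_of_le hab.le] at h
        have d1 := ht ⟨ha.trans_le h.1, h.2.trans_lt hb⟩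
        have d0 : HasDerivAt (fun t : ℝ => ((t - 1 / 2 : ℝ) : ℂ)) 1 t := by
          simpa using! ((hasDerivAt_id t).sub_const (1 / 2)).ofReal_comp
        convert! d0.mul d1 using 1
        ring)
    have i1 : IntervalIntegrable (fun t : ℝ => ((t - 1 / 2 : ℝ) : ℂ) * ψ t) volume a b := by
      refine IntervalIntegrable.continuousOn_mul hψ.intervalIntegrable ?_
      fun_prop
    have k2 := key.2
    rw [intervalIntegral.integral_add i1 (hψ1.intervalIntegrable _ _), h2, zero_add] at k2
    rw [e2, k2]
    simp [h1]

lemma memLp_slMeasure_of_bounded {f : ℝ → ℂ} {a b C : ℝ} (ha : 0 < a) (hb : b < 1)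
    (hf : AEStronglyMeasurable f (volume.restrict (Ioo (0 : ℝ) 1)))
    (h0 : ∀ᵐ x, x ∈ Ioo (0 : ℝ) 1 → x ∉ Ioo a b → f x = 0)
    (hC : ∀ᵐ x, x ∈ Ioo a b → ‖f x‖ ≤ C) : MemLp f 2 slMeasure := by
  rw [memLp_two_iff_integrable_sq_norm (hf.mono_ac slMeasure_ac), integrable_slMeasure_iff]
  have hwc : ContinuousOn slWeight (Icc a b) := by
    refine continuousOn_const.div (by fun_prop) fun x hx => ?_
    have : 0 < 1 - x ^ 2 := one_sub_sq_pos ⟨ha.trans_le hx.1, hx.2.trans_lt hb⟩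
    positivity
  obtain ⟨M, hM⟩ := isCompact_Icc.exists_bound_of_continuousOn hwc
  refine Integrable.mono' (g := fun _ => |M| * C ^ 2) (integrable_const _)
    (measurable_slWeight.aestronglyMeasurable.smul (hf.norm.pow 2)) ?_
  rw [ae_restrict_iff' measurableSet_Ioo]
  filter_upwards [h0, hC] with x h1 h2 hx
  by_cases hxm : x ∈ Ioo a b
  · rw [norm_smul]
    have h3 := (hM x ⟨hxm.1.le, hxm.2.le⟩).trans (le_abs_self M)
    have h4 := h2 hxm
    rw [norm_pow, norm_norm]
    gcongr
  · rw [h1 hx hxm]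
    simp
    positivity

lemma continuousOn_slCoeff (d : ℕ) (hd : 5 ≤ d) : ContinuousOn (slCoeff d) (Ioo (0 : ℝ) 1) := by
  have hd' : (5 : ℝ) ≤ d := by exact_mod_cast hd
  have hp : ∀ r ∈ Ioo (0 : ℝ) 1, (1 - r ^ 2) ≠ 0 := fun r hr => (one_sub_sq_pos hr).ne'
  have h0 : ∀ r ∈ Ioo (0 : ℝ) 1, r ^ 2 * (1 - r ^ 2) ^ 2 ≠ 0 := fun r hr =>
    mul_ne_zero (pow_ne_zero 2 hr.1.ne') (pow_ne_zero 2 (hp r hr))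
  have hq : ContinuousOn (potential d) (Ioo (0 : ℝ) 1) := by
    refine continuousOn_const.div (by fun_prop) fun r hr => ?_
    have : 0 < (d : ℝ) - 4 + r ^ 2 := by nlinarith [sq_nonneg r]
    positivity
  exact ((ContinuousOn.div (by fun_prop) (by fun_prop) h0).add
    (hq.div (by fun_prop) hp)).neg

lemma continuousOn_slWeight : ContinuousOn slWeight (Ioo (0 : ℝ) 1) := by
  refine continuousOn_const.div (by fun_prop) fun x hx => ?_
  have := one_sub_sq_pos hx
  positivity

lemma integrableOn_of_memLp_slMeasure {g : ℝ → ℂ} (hg : MemLp g 2 slMeasure) :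
    IntegrableOn g (Ioo 0 1) := by
  have hm : AEStronglyMeasurable g (volume.restrict (Ioo (0 : ℝ) 1)) := hg.1.mono_ac ac_slMeasure
  have h2 : MemLp g 2 (volume.restrict (Ioo (0 : ℝ) 1)) := by
    rw [memLp_two_iff_integrable_sq_norm hm]
    refine Integrable.mono' (integrableOn_normSq_of_memLp hg) (hm.norm.pow 2) ?_
    rw [ae_restrict_iff' measurableSet_Ioo]
    filter_upwards with r hr
    rw [Real.norm_of_nonneg (by positivity)]
    exact le_mul_of_one_le_left (by positivity) (one_le_slWeight hr)
  exact h2.integrable (by norm_num)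

lemma inner_SLSpace {u v : SLSpace} {f g : ℝ → ℂ} (hu : u =ᵐ[slMeasure] f)
    (hv : v =ᵐ[slMeasure] g) :
    inner ℂ u v = ∫ r in Ioo (0 : ℝ) 1, (slWeight r : ℂ) * (conj (f r) * g r) := by
  rw [L2.inner_def]
  simp only [RCLike.inner_apply']
  have h := integral_slMeasure (fun r => conj (f r) * g r)
  simp only [Complex.real_smul] at h
  rw [← h]
  exact integral_congr_ae (by filter_upwards [hu, hv] with r e1 e2; rw [e1, e2])

lemma integrableOn_conj {f : ℝ → ℂ} {s : Set ℝ} (hf : IntegrableOn f s) :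
    IntegrableOn (fun x => conj (f x)) s :=
  Complex.conjCLE.toContinuousLinearMap.integrable_comp hf

/-- Testing with compactly supported elements of the domain. -/
lemma integral_conj_mul_eq_zero {d : ℕ} (hd : 5 ≤ d) {v v' : SLSpace}
    (H : ∀ p ∈ slGraph d, inner ℂ v' p.1 = inner ℂ v p.2) {a b : ℝ}
    (ha : 0 < a) (ha2 : a < 1 / 2) (hb2 : 1 / 2 < b) (hb : b < 1) {ψ : ℝ → ℂ} {C : ℝ}
    (hψm : StronglyMeasurable ψ) (hψC : ∀ x, ‖ψ x‖ ≤ C)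
    (h0 : ∀ x, x ∉ Ioo a b → ψ x = 0) (h1 : ∫ t in a..b, ψ t = 0)
    (h2 : ∫ t in a..b, ((t - 1 / 2 : ℝ) : ℂ) * ψ t = 0)
    {F : ℝ → ℂ} (hF : F = fun r => -((slWeight r : ℂ) * v' r + (slCoeff d r : ℂ) * v r))
    (hFi : ∀ a b : ℝ, 0 < a → a ≤ b → b < 1 → IntervalIntegrable F volume a b) :
    ∫ t in a..b, conj (v t - primitiveTwo (1 / 2) F t) * ψ t = 0 := by
  have hab : a < b := ha2.trans hb2
  have haI : a ∈ Ioo (0 : ℝ) 1 := ⟨ha, hab.trans hb⟩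
  have hcI : (1 / 2 : ℝ) ∈ Ioo (0 : ℝ) 1 := ⟨by norm_num, by norm_num⟩
  have hsub : Icc a b ⊆ Ioo (0 : ℝ) 1 := fun x hx => ⟨ha.trans_le hx.1, hx.2.trans_lt hb⟩
  have hψi : Integrable ψ := by
    have : IntegrableOn ψ (Ioo a b) := Measure.integrableOn_of_bounded (M := C)
      (measure_Ioo_lt_top.ne) hψm.aestronglyMeasurable (ae_of_all _ hψC)
    rw [integrableOn_iff_integrable_of_support_subset] at this
    · exact this
    · intro x hx
      by_contra hcon
      exact hx (h0 x hcon)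
  have hψI : ∀ a b : ℝ, 0 < a → a ≤ b → b < 1 → IntervalIntegrable ψ volume a b :=
    fun _ _ _ _ _ => hψi.intervalIntegrable
  set φ := primitiveTwo a ψ with hφ
  have hφr : SLRegular φ := slRegular_primitiveTwo haI hψI
  have hφ2 := deriv_deriv_primitiveTwo haI hψI
  have hz := fun {x : ℝ} (hx : x ∉ Ioo a b) =>
    primitiveTwo_eq_zero ha hab hb hψi h0 h1 h2 hx
  have hτ : ∀ᵐ x, x ∈ Ioo (0 : ℝ) 1 → slTau d φ x =
      -((1 / slWeight x : ℝ) : ℂ) * (ψ x + (slCoeff d x : ℂ) * φ x) := by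
    filter_upwards [hφ2] with x hx h
    rw [slTau, hx h]
  have hφc : ContinuousOn φ (Ioo 0 1) := hφr.ac.continuousOn
  have hqc := continuousOn_slCoeff d hd
  have hqcc : ContinuousOn (fun x => (slCoeff d x : ℂ)) (Ioo 0 1) :=
    Complex.continuous_ofReal.comp_continuousOn hqc
  have hwcc : ContinuousOn (fun x => (slWeight x : ℂ)) (Ioo 0 1) :=
    Complex.continuous_ofReal.comp_continuousOn continuousOn_slWeight
  have hm2 : AEStronglyMeasurable (fun x => -((1 / slWeight x : ℝ) : ℂ) *
      (ψ x + (slCoeff d x : ℂ) * φ x)) (volume.restrict (Ioo (0 : ℝ) 1)) := by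
    refine AEStronglyMeasurable.mul (Measurable.aestronglyMeasurable ?_)
      (hψm.aestronglyMeasurable.add
      ((hqcc.mul hφc).aestronglyMeasurable measurableSet_Ioo))
    exact (Complex.measurable_ofReal.comp (measurable_const.div measurable_slWeight)).neg
  have hφm : MemLp φ 2 slMeasure := by
    obtain ⟨M, hM⟩ := isCompact_Icc.exists_bound_of_continuousOn (hφc.mono hsub)
    refine memLp_slMeasure_of_bounded (C := M) ha hb
      (hφc.aestronglyMeasurable measurableSet_Ioo)
      (ae_of_all _ fun x _ hx => (hz hx).2)
      (ae_of_all _ fun x hx => hM x (Ioo_subset_Icc_self hx))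
  have hτm : MemLp (slTau d φ) 2 slMeasure := by
    obtain ⟨M, hM⟩ := isCompact_Icc.exists_bound_of_continuousOn ((hqcc.mul hφc).mono hsub)
    refine memLp_slMeasure_of_bounded (C := C + M) ha hb ?_ ?_ ?_
    · refine hm2.congr ?_
      rw [Filter.EventuallyEq, ae_restrict_iff' measurableSet_Ioo]
      filter_upwards [hτ] with x hx h
      exact (hx h).symm
    · filter_upwards [hτ] with x hx h h'
      rw [hx h, h0 x h', hφ, (hz h').2]
      simp
    · filter_upwards [hτ] with x hx h
      have h' := hsub (Ioo_subset_Icc_self h)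
      rw [hx h', norm_mul, norm_neg]
      have k1 : ‖((1 / slWeight x : ℝ) : ℂ)‖ ≤ 1 := by
        rw [Complex.norm_real, Real.norm_of_nonneg (by have := slWeight_nonneg x; positivity)]
        rw [div_le_one (slWeight_pos h')]
        exact one_le_slWeight h'
      have k2 := (norm_add_le (ψ x) ((slCoeff d x : ℂ) * φ x)).trans
        (add_le_add (hψC x) (hM x (Ioo_subset_Icc_self h)))
      calc _ ≤ 1 * (C + M) := by gcongr
        _ = _ := one_mul _
  have hp : ((hφm.toLp φ, hτm.toLp _) : SLSpace × SLSpace) ∈ slGraph d :=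
    ⟨φ, hφr, hφm.coeFn_toLp, hτm.coeFn_toLp⟩
  have key := H _ hp
  rw [inner_SLSpace (ae_eq_refl _) hφm.coeFn_toLp,
    inner_SLSpace (ae_eq_refl _) (hτm.coeFn_toLp.trans (?_ : _ =ᵐ[slMeasure]
      fun x => -((1 / slWeight x : ℝ) : ℂ) * (ψ x + (slCoeff d x : ℂ) * φ x)))] at key
  swap
  · apply slMeasure_ac.ae_eq
    rw [Filter.EventuallyEq, ae_restrict_iff' measurableSet_Ioo]
    exact hτ
  -- reduce to the interval `(a, b)`
  have red : ∀ {f : ℝ → ℂ}, (∀ x, x ∉ Ioo a b → f x = 0) →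
      ∫ x in Ioo (0 : ℝ) 1, f x = ∫ x in a..b, f x := by
    intro f hf
    rw [intervalIntegral.integral_of_le hab.le, integral_Ioc_eq_integral_Ioo]
    refine setIntegral_eq_of_subset_of_forall_sdiff_eq_zero measurableSet_Ioo
      (fun x hx => hsub (Ioo_subset_Icc_self hx)) fun x hx => hf x hx.2
  have hvi : IntegrableOn v (Ioo 0 1) := integrableOn_of_memLp_slMeasure (Lp.memLp v)
  have hvI : IntervalIntegrable (fun x => conj (v x)) volume a b := by
    rw [intervalIntegrable_iff_integrableOn_Ioo_of_le hab.le]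
    exact integrableOn_conj (hvi.mono_set (fun x hx => hsub (Ioo_subset_Icc_self hx)))
  have hvψ : IntervalIntegrable (fun x => conj (v x) * ψ x) volume a b := by
    rw [intervalIntegrable_iff_integrableOn_Ioo_of_le hab.le] at hvI ⊢
    exact hvI.mul_bdd (c := C) hψm.aestronglyMeasurable (ae_of_all _ hψC)
  have hFφ : IntervalIntegrable (fun x => conj (F x) * φ x) volume a b := by
    have hFI : IntervalIntegrable (fun x => conj (F x)) volume a b := by
      have := hFi a b ha hab.le hb
      rw [intervalIntegrable_iff_integrableOn_Ioo_of_le hab.le] at this ⊢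
      exact integrableOn_conj this
    refine hFI.mul_continuousOn ?_
    rw [uIcc_of_le hab.le]
    exact hφc.mono hsub
  -- The relation `H` for the pair `(φ, τφ)`, with `φ'' = ψ`: the weights cancel and the
  -- zeroth-order terms are collected in `F`. It says that `v'' = F` weakly.
  have step1 : ∫ x in a..b, conj (v x) * ψ x = ∫ x in a..b, conj (F x) * φ x := by
    rw [red (fun x hx => by rw [hφ, (hz hx).2]; ring),
      red (fun x hx => by rw [h0 x hx, hφ, (hz hx).2]; ring)] at key
    rw [← sub_eq_zero, ← intervalIntegral.integral_sub hvψ hFφ]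
    have e : ∀ x ∈ uIcc a b, conj (v x) * ψ x - conj (F x) * φ x =
        (slWeight x : ℂ) * (conj (v' x) * φ x) - (slWeight x : ℂ) * (conj (v x) *
          (-((1 / slWeight x : ℝ) : ℂ) * (ψ x + (slCoeff d x : ℂ) * φ x))) := by
      intro x hx
      rw [uIcc_of_le hab.le] at hx
      have hw : (slWeight x : ℂ) ≠ 0 := by exact_mod_cast (slWeight_pos (hsub hx)).ne'
      simp only [hF, map_neg, map_add, map_mul, Complex.conj_ofReal]
      push_cast
      field_simp
      ring
    rw [intervalIntegral.integral_congr e, intervalIntegral.integral_sub, key, sub_self]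
    · have i1 : IntervalIntegrable (fun x => (slWeight x : ℂ) * φ x * conj (v' x)) volume a b := by
        refine IntervalIntegrable.continuousOn_mul ?_ ?_
        · rw [intervalIntegrable_iff_integrableOn_Ioo_of_le hab.le]
          exact integrableOn_conj ((integrableOn_of_memLp_slMeasure (Lp.memLp v')).mono_set
            (fun x hx => hsub (Ioo_subset_Icc_self hx)))
        · rw [uIcc_of_le hab.le]
          exact (hwcc.mul hφc).mono hsub
      refine i1.congr fun x _ => ?_
      ring
    · have i1 : IntervalIntegrable (fun x => -(conj (v x) * ψ x) +
          -((slCoeff d x : ℂ) * φ x) * conj (v x)) volume a b := by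
        refine hvψ.neg.add (IntervalIntegrable.continuousOn_mul hvI ?_)
        rw [uIcc_of_le hab.le]
        exact ((hqcc.mul hφc).mono hsub).neg
      refine i1.congr fun x hx => ?_
      have hx' : x ∈ Ioo (0 : ℝ) 1 := by
        rw [uIoc_of_le hab.le] at hx
        exact hsub (Ioc_subset_Icc_self hx)
      have hw : (slWeight x : ℂ) ≠ 0 := by exact_mod_cast (slWeight_pos hx').ne'
      push_cast
      field_simp
      ring
  -- integrate by parts
  have hvr := slRegular_primitiveTwo hcI hFi
  have hv2 := deriv_deriv_primitiveTwo hcI hFi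
  have conjD : ∀ {f : ℝ → ℂ} {f' : ℂ} {x : ℝ}, HasDerivAt f f' x →
      HasDerivAt (fun x => conj (f x)) (conj f') x := fun hf =>
    Complex.conjCLE.toContinuousLinearMap.hasFDerivAt.comp_hasDerivAt _ hf
  -- Integrating `(P' φ - P φ')'`, with `P` the conjugate of the twofold primitive of `F`, gives no
  -- boundary terms because `φ` and `φ'` vanish at `a` and `b`. So `F` tested with `φ` equals its
  -- double primitive tested with `ψ`.
  have step2 := ac_integral_eq_sub
    (((ac_comp_lipschitz lipschitzWith_conj (hvr.ac_deriv a b ha hab.le hb)).fun_smul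
      (hφr.ac a b ha hab.le hb)).fun_sub
    ((ac_comp_lipschitz lipschitzWith_conj (hvr.ac a b ha hab.le hb)).fun_smul
      (hφr.ac_deriv a b ha hab.le hb)))
    (f' := fun x => conj (F x) * φ x - conj (primitiveTwo (1 / 2) F x) * ψ x) (by
      filter_upwards [hφ2, hv2, hφr.ae_hasDerivAt_deriv, hvr.ae_hasDerivAt_deriv]
        with x k1 k2 k3 k4 hx
      rw [uIcc_of_le hab.le] at hx
      have hx' := hsub hx
      have e3 := k3 hx'
      have e4 := k4 hx'
      rw [k1 hx'] at e3
      rw [k2 hx'] at e4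
      convert! ((conjD e4).mul (hφr.hasDerivAt hx')).sub
        ((conjD (hvr.hasDerivAt hx')).mul e3) using 1
      ring)
  have hza := hz (x := a) (fun h => lt_irrefl _ h.1)
  have hzb := hz (x := b) (fun h => lt_irrefl _ h.2)
  have dφ : ∀ {x : ℝ}, x ∈ Icc a b → deriv φ x = ∫ t in a..x, ψ t := fun hx =>
    (hasDerivAt_primitiveTwo haI hψI (hsub hx)).deriv
  have step3 := step2.2
  have e0 : primitiveTwo a ψ a = φ a := rfl
  rw [dφ (right_mem_Icc.2 hab.le), dφ (left_mem_Icc.2 hab.le), hza.1, hzb.1, hφ, hza.2, hzb.2,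
    ← hφ] at step3
  have hpψ : IntervalIntegrable (fun x => conj (primitiveTwo (1 / 2) F x) * ψ x) volume a b := by
    refine IntervalIntegrable.continuousOn_mul hψi.intervalIntegrable ?_
    rw [uIcc_of_le hab.le]
    exact (Complex.continuous_conj.comp_continuousOn hvr.ac.continuousOn).mono hsub
  rw [intervalIntegral.integral_sub hFφ hpψ, ← step1,
    ← intervalIntegral.integral_sub hvψ hpψ] at step3
  simp only [smul_zero, sub_zero] at step3
  rw [← step3]
  refine intervalIntegral.integral_congr fun x _ => ?_
  simp only [map_sub]
  ring

/-- A function annihilating all compactly supported functions with vanishing moments of orders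
zero and one is affine. -/
lemma ae_eq_affine {D : ℝ → ℂ}
    (hD : ∀ a b : ℝ, 0 < a → a ≤ b → b < 1 → IntervalIntegrable D volume a b)
    (H : ∀ a b : ℝ, 0 < a → a < 1 / 4 → 3 / 4 < b → b < 1 → ∀ (ψ : ℝ → ℂ) (C : ℝ),
      StronglyMeasurable ψ → (∀ x, ‖ψ x‖ ≤ C) → (∀ x, x ∉ Ioo a b → ψ x = 0) →
      ∫ t in a..b, ψ t = 0 → ∫ t in a..b, ((t - 1 / 2 : ℝ) : ℂ) * ψ t = 0 →
      ∫ t in a..b, conj (D t) * ψ t = 0) :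
    ∃ A B : ℂ, ∀ᵐ x, x ∈ Ioo (0 : ℝ) 1 → D x = A + B * ((x - 1 / 2 : ℝ) : ℂ) := by
  set J : Set ℝ := Icc (1 / 4) (3 / 4) with hJ
  -- `η1` and `η2` are biorthogonal to `1` and `t - 1/2`: `J` has length `1/2` and the integral of
  -- `(t - 1/2)²` over `J` is `1/96`. Since `J` is fixed, `A` and `B` do not depend on the interval
  -- `(a, b)`.
  set η1 : ℝ → ℂ := J.indicator fun _ => 2 with hη1
  set η2 : ℝ → ℂ := J.indicator fun t => 96 * ((t - 1 / 2 : ℝ) : ℂ) with hη2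
  set A : ℂ := conj (∫ t in (1 / 4 : ℝ)..(3 / 4), conj (D t) * 2) with hA
  set B : ℂ := conj (∫ t in (1 / 4 : ℝ)..(3 / 4), conj (D t) * (96 * ((t - 1 / 2 : ℝ) : ℂ)))
    with hB
  refine ⟨A, B, ?_⟩
  have main : ∀ a b : ℝ, 0 < a → a < 1 / 4 → 3 / 4 < b → b < 1 →
      ∀ᵐ x, x ∈ Ioo a b → D x = A + B * ((x - 1 / 2 : ℝ) : ℂ) := by
    intro a b ha ha4 hb4 hb
    have hab : a < b := by linarith
    have hJs : J ⊆ Ioo a b := fun x hx => ⟨ha4.trans_le hx.1, hx.2.trans_lt hb4⟩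
    have red : ∀ f : ℝ → ℂ, ∫ t in a..b, J.indicator f t = ∫ t in (1 / 4 : ℝ)..(3 / 4), f t := by
      intro f
      rw [intervalIntegral.integral_of_le hab.le, integral_Ioc_eq_integral_Ioo,
        setIntegral_indicator measurableSet_Icc, inter_eq_self_of_subset_right hJs,
        intervalIntegral.integral_of_le (by norm_num), integral_Icc_eq_integral_Ioc]
    have redm : ∀ f g : ℝ → ℂ, ∫ t in a..b, g t * J.indicator f t =
        ∫ t in (1 / 4 : ℝ)..(3 / 4), g t * f t := by
      intro f g
      rw [← red]
      refine intervalIntegral.integral_congr fun t _ => ?_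
      by_cases ht : t ∈ J
      · simp [ht]
      · simp [ht]
    have hDI : IntegrableOn D (Ioo a b) := by
      have := hD a b ha hab.le hb
      rwa [intervalIntegrable_iff_integrableOn_Ioo_of_le hab.le] at this
    have hDb : ∀ {ψ : ℝ → ℂ} {C : ℝ}, StronglyMeasurable ψ → (∀ x, ‖ψ x‖ ≤ C) →
        IntervalIntegrable (fun t => conj (D t) * ψ t) volume a b := by
      intro ψ C hm hC
      rw [intervalIntegrable_iff_integrableOn_Ioo_of_le hab.le]
      exact (integrableOn_conj hDI).mul_bdd (c := C) hm.aestronglyMeasurable (ae_of_all _ hC)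
    have hbb : ∀ {ψ : ℝ → ℂ} {C : ℝ}, StronglyMeasurable ψ → (∀ x, ‖ψ x‖ ≤ C) →
        IntervalIntegrable ψ volume a b := by
      intro ψ C hm hC
      rw [intervalIntegrable_iff_integrableOn_Ioo_of_le hab.le]
      exact Measure.integrableOn_of_bounded (M := C) (measure_Ioo_lt_top.ne)
        hm.aestronglyMeasurable (ae_of_all _ hC)
    have hlin : Continuous fun t : ℝ => ((t - 1 / 2 : ℝ) : ℂ) := by fun_prop
    have hbl : ∀ {ψ : ℝ → ℂ} {C : ℝ}, StronglyMeasurable ψ → (∀ x, ‖ψ x‖ ≤ C) →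
        IntervalIntegrable (fun t => ((t - 1 / 2 : ℝ) : ℂ) * ψ t) volume a b := fun hm hC =>
      (hbb hm hC).continuousOn_mul hlin.continuousOn
    have m1 : StronglyMeasurable η1 := stronglyMeasurable_const.indicator measurableSet_Icc
    have m2 : StronglyMeasurable η2 :=
      ((hlin.stronglyMeasurable).const_mul 96).indicator measurableSet_Icc
    have b1 : ∀ x, ‖η1 x‖ ≤ 2 := fun x => by
      by_cases hx : x ∈ J <;> simp [hη1, hx]
    have b2 : ∀ x, ‖η2 x‖ ≤ 96 := fun x => by
      by_cases hx : x ∈ J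
      · rw [hη2, indicator_of_mem hx, norm_mul, Complex.norm_real, Real.norm_eq_abs]
        have : |x - 1 / 2| ≤ 1 := by rw [abs_le]; constructor <;> linarith [hx.1, hx.2]
        simpa using this
      · simp [hη2, hx]
    have e11 : ∫ t in a..b, η1 t = 1 := by
      rw [red]; simp; norm_num
    have e12 : ∫ t in a..b, ((t - 1 / 2 : ℝ) : ℂ) * η1 t = 0 := by
      rw [redm]
      have : ∀ t : ℝ, ((t - 1 / 2 : ℝ) : ℂ) * 2 = (((t - 1 / 2) * 2 : ℝ) : ℂ) := fun t => by
        push_cast; ring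
      simp only [this]
      rw [intervalIntegral.integral_ofReal, intervalIntegral.integral_mul_const,
        intervalIntegral.integral_sub (by simp) (by simp)]
      norm_num
    have e21 : ∫ t in a..b, η2 t = 0 := by
      rw [red]
      have : ∀ t : ℝ, 96 * ((t - 1 / 2 : ℝ) : ℂ) = ((96 * (t - 1 / 2) : ℝ) : ℂ) := fun t => by
        push_cast; ring
      simp only [this]
      rw [intervalIntegral.integral_ofReal, intervalIntegral.integral_const_mul,
        intervalIntegral.integral_sub (by simp) (by simp)]
      norm_num
    have e22 : ∫ t in a..b, ((t - 1 / 2 : ℝ) : ℂ) * η2 t = 1 := by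
      rw [redm]
      have : ∀ t : ℝ, ((t - 1 / 2 : ℝ) : ℂ) * (96 * ((t - 1 / 2 : ℝ) : ℂ)) =
          ((96 * (t - 1 / 2) ^ 2 : ℝ) : ℂ) := fun t => by
        push_cast; ring
      simp only [this]
      rw [intervalIntegral.integral_ofReal, intervalIntegral.integral_const_mul,
        intervalIntegral.integral_comp_sub_right (fun t => t ^ 2), integral_pow]
      norm_num
    have key : ∀ s : Set ℝ, MeasurableSet s →
        ∫ t in s, conj (D t - (A + B * ((t - 1 / 2 : ℝ) : ℂ))) ∂(volume.restrict (Ioo a b)) = 0 := by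
      intro s hs
      set ψ0 : ℝ → ℂ := (s ∩ Ioo a b).indicator fun _ => 1 with hψ0
      have hsm : MeasurableSet (s ∩ Ioo a b) := hs.inter measurableSet_Ioo
      have m0 : StronglyMeasurable ψ0 := stronglyMeasurable_const.indicator hsm
      have b0 : ∀ x, ‖ψ0 x‖ ≤ 1 := fun x => by
        by_cases hx : x ∈ s ∩ Ioo a b
        · rw [hψ0, indicator_of_mem hx]; simp
        · rw [hψ0, indicator_of_notMem hx]; simp
      set c0 := ∫ t in a..b, ψ0 t with hc0
      set c1 := ∫ t in a..b, ((t - 1 / 2 : ℝ) : ℂ) * ψ0 t with hc1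
      -- Removing both moments from an indicator function makes it admissible. Moving the correction
      -- onto `D` subtracts exactly the affine function, so `D` minus this function has zero
      -- integral over every measurable subset of `(a, b)`.
      have h := H a b ha ha4 hb4 hb (fun t => ψ0 t - c0 * η1 t - c1 * η2 t)
        (1 + ‖c0‖ * 2 + ‖c1‖ * 96) ((m0.sub (m1.const_mul c0)).sub (m2.const_mul c1))
        (fun x => by
          refine (norm_sub_le _ _).trans (add_le_add ((norm_sub_le _ _).trans
            (add_le_add (b0 x) ?_)) ?_)
          · rw [norm_mul]; gcongr; exact b1 x
          · rw [norm_mul]; gcongr; exact b2 x)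
        (fun x hx => by
          have h1 : x ∉ J := fun h => hx (hJs h)
          have h2 : x ∉ s ∩ Ioo a b := fun h => hx h.2
          rw [hψ0, hη1, hη2, indicator_of_notMem h1, indicator_of_notMem h1,
            indicator_of_notMem h2]
          ring)
        (by
          rw [intervalIntegral.integral_sub ((hbb m0 b0).sub ((hbb m1 b1).const_mul c0))
            ((hbb m2 b2).const_mul c1), intervalIntegral.integral_sub (hbb m0 b0)
            ((hbb m1 b1).const_mul c0), intervalIntegral.integral_const_mul,
            intervalIntegral.integral_const_mul, e11, e21, ← hc0]
          ring)
        (by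
          have e : ∀ t : ℝ, ((t - 1 / 2 : ℝ) : ℂ) * (ψ0 t - c0 * η1 t - c1 * η2 t) =
            ((t - 1 / 2 : ℝ) : ℂ) * ψ0 t - c0 * (((t - 1 / 2 : ℝ) : ℂ) * η1 t) -
              c1 * (((t - 1 / 2 : ℝ) : ℂ) * η2 t) := fun t => by ring
          simp only [e]
          rw [intervalIntegral.integral_sub ((hbl m0 b0).sub ((hbl m1 b1).const_mul c0))
            ((hbl m2 b2).const_mul c1), intervalIntegral.integral_sub (hbl m0 b0)
            ((hbl m1 b1).const_mul c0), intervalIntegral.integral_const_mul,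
            intervalIntegral.integral_const_mul, e12, e22, ← hc1]
          ring)
      have e : ∀ t : ℝ, conj (D t) * (ψ0 t - c0 * η1 t - c1 * η2 t) =
          conj (D t) * ψ0 t - c0 * (conj (D t) * η1 t) - c1 * (conj (D t) * η2 t) :=
        fun t => by ring
      simp only [e] at h
      rw [intervalIntegral.integral_sub ((hDb m0 b0).sub ((hDb m1 b1).const_mul c0))
            ((hDb m2 b2).const_mul c1), intervalIntegral.integral_sub (hDb m0 b0)
            ((hDb m1 b1).const_mul c0), intervalIntegral.integral_const_mul,
            intervalIntegral.integral_const_mul, redm, redm] at h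
      have hA' : ∫ t in (1 / 4 : ℝ)..(3 / 4), conj (D t) * 2 = conj A := by
        rw [hA, Complex.conj_conj]
      have hB' : ∫ t in (1 / 4 : ℝ)..(3 / 4), conj (D t) * (96 * ((t - 1 / 2 : ℝ) : ℂ)) =
          conj B := by rw [hB, Complex.conj_conj]
      rw [hA', hB'] at h
      have fin : ∫ t in a..b, conj (D t - (A + B * ((t - 1 / 2 : ℝ) : ℂ))) * ψ0 t = 0 := by
        have e : ∀ t : ℝ, conj (D t - (A + B * ((t - 1 / 2 : ℝ) : ℂ))) * ψ0 t =
            conj (D t) * ψ0 t - conj A * ψ0 t - conj B * (((t - 1 / 2 : ℝ) : ℂ) * ψ0 t) := by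
          intro t
          simp only [map_sub, map_add, map_mul, Complex.conj_ofReal]
          ring
        simp only [e]
        rw [intervalIntegral.integral_sub ((hDb m0 b0).sub ((hbb m0 b0).const_mul _))
            ((hbl m0 b0).const_mul _), intervalIntegral.integral_sub (hDb m0 b0)
            ((hbb m0 b0).const_mul _), intervalIntegral.integral_const_mul,
            intervalIntegral.integral_const_mul, ← hc0, ← hc1]
        linear_combination h
      rw [Measure.restrict_restrict hs, ← fin, intervalIntegral.integral_of_le hab.le,
        integral_Ioc_eq_integral_Ioo]
      have e2 : ∀ t : ℝ, conj (D t - (A + B * ((t - 1 / 2 : ℝ) : ℂ))) * ψ0 t =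
          (s ∩ Ioo a b).indicator (fun t => conj (D t - (A + B * ((t - 1 / 2 : ℝ) : ℂ)))) t := by
        intro t
        by_cases ht : t ∈ s ∩ Ioo a b
        · rw [hψ0, indicator_of_mem ht, indicator_of_mem ht, mul_one]
        · rw [hψ0, indicator_of_notMem ht, indicator_of_notMem ht, mul_zero]
      simp only [e2]
      rw [setIntegral_indicator hsm]
      congr 2
      ext x; simp
    have hint : Integrable (fun t => conj (D t - (A + B * ((t - 1 / 2 : ℝ) : ℂ))))
        (volume.restrict (Ioo a b)) := by
      refine integrableOn_conj (hDI.sub ?_)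
      have hc : Continuous fun t : ℝ => A + B * ((t - 1 / 2 : ℝ) : ℂ) := by fun_prop
      exact (hc.integrableOn_Icc (a := a) (b := b)).mono_set Ioo_subset_Icc_self
    have := hint.ae_eq_zero_of_forall_setIntegral_eq_zero fun s hs _ => key s hs
    rw [Filter.EventuallyEq, ae_restrict_iff' measurableSet_Ioo] at this
    filter_upwards [this] with x hx h
    have h' := hx h
    rw [Pi.zero_apply, map_eq_zero, sub_eq_zero] at h'
    exact h'
  refine ae_Ioo_of_forall_Icc fun a b ha hab hb => ?_
  -- The compact interval is enlarged to an open one that also contains `J`.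
  filter_upwards [main (min (a / 2) (1 / 8)) (max ((b + 1) / 2) (7 / 8))
    (lt_min (by linarith) (by norm_num)) ((min_le_right _ _).trans_lt (by norm_num))
    ((by norm_num : (3 / 4 : ℝ) < 7 / 8).trans_le (le_max_right _ _))
    (max_lt (by linarith) (by norm_num))] with x hx h
  exact hx ⟨(min_le_left _ _).trans_lt (by linarith [h.1]),
    lt_of_lt_of_le (by linarith [h.2]) (le_max_left _ _)⟩

lemma SLRegular.add_affine {g : ℝ → ℂ} (hg : SLRegular g) (A B : ℂ) :
    SLRegular (fun x => g x + (A + B * ((x - 1 / 2 : ℝ) : ℂ))) ∧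
      ∀ x ∈ Ioo (0 : ℝ) 1, deriv (fun x => g x + (A + B * ((x - 1 / 2 : ℝ) : ℂ))) x =
        deriv g x + B := by
  have hl : ∀ x : ℝ, HasDerivAt (fun x : ℝ => A + B * ((x - 1 / 2 : ℝ) : ℂ)) B x := fun x => by
    have := (((hasDerivAt_id x).sub_const (1 / 2)).ofReal_comp.const_mul B).const_add A
    simpa using! this
  have hld : ContDiff ℝ 1 (fun x : ℝ => A + B * ((x - 1 / 2 : ℝ) : ℂ)) :=
    contDiff_const.add (contDiff_const.mul
      (Complex.ofRealCLM.contDiff.comp (contDiff_id.sub contDiff_const)))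
  have hd : ∀ x ∈ Ioo (0 : ℝ) 1, deriv (fun x => g x + (A + B * ((x - 1 / 2 : ℝ) : ℂ))) x =
        deriv g x + B := fun x hx => ((hg.hasDerivAt hx).add (hl x)).deriv
  refine ⟨⟨fun a b h0 hab h1 => (hg.ac a b h0 hab h1).fun_add
    hld.contDiffOn.absolutelyContinuousOnInterval, fun x hx =>
    ((hg.hasDerivAt hx).add (hl x)).differentiableAt.differentiableWithinAt, ?_⟩, hd⟩
  refine ACLoc.congr (g := fun x => deriv g x + B) (fun a b h0 hab h1 => ?_) fun x hx =>
    (hd x hx).symm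
  exact (hg.ac_deriv a b h0 hab h1).fun_add
    (LipschitzWith.const B).lipschitzOnWith.absolutelyContinuousOnInterval

/-- The maximal operator contains the adjoint of its restriction to compactly supported
functions. -/
lemma mem_slGraph_of_forall_inner {d : ℕ} (hd : 5 ≤ d) {v v' : SLSpace}
    (H : ∀ p ∈ slGraph d, inner ℂ v' p.1 = inner ℂ v p.2) : (v, v') ∈ slGraph d := by
  -- `F` is what `v''` has to be for `τ v = v'`. It is only locally integrable, so `v` is recovered
  -- as its double primitive plus an affine function.
  set F : ℝ → ℂ := fun r => -((slWeight r : ℂ) * v' r + (slCoeff d r : ℂ) * v r) with hF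
  have hcI : (1 / 2 : ℝ) ∈ Ioo (0 : ℝ) 1 := ⟨by norm_num, by norm_num⟩
  have hvI : ∀ u : SLSpace, ∀ a b : ℝ, 0 < a → a ≤ b → b < 1 →
      IntervalIntegrable u volume a b := by
    intro u a b ha hab hb
    rw [intervalIntegrable_iff_integrableOn_Ioo_of_le hab]
    exact (integrableOn_of_memLp_slMeasure (Lp.memLp u)).mono_set (Ioo_subset_Ioo ha.le hb.le)
  have hFi : ∀ a b : ℝ, 0 < a → a ≤ b → b < 1 → IntervalIntegrable F volume a b := by
    intro a b ha hab hb
    have hsub : uIcc a b ⊆ Ioo (0 : ℝ) 1 := by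
      rw [uIcc_of_le hab]
      exact fun x hx => ⟨ha.trans_le hx.1, hx.2.trans_lt hb⟩
    exact (((hvI v' a b ha hab hb).continuousOn_mul
      ((Complex.continuous_ofReal.comp_continuousOn continuousOn_slWeight).mono hsub)).add
      ((hvI v a b ha hab hb).continuousOn_mul
      ((Complex.continuous_ofReal.comp_continuousOn (continuousOn_slCoeff d hd)).mono hsub))).neg
  have hreg := slRegular_primitiveTwo hcI hFi
  obtain ⟨A, B, hAB⟩ := ae_eq_affine (D := fun t => v t - primitiveTwo (1 / 2) F t)
    (fun a b ha hab hb => (hvI v a b ha hab hb).sub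
      (intervalIntegrable_of_continuousOn_Ioo hreg.ac.continuousOn ha hab hb))
    (fun a b ha ha4 hb4 hb ψ C hm hC h0 h1 h2 =>
      integral_conj_mul_eq_zero hd H ha (by linarith) (by linarith) hb hm hC h0 h1 h2 hF hFi)
  obtain ⟨hr, hd1⟩ := hreg.add_affine A B
  set g : ℝ → ℂ := fun x => primitiveTwo (1 / 2) F x + (A + B * ((x - 1 / 2 : ℝ) : ℂ)) with hg
  have hvg : ∀ᵐ x, x ∈ Ioo (0 : ℝ) 1 → v x = g x := by
    filter_upwards [hAB] with x hx h
    have := hx h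
    rw [sub_eq_iff_eq_add] at this
    rw [this, hg]; ring
  refine ⟨g, hr, slMeasure_ac.ae_eq ?_, slMeasure_ac.ae_eq ?_⟩
  · rw [Filter.EventuallyEq, ae_restrict_iff' measurableSet_Ioo]
    exact hvg
  · rw [Filter.EventuallyEq, ae_restrict_iff' measurableSet_Ioo]
    filter_upwards [hvg, deriv_deriv_primitiveTwo hcI hFi, hreg.ae_hasDerivAt_deriv]
      with x h1 h2 h3 hx
    have e : deriv (deriv g) x = F x := by
      rw [← h2 hx, ← ((h3 hx).add_const B).deriv]
      apply Filter.EventuallyEq.deriv_eq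
      filter_upwards [isOpen_Ioo.mem_nhds hx] with y hy
      exact hd1 y hy
    have hw : (slWeight x : ℂ) ≠ 0 := by exact_mod_cast (slWeight_pos hx).ne'
    rw [slTau, e, ← h1 hx, hF]
    push_cast
    field_simp
    ring

lemma slOperator_mem_graph (d : ℕ) (u : (slOperator d).domain) :
    ((u : SLSpace), slOperator d u) ∈ slGraph d :=
  (mem_slOperator_graph d _).1 ((slOperator d).mem_graph u)

lemma exists_slOperator_of_mem {d : ℕ} {p : SLSpace × SLSpace} (hp : p ∈ slGraph d) :
    ∃ u : (slOperator d).domain, (u : SLSpace) = p.1 ∧ slOperator d u = p.2 := by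
  rw [← mem_slOperator_graph, LinearPMap.mem_graph_iff] at hp
  exact hp

theorem slOperator_isSelfAdjoint {d : ℕ} (hd : 5 ≤ d) : IsSelfAdjoint (slOperator d) := by
  have hdense : Dense ((slOperator d).domain : Set SLSpace) := by
    rw [Submodule.dense_iff_topologicalClosure_eq_top,
      Submodule.topologicalClosure_eq_top_iff, Submodule.eq_bot_iff]
    intro v hv
    -- A vector `v` orthogonal to the domain satisfies the adjoint relation for the pair `(0, v)`.
    -- That pair then lies in the graph, and `v = 0` because the graph is single valued.
    have hmem : ((0 : SLSpace), v) ∈ slGraph d := mem_slGraph_of_forall_inner hd fun p hp => by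
      obtain ⟨u, hu, -⟩ := exists_slOperator_of_mem hp
      rw [inner_zero_left, ← hu]
      exact (Submodule.mem_orthogonal' _ _).1 hv _ u.2
    exact slGraph_singleValued d _ hmem rfl
  rw [LinearPMap.isSelfAdjoint_def]
  have hle : slOperator d ≤ (slOperator d).adjoint := by
    apply LinearPMap.IsFormalAdjoint.le_adjoint hdense
    intro x y
    exact slGraph_symm hd (slOperator_mem_graph d x) (slOperator_mem_graph d y)
  refine le_antisymm ?_ hle
  apply LinearPMap.le_of_le_graph
  rintro ⟨v, v'⟩ h
  rw [mem_slOperator_graph]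
  refine mem_slGraph_of_forall_inner hd fun p hp => ?_
  obtain ⟨u, hu1, hu2⟩ := exists_slOperator_of_mem hp
  obtain ⟨y, hy1, hy2⟩ := LinearPMap.mem_graph_iff _ |>.1 h
  have := LinearPMap.adjoint_isFormalAdjoint hdense y u
  simp only at hy1 hy2
  rw [← hy1, ← hy2, ← hu1, ← hu2]
  exact this

/-! ### Absence of negative eigenvalues of the Sturm–Liouville operator -/

/-- The logarithmic derivative of the zero energy solution
`r^((d-1)/2) (1-r²)^((7-d)/4) / (d-4+r²)`. -/
def zeroEnergyLogDeriv (d : ℕ) (r : ℝ) : ℝ :=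
  ((d : ℝ) - 1) / 2 / r + ((d : ℝ) - 7) / 2 * r / (1 - r ^ 2) - 2 * r / ((d : ℝ) - 4 + r ^ 2)

/-- The Riccati equation satisfied by the logarithmic derivative of a zero energy solution. -/
lemma hasDerivAt_zeroEnergyLogDeriv {d : ℕ} (hd : 5 ≤ d) {r : ℝ} (hr : r ∈ Ioo (0 : ℝ) 1) :
    HasDerivAt (zeroEnergyLogDeriv d) (-(zeroEnergyLogDeriv d r ^ 2 + slCoeff d r)) r := by
  have hd' : (5 : ℝ) ≤ d := by exact_mod_cast hd
  have h0 := hr.1.ne'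
  have h1 := (one_sub_sq_pos hr).ne'
  have h2 : (d : ℝ) - 4 + r ^ 2 ≠ 0 := by nlinarith [sq_nonneg r]
  have e1 : HasDerivAt (fun r : ℝ => ((d : ℝ) - 1) / 2 / r) (-(((d : ℝ) - 1) / 2 / r ^ 2)) r := by
    convert! (hasDerivAt_id r).fun_inv h0 |>.const_mul (((d : ℝ) - 1) / 2) using 1
    simp only [id]; ring
  have p1 : HasDerivAt (fun r : ℝ => 1 - r ^ 2) (-(2 * r)) r := by
    simpa using (hasDerivAt_pow 2 r).const_sub 1
  have p2 : HasDerivAt (fun r : ℝ => (d : ℝ) - 4 + r ^ 2) (2 * r) r := by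
    simpa using (hasDerivAt_pow 2 r).const_add ((d : ℝ) - 4)
  have e2 := ((hasDerivAt_id r).const_mul (((d : ℝ) - 7) / 2)).div p1 h1
  have e3 := ((hasDerivAt_id r).const_mul (2 : ℝ)).div p2 h2
  convert! (e1.add e2).sub e3 using 1
  simp only [zeroEnergyLogDeriv, slCoeff, potential, id]
  field_simp
  ring

/-- This crude size is all that is needed of the zero energy solution near the endpoints: `a|g|²` is
then of order `|g|²/x` at distance `x`, which is `x` times an integrable function. -/
lemma abs_zeroEnergyLogDeriv_le {d : ℕ} (hd : 5 ≤ d) {r : ℝ} (hr : r ∈ Ioo (0 : ℝ) 1) :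
    |zeroEnergyLogDeriv d r| ≤ ((d : ℝ) + 7) * (1 / r + 1 / (1 - r)) := by
  have hd' : (5 : ℝ) ≤ d := by exact_mod_cast hd
  obtain ⟨h0, h1⟩ := hr
  have h3 : 0 < 1 - r := by linarith
  have b1 : |((d : ℝ) - 1) / 2 / r| ≤ ((d : ℝ) + 7) / 2 * (1 / r) := by
    rw [abs_of_nonneg (div_nonneg (by linarith) h0.le), div_eq_mul_one_div _ r]
    gcongr
    linarith
  have b2 : |((d : ℝ) - 7) / 2 * r / (1 - r ^ 2)| ≤ ((d : ℝ) + 7) / 2 * (1 / (1 - r)) := by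
    have : 0 < 1 - r ^ 2 := one_sub_sq_pos ⟨h0, h1⟩
    rw [abs_div, abs_mul, abs_of_pos this, abs_of_pos h0, mul_div_assoc]
    have k1 : |((d : ℝ) - 7) / 2| ≤ ((d : ℝ) + 7) / 2 := by
      rw [abs_le]; constructor <;> linarith
    have k2 : r / (1 - r ^ 2) ≤ 1 / (1 - r) := by
      rw [div_le_div_iff₀ this h3]; nlinarith
    have k3 : 0 ≤ r / (1 - r ^ 2) := by positivity
    gcongr
  have b3 : |2 * r / ((d : ℝ) - 4 + r ^ 2)| ≤ 2 * (1 / (1 - r)) := by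
    have : 1 ≤ (d : ℝ) - 4 + r ^ 2 := by nlinarith [sq_nonneg r]
    rw [abs_of_nonneg (by positivity), mul_div_assoc]
    gcongr 2 * ?_
    rw [div_le_div_iff₀ (by positivity) h3]; nlinarith
  have t := (abs_sub _ _).trans (add_le_add ((abs_add_le _ _).trans (add_le_add b1 b2)) b3)
  refine t.trans ?_
  have k4 : 0 < 1 / r := by positivity
  have k5 : 0 < 1 / (1 - r) := by positivity
  nlinarith

/-- The energy functional attached to the factorisation of the Sturm–Liouville operator. -/
lemma hasDerivAt_energy {d : ℕ} (hd : 5 ≤ d) {g g1 : ℝ → ℂ} {μ r : ℝ} (hr : r ∈ Ioo (0 : ℝ) 1)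
    (h0 : HasDerivAt g (g1 r) r)
    (h1 : HasDerivAt g1 (-((μ * slWeight r + slCoeff d r : ℝ) : ℂ) * g r) r) :
    HasDerivAt (fun r => (g1 r * conj (g r)).re - zeroEnergyLogDeriv d r * (g r * conj (g r)).re)
      (‖g1 r - zeroEnergyLogDeriv d r * g r‖ ^ 2 - μ * slWeight r * ‖g r‖ ^ 2) r := by
  have c0 : HasDerivAt (fun x => conj (g x)) (conj (g1 r)) r :=
    Complex.conjCLE.toContinuousLinearMap.hasFDerivAt.comp_hasDerivAt r h0
  have e1 : HasDerivAt (fun x => (g1 x * conj (g x)).re) _ r :=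
    Complex.reCLM.hasFDerivAt.comp_hasDerivAt r (h1.mul c0)
  have e2 : HasDerivAt (fun x => (g x * conj (g x)).re) _ r :=
    Complex.reCLM.hasFDerivAt.comp_hasDerivAt r (h0.mul c0)
  convert! e1.sub ((hasDerivAt_zeroEnergyLogDeriv hd hr).mul e2) using 1
  have nsq : ∀ z : ℂ, ‖z‖ ^ 2 = z.re ^ 2 + z.im ^ 2 := fun z => by
    rw [← Complex.normSq_eq_norm_sq, Complex.normSq_apply]; ring
  simp only [nsq, Complex.reCLM_apply, Complex.add_re, Complex.mul_re, Complex.neg_re,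
    Complex.neg_im, Complex.ofReal_re, Complex.ofReal_im, Complex.sub_re, Complex.sub_im,
    Complex.mul_im, Complex.conj_re, Complex.conj_im]
  ring

/-- If an absolutely continuous function has a.e. derivative equal to a continuous function, then
it is differentiable. -/
lemma ACLoc.hasDerivAt_of_ae {f f' : ℝ → ℂ} (hf : ACLoc f) (hf' : ContinuousOn f' (Ioo 0 1))
    (h : ∀ᵐ x, x ∈ Ioo (0 : ℝ) 1 → HasDerivAt f (f' x) x) {x : ℝ} (hx : x ∈ Ioo (0 : ℝ) 1) :
    HasDerivAt f (f' x) x := by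
  have hc : x / 2 ∈ Ioo (0 : ℝ) 1 := ⟨by linarith [hx.1], by linarith [hx.2, hx.1]⟩
  have h1 := (hasDerivAt_integral_Ioo hc hf' hx).const_add (f (x / 2))
  refine h1.congr_of_eventuallyEq ?_
  filter_upwards [Ioo_mem_nhds (by linarith [hx.1] : x / 2 < x) hx.2] with y hy
  have := (ac_integral_eq_sub (hf (x / 2) y hc.1 hy.1.le hy.2) (f' := f') (by
    filter_upwards [h] with t ht h'
    rw [uIcc_of_le hy.1.le] at h'
    exact ht ⟨hc.1.trans_le h'.1, h'.2.trans_lt hy.2⟩)).2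
  rw [this]
  ring

/-- Factorisation through the zero energy solution, in differential form: the energy `E` has a
derivative that is a sum of nonnegative terms for `μ < 0`, and it has no room to increase between
the endpoints. -/
lemma eigenfunction_eq_zero {d : ℕ} (hd : 5 ≤ d) {g : ℝ → ℂ} {μ : ℝ} (hμ : μ < 0)
    (hg : SLRegular g) (g2 : MemLp g 2 slMeasure)
    (hτ : slTau d g =ᵐ[slMeasure] fun r => (μ : ℂ) * g r) :
    ∀ r ∈ Ioo (0 : ℝ) 1, g r = 0 := by
  have gτ : MemLp (slTau d g) 2 slMeasure := (g2.const_mul (μ : ℂ)).ae_eq hτ.symm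
  have hτ' : ∀ᵐ x, x ∈ Ioo (0 : ℝ) 1 → slTau d g x = μ * g x := by
    have := ac_slMeasure.ae_eq hτ
    rwa [Filter.EventuallyEq, ae_restrict_iff' measurableSet_Ioo] at this
  have hc : ContinuousOn (fun r => -((μ * slWeight r + slCoeff d r : ℝ) : ℂ) * g r) (Ioo 0 1) :=
    (Complex.continuous_ofReal.comp_continuousOn ((continuousOn_slWeight.const_mul μ).add
      (continuousOn_slCoeff d hd))).neg.mul hg.ac.continuousOn
  -- The equation gives a continuous formula for `g''`, so `g'` is differentiable at every point and
  -- `E` can be differentiated classically.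
  have hd1 : ∀ r ∈ Ioo (0 : ℝ) 1,
      HasDerivAt (deriv g) (-((μ * slWeight r + slCoeff d r : ℝ) : ℂ) * g r) r := by
    refine fun r hr => hg.ac_deriv.hasDerivAt_of_ae hc ?_ hr
    filter_upwards [hg.ae_hasDerivAt_deriv, hτ'] with x h1 h2 hx
    have := h1 hx
    rw [deriv_deriv_eq d g hx, h2 hx] at this
    convert this using 1
    push_cast
    ring
  set E : ℝ → ℝ := fun r => (deriv g r * conj (g r)).re -
    zeroEnergyLogDeriv d r * (g r * conj (g r)).re with hE
  have hED : ∀ r ∈ Ioo (0 : ℝ) 1, HasDerivAt E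
      (‖deriv g r - zeroEnergyLogDeriv d r * g r‖ ^ 2 - μ * slWeight r * ‖g r‖ ^ 2) r :=
    fun r hr => hasDerivAt_energy hd hr (hg.hasDerivAt hr) (hd1 r hr)
  have hmono : MonotoneOn E (Ioo 0 1) := by
    refine monotoneOn_of_deriv_nonneg (convex_Ioo 0 1)
      (fun x hx => (hED x hx).continuousAt.continuousWithinAt) ?_ ?_
    · rw [interior_Ioo]
      exact fun x hx => (hED x hx).differentiableAt.differentiableWithinAt
    · rw [interior_Ioo]
      intro x hx
      rw [(hED x hx).deriv]
      have := mul_nonneg (mul_nonneg (neg_nonneg.2 hμ.le) (slWeight_nonneg x)) (sq_nonneg ‖g x‖)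
      nlinarith [sq_nonneg ‖deriv g x - zeroEnergyLogDeriv d x * g x‖]
  -- The `1` pays for `|g'||g|`, and `2(d+7)` pays for `a|g|²`, since `|a| ≤ 2(d+7)/x` when both
  -- endpoints are at distance at least `x`.
  set K : ℝ := 2 * ((d : ℝ) + 7) + 1 with hK
  have bound : ∀ r ∈ Ioo (0 : ℝ) 1, ∀ x, 0 < x → x ≤ r → x ≤ 1 - r →
      |E r| ≤ x * (K * (‖deriv g r‖ ^ 2 / 2 + ‖g r‖ ^ 2 / x ^ 2)) := by
    intro r hr x hx h1 h2
    have k1 : |(deriv g r * conj (g r)).re| ≤ ‖deriv g r‖ * ‖g r‖ := by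
      have := Complex.abs_re_le_norm (deriv g r * conj (g r))
      rwa [norm_mul, Complex.norm_conj] at this
    have k2 : (g r * conj (g r)).re = ‖g r‖ ^ 2 := by
      rw [Complex.mul_conj, Complex.ofReal_re, Complex.normSq_eq_norm_sq]
    have k3 : |zeroEnergyLogDeriv d r| ≤ ((d : ℝ) + 7) * (2 * (1 / x)) := by
      refine (abs_zeroEnergyLogDeriv_le hd hr).trans ?_
      have := one_div_le_one_div_of_le hx h1
      have := one_div_le_one_div_of_le hx h2
      gcongr
      linarith
    have k4 : |E r| ≤ ‖deriv g r‖ * ‖g r‖ + ((d : ℝ) + 7) * (2 * (1 / x)) * ‖g r‖ ^ 2 := by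
      refine (abs_sub _ _).trans (add_le_add k1 ?_)
      rw [k2, abs_mul, abs_of_nonneg (sq_nonneg ‖g r‖)]
      gcongr
    refine k4.trans ?_
    have k5 : 0 ≤ (‖deriv g r‖ - ‖g r‖ / x) ^ 2 := sq_nonneg _
    have k6 : x * (K * (‖deriv g r‖ ^ 2 / 2 + ‖g r‖ ^ 2 / x ^ 2)) - (‖deriv g r‖ * ‖g r‖ +
        ((d : ℝ) + 7) * (2 * (1 / x)) * ‖g r‖ ^ 2) = x * ((‖deriv g r‖ - ‖g r‖ / x) ^ 2 / 2 +
        ((d : ℝ) + 7) * ‖deriv g r‖ ^ 2 + (‖g r‖ / x) ^ 2 / 2) := by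
      rw [hK]; field_simp; ring
    have k7 : 0 ≤ x * ((‖deriv g r‖ - ‖g r‖ / x) ^ 2 / 2 +
        ((d : ℝ) + 7) * ‖deriv g r‖ ^ 2 + (‖g r‖ / x) ^ 2 / 2) := by positivity
    linarith
  -- By monotonicity `E r` is at most a value of `E` close to `1` and at least a value close to `0`.
  -- Both can be chosen arbitrarily small.
  have E0 : ∀ r ∈ Ioo (0 : ℝ) 1, E r = 0 := by
    intro r hr
    refine le_antisymm ?_ ?_
    · refine le_of_forall_pos_le_add fun ε hε => ?_
      have hI := (integrable_endpoint_one hd hg g2 gτ).const_mul K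
      obtain ⟨x, h1, h2⟩ := ((frequently_mul_lt_of_integrableOn (by norm_num) hI hε).and_eventually
        (Ioo_mem_nhdsGT (lt_min (sub_pos.2 hr.2) (by norm_num : (0 : ℝ) < 1 / 2)))).exists
      have h3 := lt_min_iff.1 h2.2
      have hx : 1 - x ∈ Ioo (0 : ℝ) 1 := ⟨by linarith, by linarith [h2.1]⟩
      have h4 := bound (1 - x) hx x h2.1 (by linarith) (by linarith)
      rw [norm_neg] at h1
      have h5 := hmono hr hx (by linarith)
      have := le_abs_self (E (1 - x))
      linarith
    · have key : -E r ≤ 0 := by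
        refine le_of_forall_pos_le_add fun ε hε => ?_
        have hI := (integrable_endpoint_zero hd hg g2 gτ).const_mul K
        obtain ⟨x, h1, h2⟩ := ((frequently_mul_lt_of_integrableOn (by norm_num) hI
          hε).and_eventually
          (Ioo_mem_nhdsGT (lt_min hr.1 (by norm_num : (0 : ℝ) < 1 / 2)))).exists
        have h3 := lt_min_iff.1 h2.2
        have hx : x ∈ Ioo (0 : ℝ) 1 := ⟨h2.1, by linarith⟩
        have h4 := bound x hx x h2.1 le_rfl (by linarith)
        have h5 := hmono hx hr (by linarith)
        have := neg_abs_le (E x)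
        linarith
      linarith
  intro r hr
  have hz : HasDerivAt E 0 r := (hasDerivAt_const r (0 : ℝ)).congr_of_eventuallyEq <| by
    filter_upwards [isOpen_Ioo.mem_nhds hr] with x hx using E0 x hx
  have := (hED r hr).unique hz
  have hw := slWeight_pos hr
  have h1 : -μ * slWeight r * ‖g r‖ ^ 2 ≤ 0 := by
    nlinarith [sq_nonneg ‖deriv g r - zeroEnergyLogDeriv d r * g r‖]
  have h2 : 0 < -μ * slWeight r := mul_pos (neg_pos.2 hμ) hw
  have h3 : ‖g r‖ ^ 2 ≤ 0 := by
    by_contra hcon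
    exact absurd h1 (not_le.2 (mul_pos h2 (not_le.1 hcon)))
  simpa using le_antisymm h3 (sq_nonneg _)

theorem slOperator_not_hasEigenvalue_of_neg {d : ℕ} (hd : 5 ≤ d) {μ : ℝ} (hμ : μ < 0) :
    ¬ HasEigenvalue (slOperator d) (μ : ℂ) := by
  rintro ⟨u, hu, he⟩
  obtain ⟨g, hg, h1, h2⟩ := slOperator_mem_graph d u
  rw [he] at h2
  have h1' : (u : SLSpace) =ᵐ[slMeasure] g := h1
  have hτ : slTau d g =ᵐ[slMeasure] fun r => (μ : ℂ) * g r := by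
    filter_upwards [h1', h2, Lp.coeFn_smul (μ : ℂ) (u : SLSpace)] with r e1 e2 e3
    rw [← e2, e3, Pi.smul_apply, e1, smul_eq_mul]
  have hz := eigenfunction_eq_zero hd hμ hg ((Lp.memLp (u : SLSpace)).ae_eq h1') hτ
  apply hu
  refine Lp.ext (h1'.trans (?_ : g =ᵐ[slMeasure] _))
  refine EventuallyEq.trans (slMeasure_ac.ae_eq ?_) (Lp.coeFn_zero ℂ 2 slMeasure).symm
  rw [Filter.EventuallyEq, ae_restrict_iff' measurableSet_Ioo]
  exact ae_of_all _ hz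

/-! ### Reduction of the spectral equation to the Sturm–Liouville problem -/

lemma acLoc_of_hasDerivAt {g g1 : ℝ → ℂ} (h : ∀ r ∈ Ioo (0 : ℝ) 1, HasDerivAt g (g1 r) r)
    (hc : ContinuousOn g1 (Ioo 0 1)) : ACLoc g := by
  have hcI : (1 / 2 : ℝ) ∈ Ioo (0 : ℝ) 1 := ⟨by norm_num, by norm_num⟩
  refine ACLoc.congr (g := fun x => g (1 / 2) + ∫ t in (1 / 2 : ℝ)..x, g1 t) ?_ fun x hx => ?_
  · intro a b ha hab hb
    exact (LipschitzWith.const (g (1 / 2))).lipschitzOnWith.absolutelyContinuousOnInterval.fun_add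
      (acLoc_integral hcI (fun a b ha hab hb =>
        intervalIntegrable_of_continuousOn_Ioo hc ha hab hb) a b ha hab hb)
  · have hs : uIcc (1 / 2) x ⊆ Ioo (0 : ℝ) 1 := ordConnected_Ioo.uIcc_subset hcI hx
    simp only
    rw [intervalIntegral.integral_eq_sub_of_hasDerivAt (fun t ht => h t (hs ht))
      (hc.mono hs).intervalIntegrable]
    ring

/-- The derivative of the exponent of the transformation to Sturm–Liouville form. -/
def liouvilleLogDeriv (d : ℕ) (z : ℂ) (r : ℝ) : ℂ :=
  ((d : ℂ) - 1) / 2 / r - (z + ((d : ℂ) - 1) / 2) * r / (1 - r ^ 2)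

/-- The exponent of the transformation to Sturm–Liouville form. -/
def liouvilleExponent (d : ℕ) (z : ℂ) (r : ℝ) : ℂ :=
  ((d : ℂ) - 1) / 2 * (Real.log r : ℂ) +
    (z / 2 + ((d : ℂ) - 1) / 4) * (Real.log (1 - r ^ 2) : ℂ)

lemma hasDerivAt_liouvilleExponent (d : ℕ) (z : ℂ) {r : ℝ} (hr : r ∈ Ioo (0 : ℝ) 1) :
    HasDerivAt (liouvilleExponent d z) (liouvilleLogDeriv d z r) r := by
  have h1 := (one_sub_sq_pos hr).ne'
  have p1 : HasDerivAt (fun r : ℝ => 1 - r ^ 2) (-(2 * r)) r := by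
    simpa using (hasDerivAt_pow 2 r).const_sub 1
  have e1 := (Real.hasDerivAt_log hr.1.ne').ofReal_comp.const_mul (((d : ℂ) - 1) / 2)
  have e2 := (p1.log h1).ofReal_comp.const_mul (z / 2 + ((d : ℂ) - 1) / 4)
  convert! e1.add e2 using 1
  have h0 : (r : ℂ) ≠ 0 := by exact_mod_cast hr.1.ne'
  have h1' : (1 - (r : ℂ) ^ 2) ≠ 0 := by exact_mod_cast h1
  rw [liouvilleLogDeriv]
  push_cast
  field_simp
  ring

lemma hasDerivAt_liouvilleLogDeriv (d : ℕ) (z : ℂ) {r : ℝ} (hr : r ∈ Ioo (0 : ℝ) 1) :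
    HasDerivAt (liouvilleLogDeriv d z) (-(((d : ℂ) - 1) / 2 / r ^ 2) -
      (z + ((d : ℂ) - 1) / 2) * (1 + r ^ 2) / (1 - r ^ 2) ^ 2) r := by
  have h0 : (r : ℂ) ≠ 0 := by exact_mod_cast hr.1.ne'
  have h1 : (1 - (r : ℂ) ^ 2) ≠ 0 := by exact_mod_cast (one_sub_sq_pos hr).ne'
  have hid : HasDerivAt (fun r : ℝ => (r : ℂ)) 1 r := by
    simpa using! (hasDerivAt_id r).ofReal_comp
  have p1 : HasDerivAt (fun r : ℝ => (1 - (r : ℂ) ^ 2 : ℂ)) (-(2 * r) : ℂ) r := by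
    simpa using! (hid.pow 2).const_sub 1
  have e1 := (hid.fun_inv h0).const_mul (((d : ℂ) - 1) / 2)
  have e2 := (hid.const_mul (z + ((d : ℂ) - 1) / 2)).div p1 h1
  convert! e1.sub e2 using 1
  field_simp
  ring

/-- The spectral parameter of the Sturm–Liouville problem. -/
def slParameter (d : ℕ) (z : ℂ) : ℂ := ((d : ℂ) - 5) ^ 2 / 4 - (z + ((d : ℂ) - 3) / 2) ^ 2

lemma norm_exp_liouvilleExponent_sq (d : ℕ) (z : ℂ) {r : ℝ} (hr : r ∈ Ioo (0 : ℝ) 1) :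
    ‖Complex.exp (liouvilleExponent d z r)‖ ^ 2 =
      r ^ ((d : ℝ) - 1) * (1 - r ^ 2) ^ (z.re + ((d : ℝ) - 1) / 2) := by
  have e : (liouvilleExponent d z r).re = ((d : ℝ) - 1) / 2 * Real.log r +
      (z.re / 2 + ((d : ℝ) - 1) / 4) * Real.log (1 - r ^ 2) := by
    have h1 : ((d : ℂ) - 1) / 2 = ((((d : ℝ) - 1) / 2 : ℝ) : ℂ) := by push_cast; ring
    have h2 : z / 2 + ((d : ℂ) - 1) / 4 = ((1 / 2 : ℝ) : ℂ) * z + ((((d : ℝ) - 1) / 4 : ℝ) : ℂ) := by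
      push_cast; ring
    rw [liouvilleExponent, h1, h2, Complex.add_re, ← Complex.ofReal_mul, Complex.ofReal_re,
      Complex.re_mul_ofReal, Complex.add_re, Complex.re_ofReal_mul, Complex.ofReal_re]
    ring
  rw [Complex.norm_exp, ← Real.exp_nat_mul, e, Real.rpow_def_of_pos hr.1,
    Real.rpow_def_of_pos (one_sub_sq_pos hr), ← Real.exp_add]
  congr 1
  push_cast
  ring

/-- Near `0` the transformed function is square integrable because `r^(d-1)|u|²` is integrable. Near
`1` the function `u` is bounded, and the weight leaves a power of `1-r²` with exponent `Re z +
(d-5)/2`. For `d ≥ 5` and `Re z > -1` it exceeds `-1`. -/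
lemma memLp_liouville {d : ℕ} (hd : 5 ≤ d) {z : ℂ} (hz : -1 < z.re) {u u1 : ℝ → ℂ}
    (h0 : ∀ r ∈ Ioo (0 : ℝ) 1, HasDerivAt u (u1 r) r) (h1c : ContinuousOn u1 (Ioo 0 1))
    (i0 : IntegrableOn (fun r => r ^ ((d : ℝ) - 1) * ‖u r‖ ^ 2) (Ioo 0 1))
    (i1 : IntegrableOn (fun r => ‖u1 r‖ ^ 2) (Ioo (1 / 2) 1))
    (hm : ContinuousOn (fun r => Complex.exp (liouvilleExponent d z r) * u r) (Ioo 0 1)) :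
    MemLp (fun r => Complex.exp (liouvilleExponent d z r) * u r) 2 slMeasure := by
  have hd' : (5 : ℝ) ≤ d := by exact_mod_cast hd
  -- Square integrability of `u1` makes it integrable, through `|u1| ≤ 1 + |u1|²`.
  obtain ⟨M, hM⟩ : ∃ M : ℝ, ∀ r ∈ Ioo (1 / 2 : ℝ) 1, ‖u r‖ ≤ M := by
    refine ⟨‖u (1 / 2)‖ + ∫ t in Ioo (1 / 2 : ℝ) 1, (1 + ‖u1 t‖ ^ 2), fun r hr => ?_⟩
    have hs : uIcc (1 / 2) r ⊆ Ioo (0 : ℝ) 1 := by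
      rw [uIcc_of_le hr.1.le]
      exact fun x hx => ⟨by linarith [hx.1], hx.2.trans_lt hr.2⟩
    have h1 := intervalIntegral.integral_eq_sub_of_hasDerivAt (fun t ht => h0 t (hs ht))
      (h1c.mono hs).intervalIntegrable
    have h2 : u r = u (1 / 2) + ∫ t in (1 / 2 : ℝ)..r, u1 t := by rw [h1]; ring
    rw [h2]
    refine (norm_add_le _ _).trans (add_le_add le_rfl ?_)
    refine (intervalIntegral.norm_integral_le_integral_norm hr.1.le).trans ?_
    rw [intervalIntegral.integral_of_le hr.1.le, integral_Ioc_eq_integral_Ioo]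
    have iI : IntegrableOn (fun t => 1 + ‖u1 t‖ ^ 2) (Ioo (1 / 2 : ℝ) 1) :=
      Integrable.add (integrableOn_const (by simp)) i1
    have hsub : Ioo (1 / 2 : ℝ) r ⊆ Ioo (1 / 2) 1 := Ioo_subset_Ioo_right hr.2.le
    calc ∫ t in Ioo (1 / 2 : ℝ) r, ‖u1 t‖ ≤ ∫ t in Ioo (1 / 2 : ℝ) r, (1 + ‖u1 t‖ ^ 2) := by
          refine integral_mono_of_nonneg (ae_of_all _ fun _ => norm_nonneg _)
            (iI.mono_set hsub) (ae_of_all _ fun t => ?_)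
          simp only
          nlinarith [sq_nonneg (‖u1 t‖ - 1)]
      _ ≤ _ := setIntegral_mono_set iI (ae_of_all _ fun t => by positivity) hsub.eventuallyLE
  rw [memLp_two_iff_integrable_sq_norm
    ((hm.aestronglyMeasurable measurableSet_Ioo).mono_ac slMeasure_ac), integrable_slMeasure_iff]
  set s : ℝ := z.re + ((d : ℝ) - 1) / 2 - 2 with hs
  have hs1 : -1 < s := by rw [hs]; linarith
  have iS : IntegrableOn (fun r : ℝ => (1 - r) ^ s) (Ioo 0 1) := by
    have : IntegrableOn (fun r : ℝ => r ^ s) (Ioo 0 1) := by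
      rw [← intervalIntegrable_iff_integrableOn_Ioo_of_le zero_le_one]
      exact intervalIntegral.intervalIntegrable_rpow' hs1
    exact integrableOn_comp_one_sub this
  -- The first summand dominates on `(0, 1/2)`, where `w ≤ 2`, and the second on `(1/2, 1)`. The `+
  -- 1` covers the case `s ≥ 0`.
  refine Integrable.mono' (g := fun r => 2 * (r ^ ((d : ℝ) - 1) * ‖u r‖ ^ 2) +
    M ^ 2 * ((1 - r) ^ s + 1)) ((i0.const_mul 2).add
    ((Integrable.add iS (integrableOn_const (by simp))).const_mul (M ^ 2)))
    (measurable_slWeight.aestronglyMeasurable.smul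
      ((hm.aestronglyMeasurable measurableSet_Ioo).norm.pow 2)) ?_
  rw [ae_restrict_iff' measurableSet_Ioo]
  have hne : ∀ᵐ x : ℝ, x ≠ 1 / 2 := by simp [ae_iff, measure_singleton]
  filter_upwards [hne] with r hr2 hr
  have hp := one_sub_sq_pos hr
  have hp1 : 0 < 1 - r := by linarith [hr.2]
  rw [Real.norm_of_nonneg (smul_nonneg (slWeight_nonneg r) (by positivity)), smul_eq_mul,
    norm_mul, mul_pow, norm_exp_liouvilleExponent_sq d z hr]
  have hrp : 0 ≤ r ^ ((d : ℝ) - 1) := Real.rpow_nonneg hr.1.le _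
  rcases lt_or_gt_of_ne hr2 with h | h
  · have a1 : (1 - r ^ 2) ^ (z.re + ((d : ℝ) - 1) / 2) ≤ 1 :=
      Real.rpow_le_one hp.le (by nlinarith [hr.1]) (by linarith)
    have a2 : slWeight r ≤ 2 := by
      have : 3 / 4 ≤ 1 - r ^ 2 := by nlinarith [hr.1]
      rw [slWeight, div_le_iff₀ (by positivity)]
      nlinarith
    have a3 : 0 ≤ M ^ 2 * ((1 - r) ^ s + 1) := by
      have := Real.rpow_nonneg hp1.le s; positivity
    have a4 : slWeight r * (r ^ ((d : ℝ) - 1) * (1 - r ^ 2) ^ (z.re + ((d : ℝ) - 1) / 2) *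
        ‖u r‖ ^ 2) ≤ 2 * (r ^ ((d : ℝ) - 1) * 1 * ‖u r‖ ^ 2) := by
      have := slWeight_nonneg r
      gcongr
    linarith
  · have a1 : r ^ ((d : ℝ) - 1) ≤ 1 := Real.rpow_le_one hr.1.le hr.2.le (by linarith)
    have a2 : slWeight r * (1 - r ^ 2) ^ (z.re + ((d : ℝ) - 1) / 2) = (1 - r ^ 2) ^ s := by
      rw [slWeight, hs, Real.rpow_sub hp, Real.rpow_two]
      ring
    have a3 : (1 - r ^ 2) ^ s ≤ (1 - r) ^ s + 1 := by
      rcases le_or_gt 0 s with h0 | h0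
      · have := Real.rpow_le_one hp.le (by nlinarith [hr.1]) h0
        have := Real.rpow_nonneg hp1.le s
        linarith
      · have : (1 - r ^ 2) ^ s ≤ (1 - r) ^ s :=
          Real.rpow_le_rpow_of_nonpos hp1 (by nlinarith [hr.1, hr.2]) h0.le
        linarith
    have a4 : ‖u r‖ ^ 2 ≤ M ^ 2 := by
      have := hM r ⟨h, hr.2⟩
      gcongr
    have a5 : 0 ≤ (1 - r ^ 2) ^ s := Real.rpow_nonneg hp.le s
    calc _ = r ^ ((d : ℝ) - 1) * (slWeight r * (1 - r ^ 2) ^ (z.re + ((d : ℝ) - 1) / 2)) *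
          ‖u r‖ ^ 2 := by ring
      _ ≤ 1 * ((1 - r) ^ s + 1) * M ^ 2 := by rw [a2]; gcongr
      _ ≤ _ := by
          have : 0 ≤ 2 * (r ^ ((d : ℝ) - 1) * ‖u r‖ ^ 2) := by positivity
          linarith

/-- The imaginary part of the parameter is `-2 (Re z + (d-3)/2) Im z`, with a positive bracket, so
reality forces `Im z = 0`. Then `z + (d-3)/2 > (d-5)/2 ≥ 0` makes the difference of squares
negative. -/
lemma slParameter_neg_of_real {d : ℕ} (hd : 5 ≤ d) {z : ℂ} (hz : -1 < z.re)
    (hre : conj (slParameter d z) = slParameter d z) :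
    ∃ μ : ℝ, μ < 0 ∧ slParameter d z = μ := by
  have hd' : (5 : ℝ) ≤ d := by exact_mod_cast hd
  obtain ⟨μ, hμ⟩ := Complex.conj_eq_iff_real.1 hre
  refine ⟨μ, ?_, hμ⟩
  have e1 : slParameter d z = ((((d : ℝ) - 5) ^ 2 / 4 - ((z.re + ((d : ℝ) - 3) / 2) ^ 2 - z.im ^ 2) :
      ℝ) : ℂ) - ((2 * (z.re + ((d : ℝ) - 3) / 2) * z.im : ℝ) : ℂ) * Complex.I := by
    rw [slParameter]
    nth_rewrite 1 [← Complex.re_add_im z]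
    push_cast
    ring_nf
    rw [Complex.I_sq]
    ring
  rw [e1] at hμ
  have him := congrArg Complex.im hμ
  have hr := congrArg Complex.re hμ
  simp only [Complex.sub_im, Complex.sub_re, Complex.ofReal_im, Complex.ofReal_re, Complex.mul_im,
    Complex.mul_re, Complex.I_im, Complex.I_re] at him hr
  have hpos : 0 < z.re + ((d : ℝ) - 3) / 2 := by linarith
  have hz0 : z.im = 0 := by
    have : 2 * (z.re + ((d : ℝ) - 3) / 2) * z.im = 0 := by linarith
    rcases mul_eq_zero.1 this with h | h
    · linarith
    · exact h
  rw [hz0] at hr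
  nlinarith

/-- A classical solution of the spectral equation with finite energy vanishes. -/
theorem spectral_solution_eq_zero {d : ℕ} (hd : 5 ≤ d) {z : ℂ} (hz : -1 < z.re)
    {u u1 u2 : ℝ → ℂ} (h0 : ∀ r ∈ Ioo (0 : ℝ) 1, HasDerivAt u (u1 r) r)
    (h1 : ∀ r ∈ Ioo (0 : ℝ) 1, HasDerivAt u1 (u2 r) r)
    (ode : ∀ r ∈ Ioo (0 : ℝ) 1, (1 - (r : ℂ) ^ 2) * u2 r +
      (((d : ℂ) - 1) / r - 2 * (z + d - 1) * r) * u1 r -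
      ((z + d - 1) * (z + d - 2) + (potential d r : ℂ)) * u r = 0)
    (i0 : IntegrableOn (fun r => r ^ ((d : ℝ) - 1) * ‖u r‖ ^ 2) (Ioo 0 1))
    (i1 : IntegrableOn (fun r => ‖u1 r‖ ^ 2) (Ioo (1 / 2) 1)) :
    ∀ r ∈ Ioo (0 : ℝ) 1, u r = 0 := by
  set T := liouvilleLogDeriv d z with hT
  set ex : ℝ → ℂ := fun r => Complex.exp (liouvilleExponent d z r) with hex
  set g : ℝ → ℂ := fun r => ex r * u r with hg
  set g1 : ℝ → ℂ := fun r => ex r * (u1 r + T r * u r) with hg1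
  set μ := slParameter d z with hμ
  have hexd : ∀ r ∈ Ioo (0 : ℝ) 1, HasDerivAt ex (ex r * T r) r := fun r hr =>
    (hasDerivAt_liouvilleExponent d z hr).cexp
  have hgd : ∀ r ∈ Ioo (0 : ℝ) 1, HasDerivAt g (g1 r) r := fun r hr => by
    convert! (hexd r hr).mul (h0 r hr) using 1
    rw [hg1]; ring
  -- After division by `1-r²` the coefficient of `u1` in the equation is `2T`, so the first-order
  -- terms cancel in `g''`. What remains is `-(μ w + q) g`.
  have hg1d : ∀ r ∈ Ioo (0 : ℝ) 1,
      HasDerivAt g1 (-(μ * (slWeight r : ℂ) + (slCoeff d r : ℂ)) * g r) r := fun r hr => by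
    convert! (hexd r hr).mul ((h1 r hr).add ((hasDerivAt_liouvilleLogDeriv d z hr).mul (h0 r hr)))
      using 1
    have r0 : (r : ℂ) ≠ 0 := by exact_mod_cast hr.1.ne'
    have r1 : (1 - (r : ℂ) ^ 2) ≠ 0 := by exact_mod_cast (one_sub_sq_pos hr).ne'
    have hu2 : u2 r = (-((((d : ℂ) - 1) / r - 2 * (z + d - 1) * r) * u1 r) +
        ((z + d - 1) * (z + d - 2) + (potential d r : ℂ)) * u r) / (1 - (r : ℂ) ^ 2) := by
      rw [eq_div_iff r1]
      linear_combination ode r hr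
    have hTr : T r = ((d : ℂ) - 1) / 2 / r - (z + ((d : ℂ) - 1) / 2) * r / (1 - r ^ 2) := rfl
    rw [Pi.add_apply, Pi.mul_apply, ← hT, hu2, hg, hTr, hμ, slParameter, slWeight, slCoeff]
    push_cast
    field_simp
    ring
  have hgc : ContinuousOn g (Ioo 0 1) := fun r hr => (hgd r hr).continuousAt.continuousWithinAt
  have hg1c : ContinuousOn g1 (Ioo 0 1) := fun r hr => (hg1d r hr).continuousAt.continuousWithinAt
  have h1c : ContinuousOn u1 (Ioo 0 1) := fun r hr => (h1 r hr).continuousAt.continuousWithinAt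
  have hg2 : MemLp g 2 slMeasure := memLp_liouville hd hz h0 h1c i0 i1 hgc
  have hdg : EqOn g1 (deriv g) (Ioo 0 1) := fun r hr => (hgd r hr).deriv.symm
  have hreg : SLRegular g :=
    { ac := acLoc_of_hasDerivAt hgd hg1c
      diff := fun r hr => (hgd r hr).differentiableAt.differentiableWithinAt
      ac_deriv := by
        refine ACLoc.congr (acLoc_of_hasDerivAt hg1d ?_) hdg
        exact ((continuousOn_const.mul (Complex.continuous_ofReal.comp_continuousOn
          continuousOn_slWeight)).add (Complex.continuous_ofReal.comp_continuousOn
          (continuousOn_slCoeff d hd))).neg.mul hgc }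
  have hτ : ∀ r ∈ Ioo (0 : ℝ) 1, slTau d g r = μ * g r := fun r hr => by
    have e : deriv (deriv g) r = -(μ * (slWeight r : ℂ) + (slCoeff d r : ℂ)) * g r := by
      rw [← (hg1d r hr).deriv]
      exact (hdg.symm.eventuallyEq_of_mem (isOpen_Ioo.mem_nhds hr)).deriv_eq
    have hw : (slWeight r : ℂ) ≠ 0 := by exact_mod_cast (slWeight_pos hr).ne'
    rw [slTau, e]
    push_cast
    field_simp
    ring
  have hτae : slTau d g =ᵐ[slMeasure] fun r => μ * g r := by
    apply slMeasure_ac.ae_eq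
    rw [Filter.EventuallyEq, ae_restrict_iff' measurableSet_Ioo]
    exact ae_of_all _ hτ
  have hgz : ∀ r ∈ Ioo (0 : ℝ) 1, g r = 0 := by
    set U : SLSpace := hg2.toLp g with hU
    have hUg : U =ᵐ[slMeasure] g := hg2.coeFn_toLp
    by_cases hU0 : U = 0
    · rw [hU0] at hUg
      have e := ac_slMeasure.ae_eq (hUg.symm.trans (Lp.coeFn_zero ℂ 2 slMeasure))
      exact Measure.eqOn_open_of_ae_eq e isOpen_Ioo hgc continuousOn_const
    · have hmem : (U, μ • U) ∈ slGraph d := by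
        refine ⟨g, hreg, hUg, ?_⟩
        filter_upwards [Lp.coeFn_smul μ U, hUg, hτae] with r e1 e2 e3
        rw [e1, e3, Pi.smul_apply, e2, smul_eq_mul]
      have hs := slGraph_symm hd hmem hmem
      -- Symmetry of `T` on a nonzero eigenvector makes `μ` real.
      simp only [inner_smul_left, inner_smul_right] at hs
      have hre : conj μ = μ := mul_right_cancel₀ (inner_self_ne_zero.2 hU0) hs
      obtain ⟨m, hm, hme⟩ := slParameter_neg_of_real hd hz hre
      refine eigenfunction_eq_zero hd hm hreg hg2 ?_
      rw [← hme]
      exact hτae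
  intro r hr
  exact (mul_eq_zero.1 (hgz r hr)).resolve_left (Complex.exp_ne_zero _)

/-! ### Radial profiles -/

section radial

variable {d : ℕ}

lemma radLambda_apply (f : CInftyRad d) {x : Euc d} (hx : x ∈ unitBall d) :
    (radLambda d f : Euc d → ℂ) x = fderiv ℝ (f : Euc d → ℂ) x x :=
  indicator_of_mem hx _

lemma CInftyRad.differentiableAt (f : CInftyRad d) {x : Euc d} (hx : x ∈ unitBall d) :
    DifferentiableAt ℝ (f : Euc d → ℂ) x := f.2.1.1.differentiableAt hx

/-- For `v` orthogonal to `x` the points `x + t v` and `x - t v` have the same norm, so `t ↦ f (x +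
t v)` is even. -/
lemma fderiv_eq_zero_of_orthogonal (f : CInftyRad d) {x v : Euc d} (hx : x ∈ unitBall d)
    (h : inner ℝ x v = 0) : fderiv ℝ (f : Euc d → ℂ) x v = 0 := by
  have hd := (CInftyRad.differentiableAt f hx).hasFDerivAt
  have c1 : HasDerivAt (fun t : ℝ => x + t • v) v 0 := by
    simpa using ((hasDerivAt_id (0 : ℝ)).smul_const v).const_add x
  have c2 : HasDerivAt (fun t : ℝ => x - t • v) (-v) 0 := by
    simpa using ((hasDerivAt_id (0 : ℝ)).smul_const v).const_sub x
  have e1 : HasDerivAt (fun t : ℝ => (f : Euc d → ℂ) (x + t • v))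
      (fderiv ℝ (f : Euc d → ℂ) x v) 0 := by
    refine HasFDerivAt.comp_hasDerivAt (0 : ℝ) ?_ c1
    simpa using hd
  have e2 : HasDerivAt (fun t : ℝ => (f : Euc d → ℂ) (x - t • v))
      (fderiv ℝ (f : Euc d → ℂ) x (-v)) 0 := by
    refine HasFDerivAt.comp_hasDerivAt (0 : ℝ) ?_ c2
    simpa using hd
  have e : (fun t : ℝ => (f : Euc d → ℂ) (x - t • v)) =
      fun t : ℝ => (f : Euc d → ℂ) (x + t • v) := by
    funext t
    refine f.2.2 _ _ ?_
    rw [← sq_eq_sq₀ (norm_nonneg _) (norm_nonneg _), norm_sub_sq_real, norm_add_sq_real,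
      inner_smul_right, h]
    simp
  rw [e] at e2
  have := e1.unique e2
  rw [map_neg] at this
  exact self_eq_neg.1 this

lemma fderiv_radial (f : CInftyRad d) {x : Euc d} (hx : x ∈ unitBall d) (hx0 : x ≠ 0)
    (v : Euc d) : fderiv ℝ (f : Euc d → ℂ) x v =
      ((inner ℝ x v : ℝ) : ℂ) * ((radLambda d f : Euc d → ℂ) x / ((‖x‖ ^ 2 : ℝ) : ℂ)) := by
  have hn : ‖x‖ ^ 2 ≠ 0 := by simpa using hx0
  have h0 := fderiv_eq_zero_of_orthogonal f (v := v - (inner ℝ x v / ‖x‖ ^ 2) • x) hx (by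
    rw [inner_sub_right, inner_smul_right, real_inner_self_eq_norm_sq, div_mul_cancel₀ _ hn,
      sub_self])
  rw [map_sub, map_smul, sub_eq_zero] at h0
  rw [h0, radLambda_apply f hx, Complex.real_smul]
  push_cast
  ring

/-- With `k = Λf/|x|²` the gradient of `f` is `k x`, so `Δf = d k + Λk`. Moreover `Λk = ΛΛf/|x|² -
2k`, which turns `d` into `d - 2`. -/
lemma radLaplacian_apply (f : CInftyRad d) {x : Euc d} (hx : x ∈ unitBall d) (hx0 : x ≠ 0) :
    (radLaplacian d f : Euc d → ℂ) x = ((radLambda d (radLambda d f) : Euc d → ℂ) x +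
      ((d : ℂ) - 2) * (radLambda d f : Euc d → ℂ) x) / ((‖x‖ ^ 2 : ℝ) : ℂ) := by
  set k : Euc d → ℂ := fun y => (radLambda d f : Euc d → ℂ) y / ((‖y‖ ^ 2 : ℝ) : ℂ) with hk
  have hn : ((‖x‖ ^ 2 : ℝ) : ℂ) ≠ 0 := by
    rw [Complex.ofReal_ne_zero]; simpa using hx0
  have hnd : ∀ y : Euc d, HasFDerivAt (fun y : Euc d => ((‖y‖ ^ 2 : ℝ) : ℂ))
      (Complex.ofRealCLM.comp (2 • innerSL ℝ y)) y := fun y =>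
    Complex.ofRealCLM.hasFDerivAt.comp y (hasStrictFDerivAt_norm_sq y).hasFDerivAt
  have hkd : DifferentiableAt ℝ k x := by
    have h2 : DifferentiableAt ℝ (fun y : Euc d => ((‖y‖ ^ 2 : ℝ) : ℂ)) x := (hnd x).differentiableAt
    have h3 := CInftyRad.differentiableAt (radLambda d f) hx
    have h4 : DifferentiableAt ℝ (fun y : Euc d => (((‖y‖ ^ 2 : ℝ) : ℂ))⁻¹) x := by
      exact DifferentiableAt.fun_inv h2 (by exact hn)
    simp only [hk, div_eq_mul_inv]
    exact h3.fun_mul h4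
  have hnear : ∀ᶠ y in 𝓝 x, y ∈ unitBall d ∧ y ≠ 0 :=
    Filter.Eventually.and (Metric.isOpen_ball.mem_nhds hx) (isOpen_ne.mem_nhds hx0)
  -- the second derivatives
  have hsec : ∀ v : Euc d, fderiv ℝ (fderiv ℝ (f : Euc d → ℂ)) x v v =
      ((inner ℝ v v : ℝ) : ℂ) * k x + ((inner ℝ x v : ℝ) : ℂ) * fderiv ℝ k x v := by
    intro v
    have e1 : fderiv ℝ (fun y => fderiv ℝ (f : Euc d → ℂ) y v) x v =
        fderiv ℝ (fderiv ℝ (f : Euc d → ℂ)) x v v := by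
      have hdd : DifferentiableAt ℝ (fderiv ℝ (f : Euc d → ℂ)) x :=
        f.2.1.1.fderiv.differentiableAt hx
      have := (hdd.hasFDerivAt.clm_apply (hasFDerivAt_const v x)).fderiv
      rw [this]
      simp
    rw [← e1]
    have e2 : (fun y => fderiv ℝ (f : Euc d → ℂ) y v) =ᶠ[𝓝 x]
        fun y => ((inner ℝ y v : ℝ) : ℂ) * k y := by
      filter_upwards [hnear] with y hy
      exact fderiv_radial f hy.1 hy.2 v
    rw [e2.fderiv_eq]
    have hi : HasFDerivAt (fun y : Euc d => ((inner ℝ y v : ℝ) : ℂ))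
        (Complex.ofRealCLM.comp (innerSL ℝ v)) x := by
      have h := Complex.ofRealCLM.hasFDerivAt.comp x (innerSL ℝ v).hasFDerivAt
      refine h.congr_of_eventuallyEq (Eventually.of_forall fun y => ?_)
      simp [real_inner_comm]
    have h := (hi.mul hkd.hasFDerivAt).fderiv
    simp only [Pi.mul_def] at h
    rw [h]
    simp
    ring
  -- the radial derivative of `k`
  have hkx : fderiv ℝ k x x = (radLambda d (radLambda d f) : Euc d → ℂ) x / ((‖x‖ ^ 2 : ℝ) : ℂ) -
      2 * k x := by
    have e : (radLambda d f : Euc d → ℂ) =ᶠ[𝓝 x] fun y => ((‖y‖ ^ 2 : ℝ) : ℂ) * k y := by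
      filter_upwards [hnear] with y hy
      have : ((‖y‖ ^ 2 : ℝ) : ℂ) ≠ 0 := by rw [Complex.ofReal_ne_zero]; simpa using hy.2
      rw [hk]
      field_simp
    have h := ((hnd x).mul hkd.hasFDerivAt).fderiv
    simp only [Pi.mul_def] at h
    have h2 := radLambda_apply (radLambda d f) hx
    rw [e.fderiv_eq, h] at h2
    simp only [add_apply, smul_apply, ContinuousLinearMap.comp_apply,
      innerSL_apply_apply, real_inner_self_eq_norm_sq, Complex.ofRealCLM_apply] at h2
    rw [h2]
    simp only [smul_eq_mul, nsmul_eq_mul]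
    have hn' : ((‖x‖ : ℝ) : ℂ) ≠ 0 := by
      rw [Complex.ofReal_ne_zero]; simpa using hx0
    push_cast at hn ⊢
    field_simp
    ring
  have hlap : (radLaplacian d f : Euc d → ℂ) x = Laplacian.laplacian (f : Euc d → ℂ) x :=
    indicator_of_mem hx _
  rw [hlap, InnerProductSpace.laplacian_eq_iteratedFDeriv_orthonormalBasis _
        (EuclideanSpace.basisFun (Fin d) ℝ)]
  simp only [iteratedFDeriv_two_apply]
  have e3 : ∀ i : Fin d, fderiv ℝ (fderiv ℝ (f : Euc d → ℂ)) x
      (EuclideanSpace.basisFun (Fin d) ℝ i) (EuclideanSpace.basisFun (Fin d) ℝ i) =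
      k x + (x i : ℂ) * fderiv ℝ k x (EuclideanSpace.basisFun (Fin d) ℝ i) := by
    intro i
    rw [hsec]
    simp [EuclideanSpace.inner_single_right]
  simp only [Matrix.cons_val_zero, Matrix.cons_val_one, e3]
  rw [Finset.sum_add_distrib]
  have e4 : ∑ i, (x i : ℂ) * fderiv ℝ k x (EuclideanSpace.basisFun (Fin d) ℝ i) =
      fderiv ℝ k x x := by
    have hxs : x = ∑ i, x i • EuclideanSpace.basisFun (Fin d) ℝ i := by
      have := (EuclideanSpace.basisFun (Fin d) ℝ).sum_repr x
      simpa using this.symm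
    have h3 := congrArg (fderiv ℝ k x) hxs
    rw [map_sum] at h3
    rw [h3]
    refine Finset.sum_congr rfl fun i _ => ?_
    rw [map_smul, Complex.real_smul]
  rw [e4, hkx, Finset.sum_const, Finset.card_univ, Fintype.card_fin, nsmul_eq_mul, hk]
  field_simp
  ring

/-- The radial profile of a function, along the unit vector `e`. -/
def prof (e : Euc d) (f : CInftyRad d) (r : ℝ) : ℂ := (f : Euc d → ℂ) (r • e)

variable {e : Euc d}

lemma smul_mem_unitBall (he : ‖e‖ = 1) {r : ℝ} (hr : r ∈ Ioo (0 : ℝ) 1) :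
    r • e ∈ unitBall d := by
  simp [norm_smul, he, abs_of_pos hr.1, hr.2]

lemma smul_ne_zero_of_mem (he : ‖e‖ = 1) {r : ℝ} (hr : r ∈ Ioo (0 : ℝ) 1) : r • e ≠ 0 := by
  intro h
  have := congrArg norm h
  simp [norm_smul, he] at this
  exact hr.1.ne' this

/-- Derivatives along the ray are expressed through `Λ`, so that they are again profiles of smooth
radial functions, up to powers of `r`. -/
lemma hasDerivAt_prof (he : ‖e‖ = 1) (f : CInftyRad d) {r : ℝ} (hr : r ∈ Ioo (0 : ℝ) 1) :
    HasDerivAt (prof e f) (prof e (radLambda d f) r / r) r := by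
  have h1 : HasDerivAt (fun t : ℝ => t • e) e r := by
    simpa using (hasDerivAt_id r).smul_const e
  have h2 := (CInftyRad.differentiableAt f (smul_mem_unitBall he hr)).hasFDerivAt.comp_hasDerivAt r h1
  convert! h2 using 1
  rw [prof, radLambda_apply f (smul_mem_unitBall he hr), map_smul, Complex.real_smul]
  have : (r : ℂ) ≠ 0 := by exact_mod_cast hr.1.ne'
  field_simp

lemma prof_radLaplacian (he : ‖e‖ = 1) (f : CInftyRad d) {r : ℝ} (hr : r ∈ Ioo (0 : ℝ) 1) :
    prof e (radLaplacian d f) r = (prof e (radLambda d (radLambda d f)) r +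
      ((d : ℂ) - 2) * prof e (radLambda d f) r) / (r : ℂ) ^ 2 := by
  rw [prof, radLaplacian_apply f (smul_mem_unitBall he hr) (smul_ne_zero_of_mem he hr),
    norm_smul, he, mul_one, Real.norm_of_nonneg hr.1.le]
  push_cast
  rfl

lemma continuousOn_prof (he : ‖e‖ = 1) (f : CInftyRad d) :
    ContinuousOn (prof e f) (Ioo 0 1) := fun _ hr =>
  (hasDerivAt_prof he f hr).continuousAt.continuousWithinAt

lemma prof_bounded (he : ‖e‖ = 1) (f : CInftyRad d) :
    ∃ C, ∀ r ∈ Ioo (0 : ℝ) 1, ‖prof e f r‖ ≤ C := by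
  obtain ⟨C, hC⟩ := f.2.1.1.2 0
  refine ⟨C, fun r hr => ?_⟩
  have := hC _ (smul_mem_unitBall he hr)
  rwa [norm_iteratedFDeriv_zero] at this

end radial

/-- Lebesgue measure on the interval `(0,1)`. -/
abbrev intervalMeasure : Measure ℝ := volume.restrict (Ioo (0 : ℝ) 1)

instance : IsProbabilityMeasure intervalMeasure := ⟨by simp [intervalMeasure]⟩

/-! ### Weighted radial profiles in `L²(0,1)` and polar coordinates. -/

section weighted

variable {d : ℕ} {e : Euc d}

/-- The weight `r^n` is the square root of the radial Jacobian `r^(d-1)` when `d = 2n + 1`. With it,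
the `L²` norm on the ball becomes a multiple of an unweighted norm on `(0,1)`. -/
lemma memLp_weighted_prof (he : ‖e‖ = 1) (n : ℕ) (f : CInftyRad d) :
    MemLp (fun r : ℝ => (r : ℂ) ^ n * prof e f r) 2 intervalMeasure := by
  obtain ⟨C, hC⟩ := prof_bounded he f
  refine MemLp.of_bound (C := C) ?_ ?_
  · refine ContinuousOn.aestronglyMeasurable ?_ measurableSet_Ioo
    exact (Continuous.continuousOn (by fun_prop)).mul (continuousOn_prof he f)
  · rw [ae_restrict_iff' measurableSet_Ioo]
    filter_upwards with r hr
    rw [norm_mul, norm_pow, Complex.norm_real, Real.norm_of_nonneg hr.1.le]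
    have h1 : r ^ n ≤ 1 := pow_le_one₀ hr.1.le hr.2.le
    calc _ ≤ 1 * C := by gcongr; exact hC r hr
      _ = C := one_mul C

/-- The weighted radial profile as an element of `L²(0,1)`. -/
def radL2 (he : ‖e‖ = 1) (n : ℕ) : CInftyRad d →ₗ[ℂ] Lp ℂ 2 intervalMeasure where
  toFun f := (memLp_weighted_prof he n f).toLp _
  map_add' f g := by
    rw [← MemLp.toLp_add]
    refine MemLp.toLp_congr _ _ (ae_of_all _ fun r => ?_)
    simp [prof, mul_add]
  map_smul' c f := by
    rw [RingHom.id_apply, ← MemLp.toLp_const_smul]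
    refine MemLp.toLp_congr _ _ (ae_of_all _ fun r => ?_)
    simp [prof, mul_left_comm]

lemma coeFn_radL2 (he : ‖e‖ = 1) (n : ℕ) (f : CInftyRad d) :
    radL2 he n f =ᵐ[intervalMeasure] fun r => (r : ℂ) ^ n * prof e f r :=
  (memLp_weighted_prof he n f).coeFn_toLp

lemma L2_norm_sq {α : Type*} [MeasurableSpace α] {m : Measure α} (f : Lp ℂ 2 m) {g : α → ℂ}
    (h : f =ᵐ[m] g) : ‖f‖ ^ 2 = ∫ x, ‖g x‖ ^ 2 ∂m := by
  have h1 : (inner ℂ f f : ℂ) = ((‖f‖ ^ 2 : ℝ) : ℂ) := by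
    rw [inner_self_eq_norm_sq_to_K]; push_cast; rfl
  rw [L2.inner_def] at h1
  have h2 : ∫ a, inner ℂ (f a) (f a) ∂m = ((∫ a, ‖g a‖ ^ 2 ∂m : ℝ) : ℂ) := by
    rw [← integral_complex_ofReal]
    refine integral_congr_ae ?_
    filter_upwards [h] with x hx
    rw [inner_self_eq_norm_sq_to_K, hx]
    push_cast; rfl
  rw [h2] at h1
  exact_mod_cast h1.symm

/-- Polar coordinates. -/
lemma norm_toL2_radIncl_sq {n : ℕ} (hdn : d = 2 * n + 1) (he : ‖e‖ = 1) (f : CInftyRad d) :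
    ‖toL2 d (radIncl d f)‖ ^ 2 =
      (d : ℝ) * (volume : Measure (Euc d)).real (Metric.ball 0 1) * ‖radL2 he n f‖ ^ 2 := by
  have h0 : (toL2 d (radIncl d f) : Euc d → ℂ) =ᵐ[ballMeasure d] (radIncl d f : Euc d → ℂ) :=
    (CInfty_memLp (radIncl d f)).coeFn_toLp
  rw [L2_norm_sq _ h0, L2_norm_sq _ (coeFn_radL2 he n f)]
  have hne : Nontrivial (Euc d) := ⟨e, 0, fun h => by rw [h, norm_zero] at he; exact zero_ne_one he⟩
  have h1 : ∫ x, ‖(radIncl d f : Euc d → ℂ) x‖ ^ 2 ∂(ballMeasure d) =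
      ∫ x : Euc d, (fun r : ℝ => ‖(f : Euc d → ℂ) (r • e)‖ ^ 2) ‖x‖ := by
    rw [ballMeasure, setIntegral_eq_integral_of_forall_compl_eq_zero]
    · refine integral_congr_ae (ae_of_all _ fun x => ?_)
      have : (f : Euc d → ℂ) x = (f : Euc d → ℂ) (‖x‖ • e) := f.2.2 _ _ (by simp [norm_smul, he])
      simp only
      rw [← this]
      rfl
    · intro x hx
      rw [(radIncl d f).2.2 x hx]
      simp
  rw [h1, integral_fun_norm_addHaar (volume : Measure (Euc d))
    (fun r : ℝ => ‖(f : Euc d → ℂ) (r • e)‖ ^ 2), finrank_euclideanSpace_fin, nsmul_eq_mul, smul_eq_mul,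
    mul_assoc]
  congr 2
  have h2 : ∫ y in Ioi (0 : ℝ), y ^ (d - 1) • ‖(f : Euc d → ℂ) (y • e)‖ ^ 2 =
      ∫ y in Ioo (0 : ℝ) 1, y ^ (d - 1) • ‖(f : Euc d → ℂ) (y • e)‖ ^ 2 := by
    refine setIntegral_eq_of_subset_of_forall_sdiff_eq_zero measurableSet_Ioi
      (fun x hx => hx.1) fun x hx => ?_
    have hx1 : x • e ∉ unitBall d := fun h => hx.2 ⟨hx.1, by
      have h0 : (0 : ℝ) < x := hx.1
      simpa [norm_smul, he, abs_of_pos h0] using h⟩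
    rw [f.2.1.2 _ hx1]
    simp
  rw [h2]
  refine setIntegral_congr_fun measurableSet_Ioo fun y hy => ?_
  simp only [norm_mul, norm_pow, Complex.norm_real, Real.norm_of_nonneg hy.1.le, smul_eq_mul, prof]
  rw [mul_pow, ← pow_mul, show d - 1 = n * 2 by omega]

lemma ball_const_pos (hd : 5 ≤ d) :
    0 < (d : ℝ) * (volume : Measure (Euc d)).real (Metric.ball 0 1) := by
  have h1 : (0 : ℝ) < d := by exact_mod_cast (by omega : 0 < d)
  have h2 : 0 < (volume : Measure (Euc d)).real (Metric.ball 0 1) :=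
    ENNReal.toReal_pos (Metric.measure_ball_pos _ _ one_pos).ne' measure_ball_lt_top.ne
  positivity

/-- The norms of the ball and of the weighted profiles are equivalent. -/
lemma exists_norm_radL2_equiv (hd : 5 ≤ d) {n : ℕ} (hdn : d = 2 * n + 1) (he : ‖e‖ = 1) :
    ∃ K : ℝ, 0 < K ∧ ∀ f : CInftyRad d, ‖toL2 d (radIncl d f)‖ = K * ‖radL2 he n f‖ := by
  refine ⟨Real.sqrt ((d : ℝ) * (volume : Measure (Euc d)).real (Metric.ball 0 1)),
    Real.sqrt_pos.2 (ball_const_pos hd), fun f => ?_⟩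
  rw [← sq_eq_sq₀ (norm_nonneg _) (by positivity), mul_pow,
    Real.sq_sqrt (ball_const_pos hd).le, norm_toL2_radIncl_sq hdn he]

/-- `Λ` is the sum of the `x_i ∂_i` with coefficients bounded on the ball. It costs one derivative,
whence `1 ≤ k`. -/
lemma exists_norm_toL2_radLambda_le (d : ℕ) {k : ℕ} (hk : 1 ≤ k) :
    ∃ C : ℝ, 0 ≤ C ∧ ∀ f : CInftyRad d,
      ‖toL2 d (radIncl d (radLambda d f))‖ ≤ C * ‖jet d k (radIncl d f)‖ := by
  have hm : ∀ i : Fin d, BddSmooth fun x : Euc d => ((x i : ℝ) : ℂ) := fun i =>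
    BddSmooth.of_contDiff (Complex.ofRealCLM.contDiff.comp
      (EuclideanSpace.proj (𝕜 := ℝ) i).contDiff)
  choose C hC using fun i => norm_toL2_smoothMul_le _ (hm i)
  refine ⟨∑ i, |C i|, Finset.sum_nonneg fun i _ => abs_nonneg _, fun f => ?_⟩
  have e1 : radIncl d (radLambda d f) = ∑ i, smoothMul _ (hm i) (pderiv i (radIncl d f)) := by
    ext x
    rw [Submodule.coe_sum, Finset.sum_apply]
    by_cases hx : x ∈ unitBall d
    · have h1 : (radIncl d (radLambda d f) : Euc d → ℂ) x = fderiv ℝ (f : Euc d → ℂ) x x :=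
        radLambda_apply f hx
      rw [h1]
      have hxs : x = ∑ i, x i • EuclideanSpace.single i (1 : ℝ) := by
        have := (EuclideanSpace.basisFun (Fin d) ℝ).sum_repr x
        simpa using this.symm
      have h3 := congrArg (fderiv ℝ (f : Euc d → ℂ) x) hxs
      rw [map_sum] at h3
      rw [h3]
      refine Finset.sum_congr rfl fun i _ => ?_
      rw [map_smul, Complex.real_smul]
      have h4 : (pderiv i (radIncl d f) : Euc d → ℂ) x =
        fderiv ℝ (f : Euc d → ℂ) x (EuclideanSpace.single i 1) :=
        (indicator_of_mem hx _ : (unitBall d).indicator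
          (fun x => fderiv ℝ (f : Euc d → ℂ) x (EuclideanSpace.single i 1)) x = _)
      change _ = ((x i : ℝ) : ℂ) * (pderiv i (radIncl d f) : Euc d → ℂ) x
      rw [h4]
    · rw [(radIncl d (radLambda d f)).2.2 x hx]
      refine (Finset.sum_eq_zero fun i _ => ?_).symm
      exact (smoothMul _ (hm i) (pderiv i (radIncl d f))).2.2 x hx
  rw [e1, map_sum, Finset.sum_mul]
  refine (norm_sum_le _ _).trans (Finset.sum_le_sum fun i _ => ?_)
  have h1 : mderiv (Pi.single i 1) (radIncl d f) = pderiv i (radIncl d f) := by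
    have : ((List.finRange d).map fun j => (pderiv j : Module.End ℂ (CInfty d)) ^
        (Pi.single i 1 : Fin d → ℕ) j).prod = pderiv i := by
      rw [List.prod_map_eq_pow_single i]
      · simp [List.count_eq_one_of_mem (List.nodup_finRange d) (List.mem_finRange i)]
      · intro j hj _
        simp [hj]
    rw [mderiv, this]
  have h2 : ‖toL2 d (pderiv i (radIncl d f))‖ ≤ ‖jet d k (radIncl d f)‖ := by
    rw [← h1]
    refine norm_toL2_mderiv_le _ ?_ _
    simpa using hk
  refine (hC i _).trans ?_
  have := le_abs_self (C i)
  gcongr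

end weighted

/-! ### Closability of partial derivatives -/

section closability

variable {d : ℕ}

/-- Real-valued test functions on the unit ball. -/
structure IsTest (g : Euc d → ℝ) : Prop where
  smooth : ContDiff ℝ ∞ g
  compact : HasCompactSupport g
  subset : tsupport g ⊆ unitBall d

/-- The operator `A` has a formal transpose with respect to test functions. -/
def HasTranspose (A : Module.End ℂ (CInfty d)) : Prop :=
  ∀ g : Euc d → ℝ, IsTest g → ∃ h : Euc d → ℝ, IsTest h ∧
    ∀ f : CInfty d, ∫ x, g x • (A f : Euc d → ℂ) x = ∫ x, h x • (f : Euc d → ℂ) x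

lemma HasTranspose.one : HasTranspose (1 : Module.End ℂ (CInfty d)) :=
  fun g hg => ⟨g, hg, fun _ => rfl⟩

lemma HasTranspose.mul {A B : Module.End ℂ (CInfty d)} (hA : HasTranspose A)
    (hB : HasTranspose B) : HasTranspose (A * B) := fun g hg => by
  obtain ⟨h, hh, e⟩ := hA g hg
  obtain ⟨h', hh', e'⟩ := hB h hh
  exact ⟨h', hh', fun f => (e (B f)).trans (e' f)⟩

lemma HasTranspose.pow {A : Module.End ℂ (CInfty d)} (hA : HasTranspose A) (n : ℕ) :
    HasTranspose (A ^ n) := by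
  induction n with
  | zero => exact HasTranspose.one
  | succ n ih => rw [pow_succ]; exact ih.mul hA

lemma HasTranspose.list_prod {L : List (Module.End ℂ (CInfty d))}
    (h : ∀ A ∈ L, HasTranspose A) : HasTranspose L.prod := by
  induction L with
  | nil => exact HasTranspose.one
  | cons A L ih =>
    rw [List.prod_cons]
    exact (h A (by simp)).mul (ih fun B hB => h B (by simp [hB]))

lemma IsTest.integrable_smul {g : Euc d → ℝ} (hg : IsTest g) {f : Euc d → ℂ}
    (hf : ContinuousOn f (unitBall d)) : Integrable fun x => g x • f x := by
  have h1 : IntegrableOn (fun x => g x • f x) (tsupport g) :=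
    (hg.smooth.continuous.continuousOn.smul (hf.mono hg.subset)).integrableOn_compact hg.compact
  rw [integrableOn_iff_integrable_of_support_subset] at h1
  · exact h1
  · intro x hx
    refine subset_tsupport g fun h => hx ?_
    simp [h]

lemma IsTest.fderiv_neg {g : Euc d → ℝ} (hg : IsTest g) (v : Euc d) :
    IsTest fun x => -fderiv ℝ g x v := by
  have hs : tsupport (fun x => -fderiv ℝ g x v) ⊆ tsupport g := by
    refine closure_minimal (fun x hx => ?_) (isClosed_tsupport g)
    refine support_fderiv_subset ℝ (f := g) fun h => hx ?_
    simp [h]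
  refine ⟨?_, hg.compact.of_isClosed_subset (isClosed_tsupport _) hs, hs.trans hg.subset⟩
  exact ((hg.smooth.fderiv_right (m := ∞) (by simp)).clm_apply contDiff_const).neg

/-- Functions in `CInfty d` may jump across the sphere, but the integration by parts only sees the
support of the test function, which lies inside the open ball. -/
lemma hasTranspose_pderiv (i : Fin d) : HasTranspose (pderiv i : Module.End ℂ (CInfty d)) := by
  intro g hg
  refine ⟨_, hg.fderiv_neg (EuclideanSpace.single i 1), fun f => ?_⟩
  have hc : ContinuousOn (f : Euc d → ℂ) (unitBall d) := f.2.1.1.continuousOn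
  have hc' : ContinuousOn (fun x => fderiv ℝ (f : Euc d → ℂ) x (EuclideanSpace.single i 1))
    (unitBall d) := (f.2.1.fderiv_apply _).1.continuousOn
  have e : ∀ x, g x • (pderiv i f : Euc d → ℂ) x =
      g x • fderiv ℝ (f : Euc d → ℂ) x (EuclideanSpace.single i 1) := by
    intro x
    by_cases hx : x ∈ unitBall d
    · exact congrArg (g x • ·) (indicator_of_mem hx _ : (unitBall d).indicator
        (fun x => fderiv ℝ (f : Euc d → ℂ) x (EuclideanSpace.single i 1)) x = _)
    · have : g x = 0 := image_eq_zero_of_notMem_tsupport fun h => hx (hg.subset h)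
      simp [this]
  simp only [e]
  have h2 : Integrable fun x => fderiv ℝ g x (EuclideanSpace.single i 1) • (f : Euc d → ℂ) x := by
    have := ((hg.fderiv_neg (EuclideanSpace.single i 1)).integrable_smul hc).neg
    refine this.congr (ae_of_all _ fun x => ?_)
    simp
  rw [integral_smul_fderiv_eq_neg_fderiv_smul_of_integrable h2 (hg.integrable_smul hc')
    (hg.integrable_smul hc)]
  · rw [← integral_neg]
    simp
  · exact fun x _ => (hg.smooth.differentiable (by simp)).differentiableAt
  · exact fun x hx => f.2.1.differentiableAt (hg.subset hx)

lemma hasTranspose_mderiv (α : Fin d → ℕ) :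
    HasTranspose (mderiv α : Module.End ℂ (CInfty d)) := by
  refine HasTranspose.list_prod fun A hA => ?_
  obtain ⟨i, _, rfl⟩ := List.mem_map.1 hA
  exact (hasTranspose_pderiv i).pow _

/-- Pairing with a test function is continuous on `L²`. -/
lemma IsTest.continuous_pairing {g : Euc d → ℝ} (hg : IsTest g) :
    Continuous fun h : Lp ℂ 2 (ballMeasure d) => ∫ x, g x • h x ∂(ballMeasure d) := by
  have hm : MemLp (fun x => (g x : ℂ)) 2 (ballMeasure d) := by
    have h1 : MemLp (fun x => (g x : ℂ)) 2 (volume : Measure (Euc d)) := by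
      refine Continuous.memLp_of_hasCompactSupport
        (Complex.continuous_ofReal.comp hg.smooth.continuous) ?_
      exact hg.compact.comp_left (g := fun t : ℝ => (t : ℂ)) (by simp)
    exact h1.restrict _
  have e : (fun h : Lp ℂ 2 (ballMeasure d) => ∫ x, g x • h x ∂(ballMeasure d)) =
      fun h => inner ℂ (hm.toLp _) h := by
    funext h
    rw [L2.inner_def]
    refine integral_congr_ae ?_
    filter_upwards [hm.coeFn_toLp] with x hx
    rw [hx]
    simp [mul_comm]
  rw [e]
  exact continuous_const.inner continuous_id

lemma IsTest.integral_smul_toL2 {g : Euc d → ℝ} (f : CInfty d) :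
    ∫ x, g x • (toL2 d f : Euc d → ℂ) x ∂(ballMeasure d) = ∫ x, g x • (f : Euc d → ℂ) x := by
  have h0 : (toL2 d f : Euc d → ℂ) =ᵐ[ballMeasure d] (f : Euc d → ℂ) :=
    (CInfty_memLp f).coeFn_toLp
  have h1 : ∫ x, g x • (toL2 d f : Euc d → ℂ) x ∂(ballMeasure d) =
      ∫ x, g x • (f : Euc d → ℂ) x ∂(ballMeasure d) := by
    refine integral_congr_ae ?_
    filter_upwards [h0] with x hx
    rw [hx]
  rw [h1, ballMeasure]
  refine setIntegral_eq_integral_of_forall_compl_eq_zero fun x hx => ?_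
  rw [f.2.2 x hx, smul_zero]

/-- Closability of `A` in `L²`: moving `A` onto a test function shows that the limit pairs to zero
with all of them. -/
lemma eq_zero_of_tendsto_of_hasTranspose {A : Module.End ℂ (CInfty d)} (hA : HasTranspose A)
    {f : ℕ → CInfty d} {h : Lp ℂ 2 (ballMeasure d)}
    (h0 : Tendsto (fun m => toL2 d (f m)) atTop (𝓝 0))
    (h1 : Tendsto (fun m => toL2 d (A (f m))) atTop (𝓝 h)) : h = 0 := by
  have key : ∀ g : Euc d → ℝ, IsTest g → ∫ x, g x • h x ∂(ballMeasure d) = 0 := by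
    intro g hg
    obtain ⟨g', hg', e⟩ := hA g hg
    have l1 := (hg.continuous_pairing.tendsto h).comp h1
    have l2 := (hg'.continuous_pairing.tendsto 0).comp h0
    have e2 : (fun m => ∫ x, g x • (toL2 d (A (f m)) : Euc d → ℂ) x ∂(ballMeasure d)) =
        fun m => ∫ x, g' x • (toL2 d (f m) : Euc d → ℂ) x ∂(ballMeasure d) := by
      funext m
      rw [IsTest.integral_smul_toL2, IsTest.integral_smul_toL2, e]
    have e3 : ∫ x, g' x • (0 : Lp ℂ 2 (ballMeasure d)) x ∂(ballMeasure d) = 0 := by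
      rw [integral_eq_zero_of_ae]
      filter_upwards [Lp.coeFn_zero ℂ 2 (ballMeasure d)] with x hx
      rw [hx]
      simp
    simp only [Function.comp_def] at l1 l2
    rw [e2] at l1
    rw [e3] at l2
    exact tendsto_nhds_unique l1 l2
  have hfin : IsFiniteMeasure (ballMeasure d) :=
    ⟨by rw [ballMeasure, Measure.restrict_apply_univ]; exact measure_ball_lt_top⟩
  have hi : Integrable h (ballMeasure d) := (Lp.memLp h).integrable (by norm_num)
  have hz := Metric.isOpen_ball (x := (0 : Euc d)) (ε := 1) |>.ae_eq_zero_of_integral_contDiff_smul_eq_zero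
    (μ := ballMeasure d) (f := h) (hi.locallyIntegrable.locallyIntegrableOn _)
    fun g h1 h2 h3 => key g ⟨h1, h2, h3⟩
  refine Lp.ext ?_
  filter_upwards [hz, ae_restrict_mem measurableSet_ball, Lp.coeFn_zero ℂ 2 (ballMeasure d)]
    with x h1 h2 h3
  rw [h1 h2, h3]
  rfl

end closability

/-! ### Passing to the limit in the eigenvalue equation -/

/-- The integrated form of `s' = t` survives the limit without any convergence of derivatives. One
point of pointwise convergence fixes the constant of integration. -/
lemma primitive_of_tendsto {s t : ℕ → ℝ → ℂ} {S T : ℝ → ℂ}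
    (hd : ∀ k, ∀ r ∈ Ioo (0 : ℝ) 1, HasDerivAt (s k) (t k r) r)
    (ht : ∀ k, ContinuousOn (t k) (Ioo 0 1))
    (hs : ∀ᵐ r ∂intervalMeasure, Tendsto (fun k => s k r) atTop (𝓝 (S r)))
    (hT : ∀ a ∈ Ioo (0 : ℝ) 1, ∀ b ∈ Ioo (0 : ℝ) 1,
      Tendsto (fun k => ∫ x in a..b, t k x) atTop (𝓝 (∫ x in a..b, T x))) :
    ∃ x0 ∈ Ioo (0 : ℝ) 1, ∃ c : ℂ,
      S =ᵐ[intervalMeasure] fun r => c + ∫ x in x0..r, T x := by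
  obtain ⟨x0, hx0, hx0m⟩ := (hs.and (ae_restrict_mem measurableSet_Ioo)).exists
  refine ⟨x0, hx0m, S x0, ?_⟩
  filter_upwards [hs, ae_restrict_mem measurableSet_Ioo] with r hr hrm
  have h1 := (hx0.add (hT x0 hx0m r hrm))
  refine tendsto_nhds_unique hr (h1.congr fun k => ?_)
  have hsub : uIcc x0 r ⊆ Ioo 0 1 := (ordConnected_Ioo).uIcc_subset hx0m hrm
  rw [intervalIntegral.integral_eq_sub_of_hasDerivAt (fun x hx => hd k x (hsub hx))
    ((ht k).mono hsub).intervalIntegrable]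
  ring

/-- The integral is an inner product with a bounded function supported in a compact subinterval, so
`m` may be singular at the endpoints `0` and `1`. -/
lemma tendsto_intervalIntegral_mul {m : ℝ → ℂ} (hm : ContinuousOn m (Ioo 0 1))
    {F : ℕ → Lp ℂ 2 intervalMeasure} {G : Lp ℂ 2 intervalMeasure}
    (hF : Tendsto F atTop (𝓝 G)) {a b : ℝ} (ha : a ∈ Ioo (0 : ℝ) 1) (hb : b ∈ Ioo (0 : ℝ) 1) :
    Tendsto (fun k => ∫ x in a..b, m x * F k x) atTop (𝓝 (∫ x in a..b, m x * G x)) := by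
  wlog hab : a ≤ b generalizing a b
  · have h := (this hb ha (le_of_not_ge hab)).neg
    simp only [← intervalIntegral.integral_symm] at h
    exact h
  have hsub : Icc a b ⊆ Ioo 0 1 := fun x hx => ⟨ha.1.trans_le hx.1, hx.2.trans_lt hb.2⟩
  obtain ⟨C, hC⟩ := isCompact_Icc.exists_bound_of_continuousOn (hm.mono hsub)
  have hM : MemLp ((Ioc a b).indicator fun x => (starRingEnd ℂ) (m x)) 2 intervalMeasure := by
    refine MemLp.of_bound (C := max C 0) ?_ (ae_of_all _ fun x => ?_)
    · refine AEStronglyMeasurable.indicator ?_ measurableSet_Ioc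
      exact ((Complex.continuous_conj.comp_continuousOn hm).aestronglyMeasurable measurableSet_Ioo)
    · by_cases hx : x ∈ Ioc a b
      · rw [indicator_of_mem hx, RCLike.norm_conj]
        exact (hC x (Ioc_subset_Icc_self hx)).trans (le_max_left _ _)
      · rw [indicator_of_notMem hx, norm_zero]
        exact le_max_right _ _
  have e : ∀ h : Lp ℂ 2 intervalMeasure, ∫ x in a..b, m x * h x = inner ℂ (hM.toLp _) h := by
    intro h
    have hs : volume.restrict (Ioc a b) = intervalMeasure.restrict (Ioc a b) := by
      rw [Measure.restrict_restrict measurableSet_Ioc, inter_eq_left.2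
        (Ioc_subset_Icc_self.trans hsub)]
    rw [intervalIntegral.integral_of_le hab, hs, ← integral_indicator measurableSet_Ioc,
      L2.inner_def]
    refine integral_congr_ae ?_
    filter_upwards [hM.coeFn_toLp] with x hx
    rw [hx]
    by_cases hx : x ∈ Ioc a b
    · simp [hx, mul_comm]
    · simp [hx]
  simp only [e]
  exact (continuous_const.inner continuous_id).tendsto G |>.comp hF

lemma intervalIntegral_congr_Ioo {F G : ℝ → ℂ} (h : F =ᵐ[intervalMeasure] G) {a b : ℝ}
    (ha : a ∈ Ioo (0 : ℝ) 1) (hb : b ∈ Ioo (0 : ℝ) 1) :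
    ∫ x in a..b, F x = ∫ x in a..b, G x := by
  refine intervalIntegral.integral_congr_ae ?_
  filter_upwards [(ae_restrict_iff' measurableSet_Ioo).1 h] with x hx hxm
  exact hx ((ordConnected_Ioo).uIcc_subset ha hb (uIoc_subset_uIcc hxm))

/-- `U0`, `U1`, `U2` stand for the limits of `u`, `Λu` and `p`. Both primitives in the hypotheses
are continuous, and solving algebraically for `u'` makes it continuous too. This upgrades the
primitives to `C¹` functions, hence `u` to a twice differentiable function, to which
`spectral_solution_eq_zero` applies. -/
lemma weak_solution_ae_eq_zero {d n : ℕ} (hd : 5 ≤ d) (hdn : d = 2 * n + 1) {z : ℂ}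
    (hz : -1 < z.re) {U0 U1 U2 : ℝ → ℂ}
    (L0 : ∀ a b : ℝ, 0 < a → a ≤ b → b < 1 → IntervalIntegrable U0 volume a b)
    (L1 : ∀ a b : ℝ, 0 < a → a ≤ b → b < 1 → IntervalIntegrable U1 volume a b)
    (L2 : ∀ a b : ℝ, 0 < a → a ≤ b → b < 1 → IntervalIntegrable U2 volume a b)
    (m0 : Integrable (fun r => r ^ (2 * n) * ‖U0 r‖ ^ 2) intervalMeasure)
    (m1 : Integrable (fun r => r ^ (2 * n) * ‖U1 r‖ ^ 2) intervalMeasure)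
    (e2 : U2 =ᵐ[intervalMeasure] fun r => U1 r + ((d : ℂ) - 2 + z) * U0 r)
    (h0 : ∃ x0 ∈ Ioo (0 : ℝ) 1, ∃ c : ℂ,
      U0 =ᵐ[intervalMeasure] fun r => c + ∫ x in x0..r, U1 x / x)
    (hR : ∃ x0 ∈ Ioo (0 : ℝ) 1, ∃ c : ℂ,
      (fun r : ℝ => (r : ℂ) ^ (2 * n) * (U1 r / r - r * U2 r)) =ᵐ[intervalMeasure]
        fun r => c + ∫ x in x0..r, (x : ℂ) ^ (2 * n) *
          ((z - 1) * U2 x + (potential d x : ℂ) * U0 x)) :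
    U0 =ᵐ[intervalMeasure] 0 ∧ U1 =ᵐ[intervalMeasure] 0 := by
  obtain ⟨x0, hx0, c0, h0⟩ := h0
  obtain ⟨x1, hx1, c1, hR⟩ := hR
  set ζ : ℂ := (d : ℂ) - 2 + z with hζ
  set R : ℝ → ℂ := fun r => c1 + ∫ x in x1..r, (x : ℂ) ^ (2 * n) *
          ((z - 1) * U2 x + (potential d x : ℂ) * U0 x) with hRdef
  set u : ℝ → ℂ := fun r => c0 + ∫ x in x0..r, U1 x / x with hu
  -- The candidate for `u'`: it solves `R = r^(2n) (u' - r p)` with `p = r u' + ζ u`, where `1-r²`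
  -- does not vanish.
  set u1 : ℝ → ℂ := fun r => (R r / (r : ℂ) ^ (2 * n) + r * ζ * u r) / (1 - (r : ℂ) ^ 2) with hu1
  have hr0 : ∀ r ∈ Ioo (0 : ℝ) 1, (r : ℂ) ≠ 0 := fun r hr => by exact_mod_cast hr.1.ne'
  have hr1 : ∀ r ∈ Ioo (0 : ℝ) 1, (1 - (r : ℂ) ^ 2) ≠ 0 := fun r hr => by
    exact_mod_cast (one_sub_sq_pos hr).ne'
  have mem : ∀ᵐ r ∂intervalMeasure, r ∈ Ioo (0 : ℝ) 1 := ae_restrict_mem measurableSet_Ioo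
  have eU1 : U1 =ᵐ[intervalMeasure] fun r => r * u1 r := by
    filter_upwards [hR, h0, e2, mem] with r a1 a2 a3 hr
    have b0 := hr0 r hr
    have b1 := hr1 r hr
    simp only [hu1]
    rw [← a1, ← a2, a3]
    field_simp
    ring
  have hV : ContinuousOn (fun r : ℝ => (potential d r : ℂ)) (Ioo 0 1) := by
    refine Complex.continuous_ofReal.comp_continuousOn (Continuous.continuousOn ?_)
    have hd' : (5 : ℝ) ≤ d := by exact_mod_cast hd
    refine continuous_const.div (by fun_prop) fun x => ?_
    have : 0 < (d : ℝ) - 4 + x ^ 2 := by nlinarith [sq_nonneg x]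
    positivity
  have sub : ∀ a b : ℝ, 0 < a → a ≤ b → b < 1 → uIcc a b ⊆ Ioo 0 1 := fun a b ha hab hb => by
    rw [uIcc_of_le hab]
    exact fun x hx => ⟨ha.trans_le hx.1, hx.2.trans_lt hb⟩
  have cu : ContinuousOn u (Ioo 0 1) := by
    refine continuousOn_const.add (acLoc_integral hx0 fun a b ha hab hb => ?_).continuousOn
    simp only [div_eq_mul_inv]
    refine (L1 a b ha hab hb).mul_continuousOn fun x hx => ContinuousAt.continuousWithinAt ?_
    exact (Complex.continuous_ofReal.continuousAt).inv₀ (hr0 x (sub a b ha hab hb hx))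
  have cR : ContinuousOn R (Ioo 0 1) := by
    refine continuousOn_const.add (acLoc_integral hx1 fun a b ha hab hb => ?_).continuousOn
    refine IntervalIntegrable.continuousOn_mul ?_ (Continuous.continuousOn (by fun_prop))
    exact ((L2 a b ha hab hb).const_mul _).add
      ((L0 a b ha hab hb).continuousOn_mul (hV.mono (sub a b ha hab hb)))
  have cu1 : ContinuousOn u1 (Ioo 0 1) := by
    refine ContinuousOn.div ?_ (Continuous.continuousOn (by fun_prop)) hr1
    refine (cR.div (Continuous.continuousOn (by fun_prop)) fun r hr => pow_ne_zero _ (hr0 r hr)).add ?_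
    exact (Continuous.continuousOn (by fun_prop)).mul cu
  have du : ∀ r ∈ Ioo (0 : ℝ) 1, HasDerivAt u (u1 r) r := by
    intro r hr
    refine ((hasDerivAt_integral_Ioo hx0 cu1 hr).const_add c0).congr_of_eventuallyEq ?_
    filter_upwards [isOpen_Ioo.mem_nhds hr] with s hs
    simp only [hu]
    congr 1
    refine intervalIntegral_congr_Ioo ?_ hx0 hs
    filter_upwards [eU1, mem] with x hx hxm
    rw [hx, mul_div_cancel_left₀ _ (hr0 x hxm)]
  set q : ℝ → ℂ := fun x => (x : ℂ) ^ (2 * n) *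
          ((z - 1) * (x * u1 x + ζ * u x) + (potential d x : ℂ) * u x) with hq
  have cq : ContinuousOn q (Ioo 0 1) := by
    refine (Continuous.continuousOn (by fun_prop)).mul (ContinuousOn.add ?_ (hV.mul cu))
    refine continuousOn_const.mul (ContinuousOn.add ?_ (continuousOn_const.mul cu))
    exact (Continuous.continuousOn (by fun_prop)).mul cu1
  have dR : ∀ r ∈ Ioo (0 : ℝ) 1, HasDerivAt R (q r) r := by
    intro r hr
    refine ((hasDerivAt_integral_Ioo hx1 cq hr).const_add c1).congr_of_eventuallyEq ?_
    filter_upwards [isOpen_Ioo.mem_nhds hr] with s hs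
    simp only [hRdef]
    congr 1
    refine intervalIntegral_congr_Ioo ?_ hx1 hs
    filter_upwards [eU1, e2, h0, mem] with x a1 a2 a3 hxm
    simp only [hq]
    rw [a2, a1, a3]
  have hdc : (d : ℂ) = 2 * n + 1 := by rw [hdn]; push_cast; ring
  have du1 : ∀ r ∈ Ioo (0 : ℝ) 1, HasDerivAt u1
      ((((z - 1) * (r * u1 r + ζ * u r) + (potential d r : ℂ) * u r -
        2 * n * R r / (r : ℂ) ^ (2 * n + 1)) + ζ * u r + r * ζ * u1 r + 2 * r * u1 r) /
          (1 - (r : ℂ) ^ 2)) r := by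
    intro r hr
    have b0 := hr0 r hr
    have b1 := hr1 r hr
    have hid : HasDerivAt (fun x : ℝ => (x : ℂ)) 1 r := Complex.ofRealCLM.hasDerivAt
    have h1 := (dR r hr).fun_div (hid.fun_pow (2 * n)) (pow_ne_zero _ b0)
    have h2 := (hid.mul_const ζ).fun_mul (du r hr)
    have h3 := (h1.fun_add h2).fun_div ((hid.fun_pow 2).const_sub 1) b1
    convert! h3 using 1
    have hu1r : R r / (r : ℂ) ^ (2 * n) + r * ζ * u r = u1 r * (1 - (r : ℂ) ^ 2) := by
      simp only [hu1]
      rw [div_mul_cancel₀ _ b1]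
    rw [hu1r]
    -- The truncated exponent `2n - 1` is harmless because `d ≥ 5` gives `2n ≥ 1`.
    have hp : (r : ℂ) ^ (2 * n - 1) * (2 * n : ℕ) = (r : ℂ) ^ (2 * n) / r * (2 * n) := by
      obtain ⟨m, hm⟩ : ∃ m, 2 * n = m + 1 := ⟨2 * n - 1, by omega⟩
      push_cast
      rw [hm, Nat.add_sub_cancel, pow_succ]
      field_simp
    have hP : (r : ℂ) ^ (2 * n) ≠ 0 := pow_ne_zero _ b0
    simp only [hq, pow_succ]
    rw [mul_comm ((2 * n : ℕ) : ℂ), hp]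
    generalize (r : ℂ) ^ (2 * n) = P at *
    push_cast
    field_simp
    ring
  have i1 : IntegrableOn (fun r => ‖u1 r‖ ^ 2) (Ioo (1 / 2) 1) := by
    have hs : Ioo (1 / 2 : ℝ) 1 ⊆ Ioo 0 1 := Ioo_subset_Ioo_left (by norm_num)
    have hm : IntegrableOn (fun r => r ^ (2 * n) * ‖U1 r‖ ^ 2) (Ioo (1 / 2) 1) :=
      IntegrableOn.mono_set (show IntegrableOn _ (Ioo 0 1) volume from m1) hs
    -- The exponent `2n + 2` combines the weight `r^(2n)` with the two powers of `r` in `|U1|² =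
    -- r²|u1|²`; on the interval `2r ≥ 1`.
    refine Integrable.mono' (hm.const_mul (2 ^ (2 * n + 2)))
      (((cu1.mono hs).norm.pow 2).aestronglyMeasurable measurableSet_Ioo) ?_
    filter_upwards [ae_restrict_of_ae_restrict_of_subset hs eU1,
      ae_restrict_mem measurableSet_Ioo] with r hr hrm
    rw [hr, norm_mul, Complex.norm_real, Real.norm_of_nonneg (hs hrm).1.le,
      Real.norm_of_nonneg (sq_nonneg _)]
    have h2 : 1 ≤ (2 * r) ^ (2 * n + 2) := one_le_pow₀ (by linarith [hrm.1])
    calc ‖u1 r‖ ^ 2 = 1 * ‖u1 r‖ ^ 2 := (one_mul _).symm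
      _ ≤ (2 * r) ^ (2 * n + 2) * ‖u1 r‖ ^ 2 := by gcongr
      _ = 2 ^ (2 * n + 2) * (r ^ (2 * n) * (r * ‖u1 r‖) ^ 2) := by
        rw [mul_pow]; ring
  have i0 : IntegrableOn (fun r => r ^ ((d : ℝ) - 1) * ‖u r‖ ^ 2) (Ioo 0 1) := by
    refine Integrable.congr m0 ?_
    filter_upwards [h0] with r hr
    rw [hr, show (d : ℝ) - 1 = ((2 * n : ℕ) : ℝ) by rw [hdn]; push_cast; ring, Real.rpow_natCast]
  have uz := spectral_solution_eq_zero hd hz du du1 (fun r hr => by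
    have b0 := hr0 r hr
    have b1 := hr1 r hr
    have hu1r : R r = (u1 r * (1 - (r : ℂ) ^ 2) - r * ζ * u r) * (r : ℂ) ^ (2 * n) := by
      simp only [hu1]
      rw [div_mul_cancel₀ _ b1, add_sub_cancel_right, div_mul_cancel₀ _ (pow_ne_zero _ b0)]
    have hP : (r : ℂ) ^ (2 * n) ≠ 0 := pow_ne_zero _ b0
    rw [hu1r, mul_div_cancel₀ _ b1, pow_succ (r : ℂ) (2 * n), hζ, hdc]
    generalize (r : ℂ) ^ (2 * n) = P at *
    field_simp
    ring) i0 i1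
  constructor
  · filter_upwards [h0, mem] with r hr hrm
    rw [hr]
    exact uz r hrm
  · filter_upwards [eU1, mem] with r hr hrm
    have h1 : HasDerivAt u 0 r := by
      refine (hasDerivAt_const r (0 : ℂ)).congr_of_eventuallyEq ?_
      filter_upwards [isOpen_Ioo.mem_nhds hrm] with s hs
      exact uz s hs
    rw [hr, (du r hrm).unique h1, mul_zero]
    rfl

/-! ### Eigenvectors of the closure -/

lemma exists_seq_of_mem_closure_domain {H : Type*} [NormedAddCommGroup H] [NormedSpace ℂ H]
    (A : H →ₗ.[ℂ] H) (x : A.closure.domain) :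
    ∃ y : ℕ → A.domain, Tendsto (fun m => (y m : H)) atTop (𝓝 (x : H)) ∧
      Tendsto (fun m => A (y m)) atTop (𝓝 (A.closure x)) := by
  have h1 : ((x : H), A.closure x) ∈ A.graph.topologicalClosure := by
    -- For a non-closable operator `closure` is by convention the operator itself, whose graph also
    -- lies in the closed graph. Closability of `L₀` is therefore not needed.
    by_cases hA : A.IsClosable
    · rw [hA.graph_closure_eq_closure_graph]
      exact A.closure.mem_graph x
    · have e : A.closure = A := LinearPMap.closure_def' hA
      exact A.graph.le_topologicalClosure (by
        have := A.closure.mem_graph x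
        rwa [congrArg LinearPMap.graph e] at this)
  obtain ⟨p, hp, hl⟩ := mem_closure_iff_seq_limit.1 h1
  choose y hy using fun m => (LinearPMap.mem_graph_iff A).1 (hp m)
  refine ⟨y, ?_, ?_⟩
  · simp only [(hy _).1]
    exact (continuous_fst.tendsto _).comp hl
  · simp only [(hy _).2]
    exact (continuous_snd.tendsto _).comp hl

section eigen

variable {d : ℕ}

/-- Approximation of an eigenvector by smooth approximate eigenvectors. -/
lemma exists_approx_eigenvector {k : ℕ} {hd : 5 ≤ d} {ho : Odd d} {z : ℂ}
    {U : (generatorL k hd ho).domain} (hU : generatorL k hd ho U = z • (U : HSpace d k)) :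
    ∃ f : ℕ → SmoothPair d k,
      Tendsto (fun m => (f m : HSpace d k)) atTop (𝓝 (U : HSpace d k)) ∧
      Tendsto (fun m => freeOp k hd ho (f m) + potentialOp k hd (f m) - z • f m) atTop (𝓝 0) := by
  obtain ⟨y, h1, h2⟩ := exists_seq_of_mem_closure_domain (freePMap k hd ho) ⟨U, U.2⟩
  choose f hf using fun m => (y m).2
  have hf' : ∀ m, (f m : HSpace d k) = y m := hf
  refine ⟨f, ?_, ?_⟩
  · simp only [hf']
    exact h1
  · have h3 : Tendsto (fun m => freePMap k hd ho (y m) + potentialCLM k hd (y m : HSpace d k) -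
        z • (y m : HSpace d k)) atTop (𝓝 0) := by
      -- The residuals converge to the left side of the eigenvalue equation, which is zero. They are
      -- images of smooth pairs, so the convergence can be read in the norm of `SmoothPair d k`.
      have e : (0 : HSpace d k) = (freePMap k hd ho).closure ⟨U, U.2⟩ +
          potentialCLM k hd (U : HSpace d k) - z • (U : HSpace d k) := by
        rw [← hU, eq_comm, sub_eq_zero, add_comm]
        rfl
      rw [e]
      exact (h2.add (((potentialCLM k hd).continuous.tendsto _).comp h1)).sub (h1.const_smul z)
    have e : ∀ m, freePMap k hd ho (y m) + potentialCLM k hd (y m : HSpace d k) -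
        z • (y m : HSpace d k) =
        ((freeOp k hd ho (f m) + potentialOp k hd (f m) - z • f m : SmoothPair d k) :
          HSpace d k) := by
      intro m
      have e1 : freePMap k hd ho (y m) = (freeOp k hd ho (f m) : HSpace d k) := by
        rw [← freePMap_apply_coe]
        congr 1
        exact Subtype.ext (hf' m).symm
      have e2 : potentialCLM k hd (y m : HSpace d k) = (potentialOp k hd (f m) : HSpace d k) := by
        rw [← hf', potentialCLM]
        exact ContinuousLinearMap.completion_apply_coe _ _
      rw [e1, e2, ← hf', UniformSpace.Completion.coe_sub, UniformSpace.Completion.coe_add,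
        UniformSpace.Completion.coe_smul]
    rw [tendsto_zero_iff_norm_tendsto_zero] at h3 ⊢
    simpa only [e, UniformSpace.Completion.norm_coe] using h3

/-- `W f₁`. -/
def wfst (d k : ℕ) : SmoothPair d k →ₗ[ℂ] CInftyRad d := mulW d ∘ₗ SmoothPair.fst d k

/-- `W f₂`. -/
def wsnd (d k : ℕ) : SmoothPair d k →ₗ[ℂ] CInftyRad d := mulW d ∘ₗ SmoothPair.snd d k

lemma mulW_mulWInv (hd : 3 ≤ d) (ho : Odd d) (h : CInftyRad d) : mulW d (mulWInv hd ho h) = h := by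
  ext y
  change (weightW d y : ℂ) * ((weightW d y : ℂ)⁻¹ * (h : Euc d → ℂ) y) = (h : Euc d → ℂ) y
  by_cases hy : y ∈ unitBall d
  · rw [mul_inv_cancel_left₀ (weightW_ne_zero hy)]
  · simp [h.2.1.2 y hy]

/-- In the variables `W f` the conjugation by `W` disappears. When the residual tends to zero, this
component expresses the limit of `p` through those of `u` and `Λu`. -/
lemma wfst_residual {k : ℕ} (hd : 5 ≤ d) (ho : Odd d) (z : ℂ) (f : SmoothPair d k) :
    wfst d k (freeOp k hd ho f + potentialOp k hd f - z • f) =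
      wsnd d k f - radLambda d (wfst d k f) - ((d : ℂ) - 2 + z) • wfst d k f := by
  have e1 : wfst d k (freeOp k hd ho f) =
      wsnd d k f - radLambda d (wfst d k f) - ((d : ℂ) - 2) • wfst d k f :=
    mulW_mulWInv (by omega) ho _
  have e2 : wfst d k (potentialOp k hd f) = 0 := map_zero (mulW d)
  rw [map_sub, map_add, e1, e2, map_smul, add_smul]
  abel

lemma wsnd_residual {k : ℕ} (hd : 5 ≤ d) (ho : Odd d) (z : ℂ) (f : SmoothPair d k) :
    wsnd d k (freeOp k hd ho f + potentialOp k hd f - z • f) =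
      -radLambda d (wsnd d k f) - wsnd d k f + radLaplacian d (wfst d k f) -
        ((d : ℂ) - 2) • wsnd d k f + mulW d (-mulV hd (SmoothPair.fst d k f)) -
          z • wsnd d k f := by
  have e1 : wsnd d k (freeOp k hd ho f) =
      -radLambda d (wsnd d k f) - wsnd d k f + radLaplacian d (wfst d k f) -
        ((d : ℂ) - 2) • wsnd d k f := mulW_mulWInv (by omega) ho _
  have e2 : wsnd d k (potentialOp k hd f) = mulW d (-mulV hd (SmoothPair.fst d k f)) := rfl
  rw [map_sub, map_add, e1, e2, map_smul]

lemma norm_toL2_le_norm_jet (k : ℕ) (f : CInfty d) : ‖toL2 d f‖ ≤ ‖jet d k f‖ := by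
  have h := norm_toL2_mderiv_le (k := k) (fun _ : Fin d => 0) (by simp) f
  have e : mderiv (fun _ : Fin d => 0) f = f := by simp [mderiv]
  rwa [e] at h

lemma norm_jet_wfst_le {k : ℕ} (f : SmoothPair d k) :
    ‖jet d k (radIncl d (wfst d k f))‖ ≤ ‖f‖ := by
  rw [← sq_le_sq₀ (norm_nonneg _) (norm_nonneg _), SmoothPair.norm_sq d k f]
  exact le_add_of_nonneg_right (sq_nonneg _)

lemma norm_jet_wsnd_le {k : ℕ} (f : SmoothPair d k) :
    ‖jet d (k - 1) (radIncl d (wsnd d k f))‖ ≤ ‖f‖ := by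
  rw [← sq_le_sq₀ (norm_nonneg _) (norm_nonneg _), SmoothPair.norm_sq d k f]
  exact le_add_of_nonneg_left (sq_nonneg _)

variable {e : Euc d} {n : ℕ}

lemma exists_norm_radL2_wfst_le (hd : 5 ≤ d) (hdn : d = 2 * n + 1) (he : ‖e‖ = 1) (k : ℕ) :
    ∃ C : ℝ, ∀ f : SmoothPair d k, ‖(radL2 he n ∘ₗ wfst d k) f‖ ≤ C * ‖f‖ := by
  obtain ⟨K, hK, h⟩ := exists_norm_radL2_equiv hd hdn he
  refine ⟨K⁻¹, fun f => ?_⟩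
  rw [inv_mul_eq_div, le_div_iff₀ hK, mul_comm]
  exact (h _).symm.le.trans ((norm_toL2_le_norm_jet k _).trans (norm_jet_wfst_le f))

lemma exists_norm_radL2_wsnd_le (hd : 5 ≤ d) (hdn : d = 2 * n + 1) (he : ‖e‖ = 1) (k : ℕ) :
    ∃ C : ℝ, ∀ f : SmoothPair d k, ‖(radL2 he n ∘ₗ wsnd d k) f‖ ≤ C * ‖f‖ := by
  obtain ⟨K, hK, h⟩ := exists_norm_radL2_equiv hd hdn he
  refine ⟨K⁻¹, fun f => ?_⟩
  rw [inv_mul_eq_div, le_div_iff₀ hK, mul_comm]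
  exact (h _).symm.le.trans ((norm_toL2_le_norm_jet (k - 1) _).trans (norm_jet_wsnd_le f))

lemma exists_norm_radL2_radLambda_wfst_le (hd : 5 ≤ d) (hdn : d = 2 * n + 1) (he : ‖e‖ = 1)
    {k : ℕ} (hk : 1 ≤ k) :
    ∃ C : ℝ, ∀ f : SmoothPair d k, ‖(radL2 he n ∘ₗ radLambda d ∘ₗ wfst d k) f‖ ≤ C * ‖f‖ := by
  obtain ⟨K, hK, h⟩ := exists_norm_radL2_equiv hd hdn he
  obtain ⟨C, hC, h'⟩ := exists_norm_toL2_radLambda_le d hk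
  refine ⟨C / K, fun f => ?_⟩
  rw [div_mul_eq_mul_div, le_div_iff₀ hK, mul_comm]
  refine (h _).symm.le.trans ((h' _).trans ?_)
  gcongr
  exact norm_jet_wfst_le f

/-- A bounded map from smooth pairs sends a sequence converging in the completion to a convergent
sequence. -/
lemma exists_tendsto_of_bound {k : ℕ} {E : Type*} [NormedAddCommGroup E] [NormedSpace ℂ E]
    [CompleteSpace E] (Φ : SmoothPair d k →ₗ[ℂ] E) (hΦ : ∃ C : ℝ, ∀ f, ‖Φ f‖ ≤ C * ‖f‖)
    {f : ℕ → SmoothPair d k} {U : HSpace d k}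
    (hf : Tendsto (fun m => (f m : HSpace d k)) atTop (𝓝 U)) :
    ∃ a : E, Tendsto (fun m => Φ (f m)) atTop (𝓝 a) := by
  have h1 : CauchySeq f := by
    refine (UniformSpace.Completion.isUniformInducing_coe (SmoothPair d k)).cauchy_map_iff.1 ?_
    rw [Filter.map_map]
    exact hf.cauchySeq
  exact cauchySeq_tendsto_of_complete
    (h1.map (Φ.mkContinuousOfExistsBound hΦ).uniformContinuous)

lemma tendsto_zero_of_bound {k : ℕ} {E : Type*} [NormedAddCommGroup E] [NormedSpace ℂ E]
    (Φ : SmoothPair d k →ₗ[ℂ] E) (hΦ : ∃ C : ℝ, ∀ f, ‖Φ f‖ ≤ C * ‖f‖)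
    {f : ℕ → SmoothPair d k} (hf : Tendsto f atTop (𝓝 0)) :
    Tendsto (fun m => Φ (f m)) atTop (𝓝 0) := by
  have := ((Φ.mkContinuousOfExistsBound hΦ).continuous.tendsto 0).comp hf
  rwa [map_zero] at this

/-- If the `L²` norms of the components tend to zero, then so does the limit in `ℋ^k`. -/
lemma eq_zero_of_tendsto_toL2 {k : ℕ} {f : ℕ → SmoothPair d k} {U : HSpace d k}
    (hf : Tendsto (fun m => (f m : HSpace d k)) atTop (𝓝 U))
    (h1 : Tendsto (fun m => toL2 d (radIncl d (wfst d k (f m)))) atTop (𝓝 0))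
    (h2 : Tendsto (fun m => toL2 d (radIncl d (wsnd d k (f m)))) atTop (𝓝 0)) : U = 0 := by
  obtain ⟨J1, hJ1⟩ := exists_tendsto_of_bound (jet d k ∘ₗ radIncl d ∘ₗ wfst d k)
    ⟨1, fun f => by rw [one_mul]; exact norm_jet_wfst_le f⟩ hf
  obtain ⟨J2, hJ2⟩ := exists_tendsto_of_bound (jet d (k - 1) ∘ₗ radIncl d ∘ₗ wsnd d k)
    ⟨1, fun f => by rw [one_mul]; exact norm_jet_wsnd_le f⟩ hf
  -- The jets converge because they are bounded by the norm of the pair. Each entry of the limit is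
  -- a limit of `∂^α` along a sequence tending to zero in `L²`, hence zero by closability.
  have z1 : J1 = 0 := by
    ext1 α
    exact eq_zero_of_tendsto_of_hasTranspose (hasTranspose_mderiv fun i => (α.1 i : ℕ)) h1
      (((PiLp.continuous_apply 2 _ α).tendsto J1).comp hJ1)
  have z2 : J2 = 0 := by
    ext1 α
    exact eq_zero_of_tendsto_of_hasTranspose (hasTranspose_mderiv fun i => (α.1 i : ℕ)) h2
      (((PiLp.continuous_apply 2 _ α).tendsto J2).comp hJ2)
  have l1 : Tendsto (fun m => ‖f m‖ ^ 2) atTop (𝓝 0) := by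
    have := (hJ1.norm.pow 2).add (hJ2.norm.pow 2)
    rw [z1, z2, norm_zero, norm_zero] at this
    simp only [SmoothPair.norm_sq]
    simpa using! this
  have l2 : Tendsto (fun m => ‖f m‖ ^ 2) atTop (𝓝 (‖U‖ ^ 2)) := by
    simpa only [UniformSpace.Completion.norm_coe] using hf.norm.pow 2
  have := tendsto_nhds_unique l2 l1
  simpa using this

end eigen

/-! ### Absence of unstable eigenvalues of the generator -/

lemma exists_subseq_ae_tendsto {F : ℕ → Lp ℂ 2 intervalMeasure} {G : Lp ℂ 2 intervalMeasure}
    (h : Tendsto F atTop (𝓝 G)) : ∃ φ : ℕ → ℕ, StrictMono φ ∧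
      ∀ᵐ r ∂intervalMeasure, Tendsto (fun k => F (φ k) r) atTop (𝓝 (G r)) :=
  (tendstoInMeasure_of_tendsto_Lp h).exists_seq_tendsto_ae

lemma intervalIntegrable_mul_Lp {m : ℝ → ℂ} (hm : ContinuousOn m (Ioo 0 1))
    (F : Lp ℂ 2 intervalMeasure) {a b : ℝ} (ha : a ∈ Ioo (0 : ℝ) 1) (hb : b ∈ Ioo (0 : ℝ) 1) :
    IntervalIntegrable (fun x => m x * F x) volume a b := by
  have hsub : uIcc a b ⊆ Ioo 0 1 := (ordConnected_Ioo).uIcc_subset ha hb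
  have h1 : IntegrableOn F (Ioo 0 1) := (Lp.memLp F).integrable (by norm_num)
  have h2 : IntervalIntegrable F volume a b := by
    rw [intervalIntegrable_iff]
    exact h1.mono_set (uIoc_subset_uIcc.trans hsub)
  exact h2.continuousOn_mul (hm.mono hsub)

section eigen

variable {d : ℕ} {e : Euc d}

lemma prof_mulW_mulV (he : ‖e‖ = 1) (hd : 5 ≤ d) {k : ℕ} (f : SmoothPair d k) {r : ℝ}
    (hr : r ∈ Ioo (0 : ℝ) 1) :
    prof e (mulW d (-mulV hd (SmoothPair.fst d k f))) r =
      -((potential d r : ℂ) * prof e (wfst d k f) r) := by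
  have hn : ‖r • e‖ = r := by rw [norm_smul, he, mul_one, Real.norm_of_nonneg hr.1.le]
  change (weightW d (r • e) : ℂ) * -((potential d ‖r • e‖ : ℂ) *
    (SmoothPair.fst d k f : Euc d → ℂ) (r • e)) = -((potential d r : ℂ) *
      ((weightW d (r • e) : ℂ) * (SmoothPair.fst d k f : Euc d → ℂ) (r • e)))
  rw [hn]
  ring

/-- The radial flux `r^(d-1) (u' - r p)`. -/
def flux (e : Euc d) (n : ℕ) (g1 g2 : CInftyRad d) (r : ℝ) : ℂ :=
  (r : ℂ) ^ (2 * n) * (prof e (radLambda d g1) r / r - r * prof e g2 r)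

/-- The flux puts the second equation in divergence form: `r^(2n) Δu` is the derivative of `r^(2n)
u'`, and `r^(2n) (Λp + d p)` that of `r^(2n+1) p`. The right side contains no derivative of `u` or
`p`, so convergence in `L²` suffices for the limit even when `k = 1`. -/
lemma hasDerivAt_flux (he : ‖e‖ = 1) {n : ℕ} (hdn : d = 2 * n + 1) (hd : 5 ≤ d) (ho : Odd d)
    {k : ℕ} (z : ℂ) (f : SmoothPair d k) {r : ℝ} (hr : r ∈ Ioo (0 : ℝ) 1) :
    HasDerivAt (flux e n (wfst d k f) (wsnd d k f))
      ((r : ℂ) ^ (2 * n) *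
          prof e (wsnd d k (freeOp k hd ho f + potentialOp k hd f - z • f)) r +
        (z - 1) * (r : ℂ) ^ (2 * n) * prof e (wsnd d k f) r +
        (potential d r : ℂ) * (r : ℂ) ^ (2 * n) * prof e (wfst d k f) r) r := by
  have b0 : (r : ℂ) ≠ 0 := by exact_mod_cast hr.1.ne'
  have hid : HasDerivAt (fun x : ℝ => (x : ℂ)) 1 r := Complex.ofRealCLM.hasDerivAt
  have h1 := hasDerivAt_prof he (radLambda d (wfst d k f)) hr
  have h2 := hasDerivAt_prof he (wsnd d k f) hr
  have h3 := (hid.fun_pow (2 * n)).fun_mul ((h1.fun_div hid b0).fun_sub (hid.fun_mul h2))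
  have hres : prof e (wsnd d k (freeOp k hd ho f + potentialOp k hd f - z • f)) r =
      -prof e (radLambda d (wsnd d k f)) r - prof e (wsnd d k f) r +
        prof e (radLaplacian d (wfst d k f)) r - ((d : ℂ) - 2) * prof e (wsnd d k f) r +
          prof e (mulW d (-mulV hd (SmoothPair.fst d k f))) r - z * prof e (wsnd d k f) r := by
    rw [wsnd_residual]
    rfl
  convert! h3 using 1
  rw [hres, prof_mulW_mulV he hd f hr, prof_radLaplacian he _ hr]
  have hp : (r : ℂ) ^ (2 * n - 1) * (2 * n : ℕ) = (r : ℂ) ^ (2 * n) / r * (2 * n) := by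
    obtain ⟨m, hm⟩ : ∃ m, 2 * n = m + 1 := ⟨2 * n - 1, by omega⟩
    push_cast
    rw [hm, Nat.add_sub_cancel, pow_succ]
    field_simp
  have hdc : (d : ℂ) = 2 * n + 1 := by rw [hdn]; push_cast; ring
  rw [mul_comm ((2 * n : ℕ) : ℂ), hp, hdc]
  generalize (r : ℂ) ^ (2 * n) = P
  field_simp
  ring

/-- From the `ℋ^k` norm only the `L²` convergence of `u`, `Λu`, `p` and of the residuals enters the
equations. The higher derivatives matter only at the end, where closability shows that their limits
vanish. -/
theorem generatorL_not_hasEigenvalue (hd : 5 ≤ d) (ho : Odd d) {k : ℕ} (hk : 1 ≤ k) {z : ℂ}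
    (hz : -1 < z.re) : ¬ HasEigenvalue (generatorL k hd ho) z := by
  rintro ⟨U, hU0, hU⟩
  refine hU0 ?_
  obtain ⟨n, hdn⟩ := id ho
  obtain ⟨e, he⟩ : ∃ e : Euc d, ‖e‖ = 1 :=
    ⟨EuclideanSpace.single (⟨0, by omega⟩ : Fin d) 1, by simp⟩
  obtain ⟨f, hf, hres⟩ := exists_approx_eigenvector hU
  obtain ⟨a0, ha0⟩ := exists_tendsto_of_bound _ (exists_norm_radL2_wfst_le hd hdn he k) hf
  obtain ⟨a1, ha1⟩ :=
    exists_tendsto_of_bound _ (exists_norm_radL2_radLambda_wfst_le hd hdn he hk) hf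
  obtain ⟨a2, ha2⟩ := exists_tendsto_of_bound _ (exists_norm_radL2_wsnd_le hd hdn he k) hf
  have hj := tendsto_zero_of_bound _ (exists_norm_radL2_wsnd_le hd hdn he k) hres
  have hh := tendsto_zero_of_bound _ (exists_norm_radL2_wfst_le hd hdn he k) hres
  simp only [LinearMap.comp_apply] at ha0 ha1 ha2 hj hh
  have hrel : a2 = a1 + ((d : ℂ) - 2 + z) • a0 := by
    have hh' : Tendsto (fun m => radL2 he n (wsnd d k (f m)) -
        radL2 he n (radLambda d (wfst d k (f m))) -
          ((d : ℂ) - 2 + z) • radL2 he n (wfst d k (f m))) atTop (𝓝 0) := by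
      refine hh.congr fun m => ?_
      rw [wfst_residual, map_sub, map_sub, map_smul]
    have := tendsto_nhds_unique hh' ((ha2.sub ha1).sub (ha0.const_smul _))
    rw [eq_comm, sub_eq_zero, sub_eq_iff_eq_add] at this
    rw [this, add_comm]
  have mem : ∀ᵐ r ∂intervalMeasure, r ∈ Ioo (0 : ℝ) 1 := ae_restrict_mem measurableSet_Ioo
  have hr0 : ∀ r ∈ Ioo (0 : ℝ) 1, (r : ℂ) ≠ 0 := fun r hr => by exact_mod_cast hr.1.ne'
  have cof : ContinuousOn (fun r : ℝ => (r : ℂ)) (Ioo 0 1) := Complex.continuous_ofReal.continuousOn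
  have cinv : ∀ j : ℕ, ContinuousOn (fun r : ℝ => ((r : ℂ) ^ j)⁻¹) (Ioo 0 1) := fun j =>
    (cof.pow j).inv₀ fun r hr => pow_ne_zero _ (hr0 r hr)
  have hV : ContinuousOn (fun r : ℝ => (potential d r : ℂ)) (Ioo 0 1) := by
    refine Complex.continuous_ofReal.comp_continuousOn (Continuous.continuousOn ?_)
    have hd' : (5 : ℝ) ≤ d := by exact_mod_cast hd
    refine continuous_const.div (by fun_prop) fun x => ?_
    have : 0 < (d : ℝ) - 4 + x ^ 2 := by nlinarith [sq_nonneg x]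
    positivity
  -- pass to a subsequence along which everything converges almost everywhere
  obtain ⟨φ, hφ, c0⟩ := exists_subseq_ae_tendsto ha0
  obtain ⟨φ', hφ', c1⟩ := exists_subseq_ae_tendsto (ha1.comp hφ.tendsto_atTop)
  obtain ⟨φ'', hφ'', c2⟩ :=
    exists_subseq_ae_tendsto (ha2.comp (hφ.comp hφ').tendsto_atTop)
  set g : ℕ → SmoothPair d k := fun j => f (φ (φ' (φ'' j))) with hg
  have hmono : StrictMono fun j => φ (φ' (φ'' j)) := hφ.comp (hφ'.comp hφ'')
  have hgr : ∀ (G : ℕ → CInftyRad d), ∀ᵐ r ∂intervalMeasure, ∀ j,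
      radL2 he n (G j) r / (r : ℂ) ^ n = prof e (G j) r := fun G => by
    rw [ae_all_iff]
    intro j
    filter_upwards [coeFn_radL2 he n (G j), mem] with r h1 h2
    rw [h1, mul_div_cancel_left₀ _ (pow_ne_zero _ (hr0 r h2))]
  have c0' : ∀ᵐ r ∂intervalMeasure,
      Tendsto (fun j => prof e (wfst d k (g j)) r) atTop (𝓝 (a0 r / (r : ℂ) ^ n)) := by
    filter_upwards [c0, hgr fun j => wfst d k (g j)] with r h1 h2
    exact ((h1.comp (hφ'.comp hφ'').tendsto_atTop).div_const ((r : ℂ) ^ n)).congr h2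
  have c1' : ∀ᵐ r ∂intervalMeasure,
      Tendsto (fun j => prof e (radLambda d (wfst d k (g j))) r) atTop
        (𝓝 (a1 r / (r : ℂ) ^ n)) := by
    filter_upwards [c1, hgr fun j => radLambda d (wfst d k (g j))] with r h1 h2
    exact ((h1.comp hφ''.tendsto_atTop).div_const ((r : ℂ) ^ n)).congr h2
  have c2' : ∀ᵐ r ∂intervalMeasure,
      Tendsto (fun j => prof e (wsnd d k (g j)) r) atTop (𝓝 (a2 r / (r : ℂ) ^ n)) := by
    filter_upwards [c2, hgr fun j => wsnd d k (g j)] with r h1 h2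
    exact (h1.div_const ((r : ℂ) ^ n)).congr h2
  have sub : ∀ {a b : ℝ}, 0 < a → a ≤ b → b < 1 → a ∈ Ioo (0 : ℝ) 1 ∧ b ∈ Ioo (0 : ℝ) 1 :=
    fun ha hab hb => ⟨⟨ha, hab.trans_lt hb⟩, ⟨ha.trans_le hab, hb⟩⟩
  have hL : ∀ (A : Lp ℂ 2 intervalMeasure) (a b : ℝ), 0 < a → a ≤ b → b < 1 →
      IntervalIntegrable (fun r => A r / (r : ℂ) ^ n) volume a b := fun A a b ha hab hb => by
    simp only [div_eq_inv_mul]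
    exact intervalIntegrable_mul_Lp (cinv n) A (sub ha hab hb).1 (sub ha hab hb).2
  have hM : ∀ A : Lp ℂ 2 intervalMeasure,
      Integrable (fun r => r ^ (2 * n) * ‖A r / (r : ℂ) ^ n‖ ^ 2) intervalMeasure := fun A => by
    refine ((memLp_two_iff_integrable_sq_norm (Lp.aestronglyMeasurable A)).1 (Lp.memLp A)).congr ?_
    filter_upwards [mem] with r hr
    rw [norm_div, norm_pow, Complex.norm_real, Real.norm_of_nonneg hr.1.le, div_pow, ← pow_mul,
      mul_comm n 2, mul_div_cancel₀ _ (pow_pos hr.1 _).ne']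
  -- Division by `r^n` undoes the weight in `radL2`. The three remaining goals are the first
  -- equation, `u` as the primitive of `Λu/r`, and the integrated flux identity.
  have hzero := weak_solution_ae_eq_zero (U0 := fun r => a0 r / (r : ℂ) ^ n)
    (U1 := fun r => a1 r / (r : ℂ) ^ n) (U2 := fun r => a2 r / (r : ℂ) ^ n) hd hdn hz
    (hL a0) (hL a1) (hL a2) (hM a0) (hM a1) ?_ ?_ ?_
  · have z0 : a0 = 0 := by
      refine Lp.ext ?_
      filter_upwards [hzero.1, mem, Lp.coeFn_zero ℂ 2 intervalMeasure] with r h1 h2 h3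
      rw [h3]
      exact (div_eq_zero_iff.1 h1).resolve_right (pow_ne_zero _ (hr0 r h2))
    have z1 : a1 = 0 := by
      refine Lp.ext ?_
      filter_upwards [hzero.2, mem, Lp.coeFn_zero ℂ 2 intervalMeasure] with r h1 h2 h3
      rw [h3]
      exact (div_eq_zero_iff.1 h1).resolve_right (pow_ne_zero _ (hr0 r h2))
    have z2 : a2 = 0 := by rw [hrel, z0, z1, smul_zero, add_zero]
    obtain ⟨K, hK, hKe⟩ := exists_norm_radL2_equiv hd hdn he
    rw [z0] at ha0
    rw [z2] at ha2
    refine eq_zero_of_tendsto_toL2 hf ?_ ?_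
    · rw [tendsto_zero_iff_norm_tendsto_zero] at ha0 ⊢
      simp only [hKe]
      simpa using ha0.const_mul K
    · rw [tendsto_zero_iff_norm_tendsto_zero] at ha2 ⊢
      simp only [hKe]
      simpa using ha2.const_mul K
  · rw [hrel]
    filter_upwards [Lp.coeFn_add a1 (((d : ℂ) - 2 + z) • a0),
      Lp.coeFn_smul ((d : ℂ) - 2 + z) a0] with r h1 h2
    rw [h1, Pi.add_apply, h2, Pi.smul_apply, smul_eq_mul]
    ring
  · refine primitive_of_tendsto (s := fun j => prof e (wfst d k (g j)))
      (t := fun j r => prof e (radLambda d (wfst d k (g j))) r / r)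
      (fun j r hr => hasDerivAt_prof he _ hr)
      (fun j => (continuousOn_prof he _).div cof hr0) c0' fun a ha b hb => ?_
    have := tendsto_intervalIntegral_mul (cinv (n + 1))
      (ha1.comp hmono.tendsto_atTop) ha hb
    have e1 : ∫ x in a..b, a1 x / (x : ℂ) ^ n / x = ∫ x in a..b, ((x : ℂ) ^ (n + 1))⁻¹ * a1 x := by
      congr 1
      funext x
      rw [div_div, ← pow_succ, div_eq_inv_mul]
    rw [e1]
    refine this.congr fun j => intervalIntegral_congr_Ioo ?_ ha hb
    filter_upwards [hgr fun j => radLambda d (wfst d k (g j))] with x hx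
    rw [← hx j, div_div, ← pow_succ, div_eq_inv_mul]
    rfl
  · refine primitive_of_tendsto (s := fun j => flux e n (wfst d k (g j)) (wsnd d k (g j)))
      (fun j r hr => hasDerivAt_flux he hdn hd ho z (g j) hr) (fun j => ?_) ?_
      fun a ha b hb => ?_
    · exact (((cof.pow _).mul (continuousOn_prof he _)).add
        ((continuousOn_const.mul (cof.pow _)).mul (continuousOn_prof he _))).add
          ((hV.mul (cof.pow _)).mul (continuousOn_prof he _))
    · filter_upwards [c1', c2'] with r h1 h2
      exact ((h1.div_const _).sub (h2.const_mul _)).const_mul _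
    · have k1 : ContinuousOn (fun r : ℝ => (r : ℂ) ^ n) (Ioo 0 1) := cof.pow _
      have k2 : ContinuousOn (fun r : ℝ => (z - 1) * (r : ℂ) ^ n) (Ioo 0 1) :=
        continuousOn_const.mul (cof.pow _)
      have k3 : ContinuousOn (fun r : ℝ => (potential d r : ℂ) * (r : ℂ) ^ n) (Ioo 0 1) :=
        hV.mul (cof.pow _)
      have key : ∀ A B C : Lp ℂ 2 intervalMeasure,
          (∫ x in a..b, (x : ℂ) ^ n * A x) + (∫ x in a..b, (z - 1) * (x : ℂ) ^ n * B x) +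
            (∫ x in a..b, (potential d x : ℂ) * (x : ℂ) ^ n * C x) =
          ∫ x in a..b, ((x : ℂ) ^ n * A x + (z - 1) * (x : ℂ) ^ n * B x +
            (potential d x : ℂ) * (x : ℂ) ^ n * C x) := by
        intro A B C
        have i1 := intervalIntegrable_mul_Lp k1 A ha hb
        have i2 := intervalIntegrable_mul_Lp k2 B ha hb
        have i3 := intervalIntegrable_mul_Lp k3 C ha hb
        rw [intervalIntegral.integral_add (i1.add i2) i3, intervalIntegral.integral_add i1 i2]
      -- The residual tends to zero in `L²`, so only the terms in `p` and `u` survive in the limit.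
      have hlim := ((tendsto_intervalIntegral_mul k1 (hj.comp hmono.tendsto_atTop) ha hb).add
        (tendsto_intervalIntegral_mul k2 (ha2.comp hmono.tendsto_atTop) ha hb)).add
        (tendsto_intervalIntegral_mul k3 (ha0.comp hmono.tendsto_atTop) ha hb)
      simp only [key] at hlim
      have e1 : ∀ x : ℝ, (x : ℂ) ^ (2 * n) = (x : ℂ) ^ n * (x : ℂ) ^ n := fun x => by
        rw [two_mul, pow_add]
      have e2 : ∫ x in a..b, (x : ℂ) ^ (2 * n) * ((z - 1) * (a2 x / (x : ℂ) ^ n) +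
          (potential d x : ℂ) * (a0 x / (x : ℂ) ^ n)) =
          ∫ x in a..b, ((x : ℂ) ^ n * (0 : Lp ℂ 2 intervalMeasure) x +
            (z - 1) * (x : ℂ) ^ n * a2 x + (potential d x : ℂ) * (x : ℂ) ^ n * a0 x) := by
        refine intervalIntegral_congr_Ioo ?_ ha hb
        filter_upwards [mem, Lp.coeFn_zero ℂ 2 intervalMeasure] with x hx h0
        have := pow_ne_zero n (hr0 x hx)
        rw [h0, e1]
        simp only [Pi.zero_apply]
        field_simp
        ring
      rw [e2]
      refine hlim.congr fun j => intervalIntegral_congr_Ioo ?_ ha hb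
      filter_upwards [mem, hgr fun j => wfst d k (g j), hgr fun j => wsnd d k (g j),
        hgr fun j => wsnd d k (freeOp k hd ho (g j) + potentialOp k hd (g j) - z • g j)]
        with x hx h1 h2 h3
      have := pow_ne_zero n (hr0 x hx)
      rw [← h1 j, ← h2 j, ← h3 j, e1]
      simp only [Function.comp_apply, hg]
      field_simp

end eigen

end

end HypWaveMap

theorem mainTheorem5 (d : ℕ) (hd : 5 ≤ d) (ho : Odd d) :
    IsSelfAdjoint (HypWaveMap.slOperator d) ∧
    (∀ μ : ℝ, μ < 0 → ¬ HypWaveMap.HasEigenvalue (HypWaveMap.slOperator d) (μ : ℂ)) ∧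
    (∀ k : ℕ, 1 ≤ k → ∀ z : ℂ, -1 < z.re →
      ¬ HypWaveMap.HasEigenvalue (HypWaveMap.generatorL k hd ho) z) :=
  ⟨HypWaveMap.slOperator_isSelfAdjoint hd,
    fun _ hμ => HypWaveMap.slOperator_not_hasEigenvalue_of_neg hd hμ,
    fun _ hk _ hz => HypWaveMap.generatorL_not_hasEigenvalue hd ho hk hz⟩
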